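/- For every constant $a\in\mathbb N$ there are a deterministic word-RAM data structure (four fixed programs: preprocessing, pattern update, text update, query) and constants $c,k\in\mathbb N$ and $C$, all depending only on $a$, such that the following holds for all integers $2\le m\le n\le 2m$, all real $0<\varepsilon\le 1$, every alphabet $\Sigma=\{0,\dots,\sigma-1\}$ of polynomial size $\sigma\le (m+1)^a$, and every word size $w$ with $2^w\ge (m+\lceil 1/\varepsilon\rceil)^c$. Given an initial pattern $P\in\Sigma^m$ and an initial text $T\in\Sigma^n$ (together with $m,n,\sigma$ and $\lceil 1/\varepsilon\rceil$), the data structure preprocesses them (no bound on the preprocessing time is claimed) and then serves any sequence of the following operations: an update $(j,x)$ of the pattern, which sets $P[j]:=x$; an update $(j,x)$ of the text, which sets $T[j]:=x$; and a query at a position $i$ with $0\le i\le n-m$ (positions are counted from $0$), which returns an integer $v$ with $$H\le v\le(1+\varepsilon)H,$$ where $H$ is the Hamming distance between the current $P$ and the current $T[i],\dots,T[i+m-1]$. Every update and every query takes at most $C\,\varepsilon^{-2}\sqrt m\,(\log m)^k$ steps in the worst case, i.e. $O(\varepsilon^{-2}\sqrt m\,\mathrm{polylog}\, m)$ time, and preprocessing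 and all operations together use at most $C\,\varepsilon^{-2}m(\log m)^2$ words of memory, i.e. $O(\varepsilon^{-2}m\log^2 m)$ space. Here the word RAM has $w$-bit words, a constant number of registers, and unit-cost arithmetic (addition, subtraction, multiplication, division with remainder), bitwise operations, shifts, comparisons, memory reads and writes, and branching. -/

import Mathlib

/-! ## A deterministic word RAM with a step count

Words have `w` bits, i.e. they are the naturals below `2 ^ w`, and arithmetic is modulo `2 ^ w`.
A machine has finitely many registers (those its program mentions) and a memory of `S` words at
the addresses `0, …, S - 1`.  Programs are structured (sequencing, branching, loops). -/

/-- The binary word operations. -/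
inductive WordOp where
  | add | sub | mul | div | mod | and | or | xor | shl | shr | lt | eq

/-- The value of a word operation on `w`-bit words (division by `0` gives `0`, and `x mod 0 = x`;
comparisons give `0` or `1`). -/
def WordOp.eval (w : ℕ) (o : WordOp) (x y : ℕ) : ℕ :=
  (match o with
    | .add => x + y
    | .sub => x + 2 ^ w - y
    | .mul => x * y
    | .div => x / y
    | .mod => x % y
    | .and => x &&& y
    | .or => x ||| y
    | .xor => x ^^^ y
    | .shl => x <<< y
    | .shr => x >>> y
    | .lt => if x < y then 1 else 0
    | .eq => if x = y then 1 else 0) % 2 ^ w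

/-- Word RAM programs; `d`, `x`, `y` are register names. -/
inductive Cmd where
  /-- do nothing -/
  | skip
  /-- `d := v`, for a number `v` written in the program -/
  | const (d v : ℕ)
  /-- `d := x o y` -/
  | op (o : WordOp) (d x y : ℕ)
  /-- `d := memory[x]` -/
  | load (d x : ℕ)
  /-- `memory[x] := y` -/
  | store (x y : ℕ)
  /-- first `p`, then `q` -/
  | seq (p q : Cmd)
  /-- `p` if register `x` is not zero, `q` otherwise -/
  | ifnz (x : ℕ) (p q : Cmd)
  /-- repeat `p` while register `x` is not zero -/
  | loop (x : ℕ) (p : Cmd)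

/-- The contents of the registers and of the memory. -/
structure RamState where
  reg : ℕ → ℕ
  mem : ℕ → ℕ

/-- Write `v` to register `d`. -/
def RamState.setReg (s : RamState) (d v : ℕ) : RamState :=
  { s with reg := Function.update s.reg d v }

/-- Write `v` to the memory cell with address `l`. -/
def RamState.setMem (s : RamState) (l v : ℕ) : RamState :=
  { s with mem := Function.update s.mem l v }

/-- `Exec w S p s s' t`: on the machine with `w`-bit words and `S` memory cells, the program `p`,
started in state `s`, halts in state `s'` after exactly `t` steps.  Every instruction and every
test costs one step.  An access to an address `≥ S` has no successor state, so an execution exists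
only if the program halts and stays within its `S` cells. -/
inductive Exec (w S : ℕ) : Cmd → RamState → RamState → ℕ → Prop where
  | skip (s : RamState) : Exec w S .skip s s 1
  | const (s : RamState) (d v : ℕ) : Exec w S (.const d v) s (s.setReg d (v % 2 ^ w)) 1
  | op (s : RamState) (o : WordOp) (d x y : ℕ) :
      Exec w S (.op o d x y) s (s.setReg d (o.eval w (s.reg x) (s.reg y))) 1
  | load (s : RamState) (d x : ℕ) (h : s.reg x < S) :
      Exec w S (.load d x) s (s.setReg d (s.mem (s.reg x))) 1
  | store (s : RamState) (x y : ℕ) (h : s.reg x < S) :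
      Exec w S (.store x y) s (s.setMem (s.reg x) (s.reg y)) 1
  | seq {p q : Cmd} {s s₁ s₂ : RamState} {t₁ t₂ : ℕ} (hp : Exec w S p s s₁ t₁)
      (hq : Exec w S q s₁ s₂ t₂) : Exec w S (.seq p q) s s₂ (t₁ + t₂)
  | ifTrue {x : ℕ} {p q : Cmd} {s s' : RamState} {t : ℕ} (hx : s.reg x ≠ 0)
      (hp : Exec w S p s s' t) : Exec w S (.ifnz x p q) s s' (t + 1)
  | ifFalse {x : ℕ} {p q : Cmd} {s s' : RamState} {t : ℕ} (hx : s.reg x = 0)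
      (hq : Exec w S q s s' t) : Exec w S (.ifnz x p q) s s' (t + 1)
  | loopDone {x : ℕ} {p : Cmd} {s : RamState} (hx : s.reg x = 0) : Exec w S (.loop x p) s s 1
  | loopStep {x : ℕ} {p : Cmd} {s s₁ s₂ : RamState} {t₁ t₂ : ℕ} (hx : s.reg x ≠ 0)
      (hp : Exec w S p s s₁ t₁) (hl : Exec w S (.loop x p) s₁ s₂ t₂) :
      Exec w S (.loop x p) s s₂ (t₁ + t₂ + 1)

/-- The machine is deterministic: final state and number of steps are determined. -/
theorem Exec.deterministic {w S : ℕ} {p : Cmd} {s s₁ s₂ : RamState} {t₁ t₂ : ℕ}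
    (h₁ : Exec w S p s s₁ t₁) (h₂ : Exec w S p s s₂ t₂) : s₁ = s₂ ∧ t₁ = t₂ := by
  induction h₁ generalizing s₂ t₂ with
  | skip | const | op | load | store => cases h₂; exact ⟨rfl, rfl⟩
  | seq _ _ ihp ihq =>
    cases h₂ with
    | seq hp hq =>
      obtain ⟨rfl, rfl⟩ := ihp hp
      obtain ⟨rfl, rfl⟩ := ihq hq
      exact ⟨rfl, rfl⟩
  | ifTrue hx _ ih =>
    cases h₂ with
    | ifTrue _ hp => obtain ⟨rfl, rfl⟩ := ih hp; exact ⟨rfl, rfl⟩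
    | ifFalse hx' _ => exact absurd hx' hx
  | ifFalse hx _ ih =>
    cases h₂ with
    | ifTrue hx' _ => exact absurd hx hx'
    | ifFalse _ hp => obtain ⟨rfl, rfl⟩ := ih hp; exact ⟨rfl, rfl⟩
  | loopDone hx =>
    cases h₂ with
    | loopDone _ => exact ⟨rfl, rfl⟩
    | loopStep hx' _ _ => exact absurd hx hx'
  | loopStep hx _ _ ihp ihl =>
    cases h₂ with
    | loopDone hx' => exact absurd hx' hx
    | loopStep _ hp hl =>
      obtain ⟨rfl, rfl⟩ := ihp hp
      obtain ⟨rfl, rfl⟩ := ihl hl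
      exact ⟨rfl, rfl⟩

/-! ## Dynamic approximate Hamming distance -/

/-- The programs of a dynamic data structure on a pattern and a text. -/
structure DynProgram where
  /-- preprocessing of the initial pattern and text -/
  init : Cmd
  /-- substitution of one letter of the pattern -/
  updatePattern : Cmd
  /-- substitution of one letter of the text -/
  updateText : Cmd
  /-- query at a position of the text -/
  query : Cmd

/-- The state before preprocessing: the pattern is in the cells `0, …, m - 1`, the text in the cells
`m, …, m + n - 1`, and the parameters `m`, `n`, `σ`, `e` are in the registers `0, 1, 2, 3`;
everything else is zero. -/
def inputState {m n σ : ℕ} (e : ℕ) (P : Fin m → Fin σ) (T : Fin n → Fin σ) : RamState where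
  reg r := if r = 0 then m else if r = 1 then n else if r = 2 then σ else if r = 3 then e else 0
  mem l := if h : l < m then (P ⟨l, h⟩ : ℕ)
    else if h' : l - m < n then (T ⟨l - m, h'⟩ : ℕ) else 0

/-- `D.Reaches w S e P₀ T₀ P T s`: after preprocessing `P₀`, `T₀`, some finite sequence of updates
and queries leads to the current pattern `P`, the current text `T` and the machine state `s`.
The arguments of an operation are passed in the registers `0` and `1`; registers and memory
persist from one operation to the next. -/
inductive DynProgram.Reaches (D : DynProgram) (w S : ℕ) {m n σ : ℕ} (e : ℕ)
    (P₀ : Fin m → Fin σ) (T₀ : Fin n → Fin σ) :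
    (Fin m → Fin σ) → (Fin n → Fin σ) → RamState → Prop where
  | init {s : RamState} {t : ℕ} (h : Exec w S D.init (inputState e P₀ T₀) s t) :
      Reaches D w S e P₀ T₀ P₀ T₀ s
  | updatePattern {P : Fin m → Fin σ} {T : Fin n → Fin σ} {s s' : RamState} {t : ℕ}
      (j : Fin m) (x : Fin σ) (hs : Reaches D w S e P₀ T₀ P T s)
      (h : Exec w S D.updatePattern ((s.setReg 0 j).setReg 1 x) s' t) :
      Reaches D w S e P₀ T₀ (Function.update P j x) T s'
  | updateText {P : Fin m → Fin σ} {T : Fin n → Fin σ} {s s' : RamState} {t : ℕ}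
      (j : Fin n) (x : Fin σ) (hs : Reaches D w S e P₀ T₀ P T s)
      (h : Exec w S D.updateText ((s.setReg 0 j).setReg 1 x) s' t) :
      Reaches D w S e P₀ T₀ P (Function.update T j x) s'
  | query {P : Fin m → Fin σ} {T : Fin n → Fin σ} {s s' : RamState} {t : ℕ}
      (i : ℕ) (hi : i + m ≤ n) (hs : Reaches D w S e P₀ T₀ P T s)
      (h : Exec w S D.query (s.setReg 0 i) s' t) :
      Reaches D w S e P₀ T₀ P T s'

/-- The substring of length `m` of the text `T` that starts at position `i` (counted from `0`). -/
def window {m n σ : ℕ} (T : Fin n → Fin σ) (i : ℕ) (hi : i + m ≤ n) : Fin m → Fin σ :=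
  fun j => T ⟨i + j, by have := j.isLt; omega⟩

/-- On the machine with `w`-bit words and `S` memory cells, the programs `D` solve the dynamic
`(1 + ε)`-approximate Hamming distance problem for patterns of length `m` and texts of length `n`
over the alphabet `{0, …, σ - 1}`, with updates to both: preprocessing halts, and after any finite
sequence of operations every update and every query takes at most `τ` steps, and a query at `i`
leaves in register `0` a number `v` with `H ≤ v ≤ (1 + ε) H`, where `H` is the Hamming distance of
the current pattern and the current substring of the text at `i`.
The real parameter `ε` is communicated to the machine as the integer `⌈1 / ε⌉`. -/
def DynProgram.SolvesApproxHD (D : DynProgram) (w S : ℕ) (τ : ℝ) (m n σ : ℕ) (ε : ℝ) : Prop :=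
  ∀ (P₀ : Fin m → Fin σ) (T₀ : Fin n → Fin σ),
    (∃ s t, Exec w S D.init (inputState ⌈1 / ε⌉₊ P₀ T₀) s t) ∧
    ∀ (P : Fin m → Fin σ) (T : Fin n → Fin σ) (s : RamState),
      D.Reaches w S ⌈1 / ε⌉₊ P₀ T₀ P T s →
        (∀ (j : Fin m) (x : Fin σ), ∃ s' t,
          Exec w S D.updatePattern ((s.setReg 0 j).setReg 1 x) s' t ∧ (t : ℝ) ≤ τ) ∧
        (∀ (j : Fin n) (x : Fin σ), ∃ s' t,
          Exec w S D.updateText ((s.setReg 0 j).setReg 1 x) s' t ∧ (t : ℝ) ≤ τ) ∧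
        (∀ (i : ℕ) (hi : i + m ≤ n), ∃ s' t,
          Exec w S D.query (s.setReg 0 i) s' t ∧ (t : ℝ) ≤ τ ∧
          (hammingDist P (window T i hi) : ℝ) ≤ s'.reg 0 ∧
          (s'.reg 0 : ℝ) ≤ (1 + ε) * hammingDist P (window T i hi))

/-! A letter below `2 ^ d` is read as the polynomial over `ZMod p` whose coefficients are its binary
digits, and is hashed by evaluation at every `t < p`. This is a Reed–Solomon code: distinct letters
agree at no more than `d` of the `p` points (`agree_le_of_ne`), equal letters at all of them. If `E`
is the number of agreements, summed over the `m` aligned pairs of letters, then `(p - d) * H ≤ p * m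
- E ≤ p * H` (`mismatches_approx`). The prime `p` exceeds `2 (d + 1) ⌈1 / ε⌉`, so `p / (p - d) ≤ 1 +
ε`, and `(p * m - E) / (p - d)`, rounded down, is a valid answer (`answer_bounds`). No randomness is
needed because all points are used; `d` is logarithmic in `m`, and Bertrand's postulate keeps `p`
within a constant factor of `d / ε`.

For fixed strings, `E` is obtained at all positions at once: for each of the `p ^ 2` pairs of a
point `t` and a value `r`, mark the letters whose hash at `t` is `r`, and add up the correlations of
the marks of the pattern with those of the text (`sum_corrCount`). A correlation is computed by fast
Fourier transforms in fixed point arithmetic. A complex number is stored as four naturals, its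
weights on the powers of `I`, so no negative number occurs. The total error stays below `1 / 2`,
hence rounding yields the exact integer (`corrLevel_round`). The roots of unity come from the
half-angle formula and integer square roots (`goodTwiddles_table`).

For changing strings, time is cut into epochs of `B` updates, with `B` of order `√m`. Let `X` be the
current string (pattern followed by text), `F` the string at the start of the epoch and `G` the
string at the start of the previous one. During an epoch the agreements for the frozen string `F`
are computed in `B` equal slices, one per update, so they are ready when the epoch ends; a slice
costs `√m` up to logarithms and `1 / ε ^ 2`. A query takes the known agreements for `G` and corrects
them by the logs of the substitutions from `G` to `F` and from `F` to `X`, which have at most `B`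
entries each. Writing `M Y Y'` for the agreements of the pattern of `Y` with the text of `Y'`, the
correction is `(M X G - M G G) + (M X X - M X G)`: substituted pattern letters are compared with the
text of `G`, substituted text letters with the pattern of `X`, and each entry costs one pass over
the hash points (`IsLog.sums`, `query_spec`). At the end of an epoch the logs are replayed and the
roles rotate (`flush_spec`).

The programs are written in a language over `ℕ` whose semantics requires all stored values to stay
below a bound that is polynomial in `m` and `⌈1 / ε⌉`. Compilation costs a constant factor in time
and a constant power in the word range (`HExec.code_exec`). In units of `N`, the memory holds `X`
from 0, `F` from 2, `G` from 4, the two logs from 6 and 8, two arrays of results from 10 and 14, the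
twiddle factors from 18 and the transform cells from 20; the bit `yb` tells which log is the older
one and which array holds the counts for `G`. -/

/-! ## A small imperative language over the natural numbers

Programs are written with expressions over named variables, evaluated exactly in `ℕ`, and compiled
to word RAM programs.  An execution is only defined while all stored values are at most `V`. -/

/-- The variables of the programs; the first four are the input registers. -/
inductive Vr where
  | a0 | a1 | sg | e | m | n | B | N | K | D | d | p | Z | g | cnt | lo | yb | Q
  | i | k | xv | t | h | pw | q | h1 | h2 | h3 | pos | old | new | o | pl | mi | c | s
  | ph | sec | ix | kk | grp | lv
  deriving DecidableEq

/-- The register that holds a variable. -/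
def Vr.reg (x : Vr) : ℕ := x.ctorIdx

/-- This leaves the registers from 64 on as temporaries of compiled code. -/
theorem Vr.reg_lt (x : Vr) : x.reg < 64 := by cases x <;> decide

theorem Vr.reg_injective : Function.Injective Vr.reg := by
  intro x y h
  have key : ∀ x : Vr, Vr.ofNat x.reg = x := by intro x; cases x <;> rfl
  rw [← key x, ← key y, h]

/-- Binary operations of the language; `sub` is truncated. -/
inductive BOp where
  | add | sub | mul | div | mod | lt | eq

/-- The value of a binary operation. -/
def BOp.eval : BOp → ℕ → ℕ → ℕ
  | .add, x, y => x + y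
  | .sub, x, y => x - y
  | .mul, x, y => x * y
  | .div, x, y => x / y
  | .mod, x, y => x % y
  | .lt, x, y => if x < y then 1 else 0
  | .eq, x, y => if x = y then 1 else 0

/-- Expressions. -/
inductive Expr where
  | lit (c : ℕ)
  | var (x : Vr)
  | load (e : Expr)
  | bin (o : BOp) (a b : Expr)
  | pow2 (e : Expr)

instance : Add Expr := ⟨.bin .add⟩
instance : Sub Expr := ⟨.bin .sub⟩
instance : Mul Expr := ⟨.bin .mul⟩
instance : Div Expr := ⟨.bin .div⟩
instance : Mod Expr := ⟨.bin .mod⟩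
instance (c : ℕ) : OfNat Expr c := ⟨.lit c⟩
instance : Coe Vr Expr := ⟨.var⟩

/-- `a.lt b` is `1` if `a < b` and `0` otherwise. -/
def Expr.lt (a b : Expr) : Expr := .bin .lt a b

/-- `a.eq b` is `1` if `a = b` and `0` otherwise. -/
def Expr.eq (a b : Expr) : Expr := .bin .eq a b

/-- Powers of an expression with a fixed exponent. -/
def Expr.pow (a : Expr) : ℕ → Expr
  | 0 => .lit 1
  | k + 1 => .bin .mul (a.pow k) a

/-- The values of the variables and of the memory. -/
@[ext] structure St where
  var : Vr → ℕ
  mem : ℕ → ℕ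

/-- Assign to a variable. -/
def St.set (s : St) (x : Vr) (v : ℕ) : St := { s with var := Function.update s.var x v }

/-- Write to a memory cell. -/
def St.put (s : St) (l v : ℕ) : St := { s with mem := Function.update s.mem l v }

@[simp] theorem St.set_var (s : St) (x y : Vr) (v : ℕ) :
    (s.set x v).var y = if y = x then v else s.var y := by
  simp [St.set, Function.update_apply]

@[simp] theorem St.set_mem (s : St) (x : Vr) (v : ℕ) : (s.set x v).mem = s.mem := rfl

@[simp] theorem St.put_var (s : St) (l v : ℕ) : (s.put l v).var = s.var := rfl

@[simp] theorem St.put_mem (s : St) (l v : ℕ) : (s.put l v).mem = Function.update s.mem l v := rfl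

/-- The value of an expression. -/
def Expr.eval (s : St) : Expr → ℕ
  | .lit c => c
  | .var x => s.var x
  | .load e => s.mem (e.eval s)
  | .bin o a b => o.eval (a.eval s) (b.eval s)
  | .pow2 e => 2 ^ e.eval s

/-- All loads of an expression are in range and all its powers are bounded. -/
def Expr.ok (V S : ℕ) (s : St) : Expr → Prop
  | .lit _ => True
  | .var _ => True
  | .load e => e.ok V S s ∧ e.eval s < S
  | .bin _ a b => a.ok V S s ∧ b.ok V S s
  | .pow2 e => e.ok V S s ∧ 2 ^ e.eval s ≤ V

/-- An exponent `k` such that `V ^ k` bounds the value of the expression and all intermediate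
values. -/
def Expr.deg : Expr → ℕ
  | .lit c => c + 1
  | .var _ => 1
  | .load e => e.deg
  | .bin .add a b => max a.deg b.deg + 1
  | .bin .mul a b => a.deg + b.deg
  | .bin _ a b => max a.deg b.deg
  | .pow2 e => e.deg

section evalLemmas
variable (s : St) (V S : ℕ) (a b : Expr) (x : Vr) (c : ℕ)
@[simp] theorem Expr.eval_add : (a + b).eval s = a.eval s + b.eval s := rfl
@[simp] theorem Expr.eval_sub : (a - b).eval s = a.eval s - b.eval s := rfl
@[simp] theorem Expr.eval_mul : (a * b).eval s = a.eval s * b.eval s := rfl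
@[simp] theorem Expr.eval_div : (a / b).eval s = a.eval s / b.eval s := rfl
@[simp] theorem Expr.eval_mod : (a % b).eval s = a.eval s % b.eval s := rfl
@[simp] theorem Expr.eval_ofNat : (no_index (OfNat.ofNat c) : Expr).eval s = c := rfl
@[simp] theorem Expr.eval_lit : (Expr.lit c).eval s = c := rfl
@[simp] theorem Expr.eval_var : (Expr.var x).eval s = s.var x := rfl
@[simp] theorem Expr.eval_load : (Expr.load a).eval s = s.mem (a.eval s) := rfl
@[simp] theorem Expr.eval_lt : (a.lt b).eval s = if a.eval s < b.eval s then 1 else 0 := rfl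
@[simp] theorem Expr.eval_eq : (a.eq b).eval s = if a.eval s = b.eval s then 1 else 0 := rfl
@[simp] theorem Expr.eval_pow2 : (Expr.pow2 a).eval s = 2 ^ a.eval s := rfl
@[simp] theorem Expr.eval_pow : (a.pow c).eval s = a.eval s ^ c := by
  induction c with
  | zero => rfl
  | succ c ih => rw [pow_succ, ← ih]; rfl
@[simp] theorem Expr.ok_add : (a + b).ok V S s ↔ a.ok V S s ∧ b.ok V S s := Iff.rfl
@[simp] theorem Expr.ok_sub : (a - b).ok V S s ↔ a.ok V S s ∧ b.ok V S s := Iff.rfl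
@[simp] theorem Expr.ok_mul : (a * b).ok V S s ↔ a.ok V S s ∧ b.ok V S s := Iff.rfl
@[simp] theorem Expr.ok_div : (a / b).ok V S s ↔ a.ok V S s ∧ b.ok V S s := Iff.rfl
@[simp] theorem Expr.ok_mod : (a % b).ok V S s ↔ a.ok V S s ∧ b.ok V S s := Iff.rfl
@[simp] theorem Expr.ok_lt : (a.lt b).ok V S s ↔ a.ok V S s ∧ b.ok V S s := Iff.rfl
@[simp] theorem Expr.ok_eq : (a.eq b).ok V S s ↔ a.ok V S s ∧ b.ok V S s := Iff.rfl
@[simp] theorem Expr.ok_ofNat : (no_index (OfNat.ofNat c) : Expr).ok V S s := trivial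
@[simp] theorem Expr.ok_lit : (Expr.lit c).ok V S s := trivial
@[simp] theorem Expr.ok_var : (Expr.var x).ok V S s := trivial
@[simp] theorem Expr.ok_load : (Expr.load a).ok V S s ↔ a.ok V S s ∧ a.eval s < S := Iff.rfl
@[simp] theorem Expr.ok_pow2 : (Expr.pow2 a).ok V S s ↔ a.ok V S s ∧ 2 ^ a.eval s ≤ V := Iff.rfl
theorem Expr.ok_pow (h : a.ok V S s) : (a.pow c).ok V S s := by
  induction c with
  | zero => trivial
  | succ c ih => exact ⟨ih, h⟩
end evalLemmas

/-- All variables and memory cells are at most `V`. -/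
structure St.Bdd (V : ℕ) (s : St) : Prop where
  var : ∀ x, s.var x ≤ V
  mem : ∀ l, s.mem l ≤ V

theorem St.Bdd.set {V : ℕ} {s : St} (h : s.Bdd V) (x : Vr) {v : ℕ} (hv : v ≤ V) :
    (s.set x v).Bdd V := by
  refine ⟨fun y => ?_, h.mem⟩
  rw [St.set_var]; split_ifs
  exacts [hv, h.var y]

theorem St.Bdd.put {V : ℕ} {s : St} (h : s.Bdd V) (l : ℕ) {v : ℕ} (hv : v ≤ V) :
    (s.put l v).Bdd V := by
  refine ⟨h.var, fun y => ?_⟩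
  rw [St.put_mem, Function.update_apply]; split_ifs
  exacts [hv, h.mem y]

theorem Expr.one_le_deg (e : Expr) : 1 ≤ e.deg := by
  induction e with
  | lit | var => simp [Expr.deg]
  | load e ih | pow2 e ih => simpa [Expr.deg] using ih
  | bin o a b iha ihb => cases o <;> simp [Expr.deg] <;> omega

theorem Expr.deg_left_le (o : BOp) (a b : Expr) : a.deg ≤ (Expr.bin o a b).deg := by
  cases o <;> simp [Expr.deg]
  omega

theorem Expr.deg_right_le (o : BOp) (a b : Expr) : b.deg ≤ (Expr.bin o a b).deg := by
  cases o <;> simp [Expr.deg]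
  omega

/-- Induction: a literal is below `2 ^ c ≤ V ^ c`, a sum costs one extra factor `V ≥ 2`, a product
adds the exponents, and the other operations do not grow. Hence `V ^ deg < 2 ^ w` excludes overflow.
-/
theorem Expr.eval_le {V S : ℕ} (hV : 2 ≤ V) {s : St} (hs : s.Bdd V) (e : Expr)
    (he : e.ok V S s) : e.eval s ≤ V ^ e.deg := by
  induction e with
  | lit c =>
    calc c ≤ 2 ^ c := Nat.lt_two_pow_self.le
      _ ≤ V ^ c := Nat.pow_le_pow_left hV c
      _ ≤ V ^ (c + 1) := Nat.pow_le_pow_right (by omega) (by omega)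
  | var x => simpa [Expr.deg] using hs.var x
  | load e ih =>
    exact (hs.mem _).trans (Nat.le_self_pow (by have := e.one_le_deg; simp [Expr.deg]; omega) V)
  | pow2 e ih =>
    exact he.2.trans (Nat.le_self_pow (by have := e.one_le_deg; simp [Expr.deg]; omega) V)
  | bin o a b iha ihb =>
    have ha := iha he.1
    have hb := ihb he.2
    have one : 1 ≤ V ^ (Expr.bin o a b).deg := Nat.one_le_pow _ _ (by omega)
    have left : a.eval s ≤ V ^ (Expr.bin o a b).deg :=
      ha.trans (Nat.pow_le_pow_right (by omega) (Expr.deg_left_le o a b))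
    cases o with
    | add =>
      have h1 := ha.trans (Nat.pow_le_pow_right (n := V) (by omega) (le_max_left a.deg b.deg))
      have h2 := hb.trans (Nat.pow_le_pow_right (n := V) (by omega) (le_max_right a.deg b.deg))
      show a.eval s + b.eval s ≤ V ^ (max a.deg b.deg + 1)
      rw [pow_succ]; nlinarith [Nat.zero_le (V ^ max a.deg b.deg)]
    | mul =>
      show a.eval s * b.eval s ≤ V ^ (a.deg + b.deg)
      rw [pow_add]; exact Nat.mul_le_mul ha hb
    | sub => exact (Nat.sub_le _ _).trans left
    | div => exact (Nat.div_le_self _ _).trans left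
    | mod => exact (Nat.mod_le _ _).trans left
    | lt => show (if _ then 1 else 0) ≤ _; split_ifs <;> omega
    | eq => show (if _ then 1 else 0) ≤ _; split_ifs <;> omega

/-! ### Compilation of expressions -/

/-- Code for a binary operation on the registers `r` and `r + 1`. -/
def BOp.code (r : ℕ) : BOp → Cmd
  | .add => .op .add r r (r + 1)
  | .sub => .seq (.op .lt (r + 2) (r + 1) r) (.seq (.op .sub r r (r + 1)) (.op .mul r r (r + 2)))
  | .mul => .op .mul r r (r + 1)
  | .div => .op .div r r (r + 1)
  | .mod => .op .mod r r (r + 1)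
  | .lt => .op .lt r r (r + 1)
  | .eq => .op .eq r r (r + 1)

/-- Code that leaves the value of an expression in register `r`; only registers from `r` on are
changed. -/
def Expr.code (r : ℕ) : Expr → Cmd
  | .lit c => .const r c
  | .var x => .op .or r x.reg x.reg
  | .load e => .seq (e.code r) (.load r r)
  | .bin o a b => .seq (a.code r) (.seq (b.code (r + 1)) (o.code r))
  | .pow2 e => .seq (e.code r) (.seq (.const (r + 1) 1) (.op .shl r (r + 1) r))

/-- The number of steps of `BOp.code`. -/
def BOp.cost : BOp → ℕ
  | .sub => 3
  | _ => 1

/-- The number of steps of `Expr.code`. -/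
def Expr.cost : Expr → ℕ
  | .lit _ => 1
  | .var _ => 1
  | .load e => e.cost + 1
  | .bin o a b => a.cost + (b.cost + o.cost)
  | .pow2 e => e.cost + (1 + 1)

/-- The machine state `l` represents the state `s`. -/
structure Sim (s : St) (l : RamState) : Prop where
  var : ∀ x : Vr, l.reg x.reg = s.var x
  mem : l.mem = s.mem

/-- Only truncated subtraction needs an argument: the machine subtracts modulo `2 ^ w`, and
multiplication by the comparison bit annuls a wrapped result. -/
theorem BOp.code_exec {w S : ℕ} (r : ℕ) (o : BOp) (l : RamState)
    (h0 : l.reg r < 2 ^ w) (h : o.eval (l.reg r) (l.reg (r + 1)) < 2 ^ w) (h1 : 1 < 2 ^ w) :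
    ∃ l', Exec w S (o.code r) l l' o.cost ∧ l'.reg r = o.eval (l.reg r) (l.reg (r + 1)) ∧
      (∀ q, q < r → l'.reg q = l.reg q) ∧ l'.mem = l.mem := by
  cases o with
  | sub =>
    refine ⟨_, .seq (.op _ _ _ _ _) (.seq (.op _ _ _ _ _) (.op _ _ _ _ _)), ?_, ?_, rfl⟩
    · simp only [RamState.setReg, Function.update_self, WordOp.eval, BOp.eval]
      rw [Function.update_of_ne (by omega), Function.update_of_ne (by omega),
        Function.update_of_ne (by omega), Function.update_self]
      by_cases hlt : l.reg (r + 1) < l.reg r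
      · simp only [hlt, if_true]
        rw [Nat.mod_eq_of_lt h1, mul_one, Nat.mod_mod,
          show l.reg r + 2 ^ w - l.reg (r + 1) = (l.reg r - l.reg (r + 1)) + 2 ^ w by omega,
          Nat.add_mod_right]
        exact Nat.mod_eq_of_lt h
      · simp [hlt]; omega
    · intro q hq
      simp only [RamState.setReg]
      rw [Function.update_of_ne (by omega), Function.update_of_ne (by omega),
        Function.update_of_ne (by omega)]
  | _ =>
    refine ⟨_, .op _ _ _ _ _, ?_, fun q hq => ?_, rfl⟩
    · simp only [RamState.setReg, Function.update_self, WordOp.eval]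
      exact Nat.mod_eq_of_lt h
    · simp only [RamState.setReg]
      rw [Function.update_of_ne (by omega)]

/-- The registers from `r` on act as a stack: the second operand is evaluated from `r + 1` on, so
the first one survives, and `64 ≤ r` protects the variables. -/
theorem Expr.code_exec {w V S : ℕ} (hV : 2 ≤ V) {s : St} (hs : s.Bdd V) (e : Expr)
    (he : e.ok V S s) (hw : V ^ e.deg < 2 ^ w) {l : RamState} {r : ℕ} (hr : 64 ≤ r)
    (hl : Sim s l) :
    ∃ l', Exec w S (e.code r) l l' e.cost ∧ l'.reg r = e.eval s ∧
      (∀ q, q < r → l'.reg q = l.reg q) ∧ l'.mem = l.mem := by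
  have sim' : ∀ {l l' : RamState} {r : ℕ}, 64 ≤ r → Sim s l →
      (∀ q, q < r → l'.reg q = l.reg q) → l'.mem = l.mem → Sim s l' := fun hr hl h1 h2 =>
    ⟨fun x => by rw [h1 _ (by have := x.reg_lt; omega), hl.var], by rw [h2, hl.mem]⟩
  have upd : ∀ (l : RamState) (r v : ℕ), ∀ q, q < r → (l.setReg r v).reg q = l.reg q := by
    intro l r v q hq
    simp only [RamState.setReg]
    rw [Function.update_of_ne (by omega)]
  have V1 : 1 < 2 ^ w := lt_of_le_of_lt (Nat.one_le_pow _ _ (by omega)) hw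
  induction e generalizing l r with
  | lit c =>
    refine ⟨_, .const _ _ _, ?_, upd l r _, rfl⟩
    simp only [RamState.setReg, Function.update_self]
    exact Nat.mod_eq_of_lt (lt_of_le_of_lt (Expr.eval_le hV hs _ he) hw)
  | var x =>
    refine ⟨_, .op _ _ _ _ _, ?_, upd l r _, rfl⟩
    simp only [RamState.setReg, Function.update_self, WordOp.eval, Nat.or_self, hl.var]
    exact Nat.mod_eq_of_lt (lt_of_le_of_lt (Expr.eval_le hV hs _ he) hw)
  | load e ih =>
    obtain ⟨l', h1, h2, h3, h4⟩ := ih he.1 hw hr hl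
    refine ⟨_, .seq h1 (.load _ _ _ (by rw [h2]; exact he.2)), ?_, fun q hq => ?_, h4⟩
    · simp only [RamState.setReg, Function.update_self, h2, h4, hl.mem]; rfl
    · rw [upd _ _ _ _ hq, h3 _ hq]
  | pow2 e ih =>
    obtain ⟨l', h1, h2, h3, h4⟩ := ih he.1 hw hr hl
    refine ⟨_, .seq h1 (.seq (.const _ _ _) (.op _ _ _ _ _)), ?_, fun q hq => ?_, h4⟩
    · simp only [RamState.setReg, Function.update_self, WordOp.eval]
      rw [Function.update_of_ne (by omega), h2, Nat.mod_eq_of_lt V1, Nat.one_shiftLeft]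
      exact Nat.mod_eq_of_lt (lt_of_le_of_lt (Expr.eval_le hV hs _ he) hw)
    · rw [upd _ _ _ _ hq, upd _ _ _ _ (by omega), h3 _ hq]
  | bin o a b iha ihb =>
    have hwa : V ^ a.deg < 2 ^ w := lt_of_le_of_lt
      (Nat.pow_le_pow_right (by omega) (Expr.deg_left_le o a b)) hw
    have hwb : V ^ b.deg < 2 ^ w := lt_of_le_of_lt
      (Nat.pow_le_pow_right (by omega) (Expr.deg_right_le o a b)) hw
    obtain ⟨l₁, a1, a2, a3, a4⟩ := iha he.1 hwa hr hl
    obtain ⟨l₂, b1, b2, b3, b4⟩ := ihb he.2 hwb (r := r + 1) (by omega) (sim' hr hl a3 a4)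
    have e1 : l₂.reg r = a.eval s := by rw [b3 _ (by omega), a2]
    have hlt := lt_of_le_of_lt (Expr.eval_le hV hs _ he) hw
    obtain ⟨l₃, c1, c2, c3, c4⟩ := BOp.code_exec (w := w) (S := S) r o l₂
      (by rw [e1]; exact lt_of_le_of_lt (Expr.eval_le hV hs _ he.1) hwa)
      (by rw [e1, b2]; exact hlt) V1
    refine ⟨l₃, .seq a1 (.seq b1 c1), ?_, fun q hq => ?_, by rw [c4, b4, a4]⟩
    · rw [c2, e1, b2]; rfl
    · rw [c3 _ hq, b3 _ (by omega), a3 _ hq]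

/-! ### Programs, their semantics and their compilation -/

/-- Programs. -/
inductive Prog where
  | skip
  | assign (x : Vr) (e : Expr)
  | store (a b : Expr)
  | seq (p q : Prog)
  | ite (e : Expr) (p q : Prog)
  | while (e : Expr) (p : Prog)

/-- Big-step semantics with a step count, for programs all of whose values stay below `V` and whose
addresses stay below `S`. -/
inductive HExec (V S : ℕ) : Prog → St → St → ℕ → Prop where
  | skip (s : St) : HExec V S .skip s s 1
  | assign (s : St) (x : Vr) (e : Expr) (hok : e.ok V S s) (hv : e.eval s ≤ V) :
      HExec V S (.assign x e) s (s.set x (e.eval s)) 1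
  | store (s : St) (a b : Expr) (ha : a.ok V S s) (hb : b.ok V S s) (hS : a.eval s < S)
      (hv : b.eval s ≤ V) : HExec V S (.store a b) s (s.put (a.eval s) (b.eval s)) 1
  | seq {p q : Prog} {s s₁ s₂ : St} {t₁ t₂ : ℕ} (hp : HExec V S p s s₁ t₁)
      (hq : HExec V S q s₁ s₂ t₂) : HExec V S (.seq p q) s s₂ (t₁ + t₂)
  | iteTrue {e : Expr} {p q : Prog} {s s' : St} {t : ℕ} (hok : e.ok V S s) (he : e.eval s ≠ 0)
      (hp : HExec V S p s s' t) : HExec V S (.ite e p q) s s' (t + 1)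
  | iteFalse {e : Expr} {p q : Prog} {s s' : St} {t : ℕ} (hok : e.ok V S s) (he : e.eval s = 0)
      (hq : HExec V S q s s' t) : HExec V S (.ite e p q) s s' (t + 1)
  | whileDone {e : Expr} {p : Prog} {s : St} (hok : e.ok V S s) (he : e.eval s = 0) :
      HExec V S (.while e p) s s 1
  | whileStep {e : Expr} {p : Prog} {s s₁ s₂ : St} {t₁ t₂ : ℕ} (hok : e.ok V S s)
      (he : e.eval s ≠ 0) (hp : HExec V S p s s₁ t₁) (hl : HExec V S (.while e p) s₁ s₂ t₂) :
      HExec V S (.while e p) s s₂ (t₁ + t₂ + 1)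

/-- The compiler. -/
def Prog.code : Prog → Cmd
  | .skip => .skip
  | .assign x e => .seq (e.code 64) (.op .or x.reg 64 64)
  | .store a b => .seq (a.code 64) (.seq (b.code 65) (.store 64 65))
  | .seq p q => .seq p.code q.code
  | .ite e p q => .seq (e.code 64) (.ifnz 64 p.code q.code)
  | .while e p => .seq (e.code 64) (.loop 64 (.seq p.code (e.code 64)))

/-- An exponent that bounds all expressions of a program. -/
def Prog.deg : Prog → ℕ
  | .skip => 1
  | .assign _ e => e.deg
  | .store a b => max a.deg b.deg
  | .seq p q => max p.deg q.deg
  | .ite e p q => max e.deg (max p.deg q.deg)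
  | .while e p => max e.deg p.deg

/-- A bound for the number of machine steps for each step of a program. -/
def Prog.cost : Prog → ℕ
  | .skip => 1
  | .assign _ e => e.cost + 1
  | .store a b => a.cost + (b.cost + 1)
  | .seq p q => max p.cost q.cost
  | .ite e p q => max (e.cost + 1) (max p.cost q.cost)
  | .while e p => max (e.cost + 1) p.cost

theorem Sim.congr {s : St} {l l' : RamState} (hl : Sim s l)
    (h1 : ∀ q, q < 64 → l'.reg q = l.reg q) (h2 : l'.mem = l.mem) : Sim s l' :=
  ⟨fun x => by rw [h1 _ x.reg_lt, hl.var], by rw [h2, hl.mem]⟩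

theorem HExec.bdd {V S : ℕ} {p : Prog} {s s' : St} {t : ℕ} (h : HExec V S p s s' t)
    (hs : s.Bdd V) : s'.Bdd V := by
  induction h with
  | skip | whileDone => exact hs
  | assign s x e hok hv => exact hs.set _ hv
  | store s a b ha hb hS hv => exact hs.put _ hv
  | seq _ _ ih1 ih2 => exact ih2 (ih1 hs)
  | iteTrue _ _ _ ih | iteFalse _ _ _ ih => exact ih hs
  | whileStep _ _ _ _ ih1 ih2 => exact ih2 (ih1 hs)

/-- By induction on the execution: each source step turns into at most `c` machine steps, and the
absence of overflow comes from `Expr.code_exec`, because all states remain bounded by `V`. -/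
theorem HExec.code_exec {w V S : ℕ} (hV : 2 ≤ V) {p : Prog} {s s' : St} {t c : ℕ}
    (h : HExec V S p s s' t) (hs : s.Bdd V) (hw : V ^ p.deg < 2 ^ w) (hc : p.cost ≤ c)
    {l : RamState} (hl : Sim s l) :
    ∃ l' t', Exec w S p.code l l' t' ∧ t' ≤ c * t ∧ Sim s' l' := by
  have lew : ∀ {i j : ℕ}, i ≤ j → V ^ j < 2 ^ w → V ^ i < 2 ^ w := fun hij h =>
    lt_of_le_of_lt (Nat.pow_le_pow_right (by omega) hij) h
  induction h generalizing l with
  | skip s => exact ⟨l, 1, .skip l, by simpa [Prog.cost] using hc, hl⟩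
  | assign s x e hok hv =>
    obtain ⟨l', h1, h2, h3, h4⟩ := Expr.code_exec (w := w) hV hs e hok hw (r := 64) le_rfl hl
    refine ⟨_, _, .seq h1 (.op _ _ _ _ _), by simpa [Prog.cost] using hc, ?_, ?_⟩
    · intro y
      simp only [RamState.setReg, WordOp.eval, Nat.or_self, h2, Function.update_apply,
        St.set_var, Vr.reg_injective.eq_iff]
      split_ifs
      · exact Nat.mod_eq_of_lt (lt_of_le_of_lt (Expr.eval_le hV hs _ hok) hw)
      · rw [h3 _ y.reg_lt, hl.var]
    · simp only [RamState.setReg, h4, hl.mem, St.set_mem]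
  | store s a b ha hb hS hv =>
    have hwa := lew (le_max_left a.deg b.deg) hw
    have hwb := lew (le_max_right a.deg b.deg) hw
    obtain ⟨l₁, a1, a2, a3, a4⟩ := Expr.code_exec (w := w) hV hs a ha hwa (r := 64) le_rfl hl
    obtain ⟨l₂, b1, b2, b3, b4⟩ := Expr.code_exec (w := w) hV hs b hb hwb (r := 65) (by omega)
      (hl.congr a3 a4)
    have e1 : l₂.reg 64 = a.eval s := by rw [b3 _ (by omega), a2]
    refine ⟨_, _, .seq a1 (.seq b1 (.store _ _ _ (by rw [e1]; exact hS))),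
      by simpa [Prog.cost] using hc, ?_, ?_⟩
    · intro x
      have := x.reg_lt
      simp only [RamState.setMem, St.put_var]
      rw [b3 _ (by omega), a3 _ this, hl.var]
    · simp only [RamState.setMem, St.put_mem, e1, b2, b4, a4, hl.mem]
  | seq hp hq ih1 ih2 =>
    obtain ⟨l₁, t₁, a1, a2, a3⟩ := ih1 hs (lew (le_max_left _ _) hw)
      ((le_max_left _ _).trans hc) hl
    obtain ⟨l₂, t₂, b1, b2, b3⟩ := ih2 (hp.bdd hs) (lew (le_max_right _ _) hw)
      ((le_max_right _ _).trans hc) a3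
    exact ⟨l₂, _, .seq a1 b1, by rw [mul_add]; omega, b3⟩
  | @iteTrue e p q s s' t hok he hp ih =>
    simp only [Prog.cost, Prog.deg] at hc hw
    obtain ⟨l₁, a1, a2, a3, a4⟩ := Expr.code_exec (w := w) hV hs e hok
      (lew (by omega) hw) (r := 64) le_rfl hl
    obtain ⟨l₂, t₂, b1, b2, b3⟩ := ih hs (lew (by omega) hw) (by omega) (hl.congr a3 a4)
    exact ⟨l₂, _, .seq a1 (.ifTrue (by rw [a2]; exact he) b1), by rw [mul_add]; omega, b3⟩
  | @iteFalse e p q s s' t hok he hp ih =>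
    simp only [Prog.cost, Prog.deg] at hc hw
    obtain ⟨l₁, a1, a2, a3, a4⟩ := Expr.code_exec (w := w) hV hs e hok
      (lew (by omega) hw) (r := 64) le_rfl hl
    obtain ⟨l₂, t₂, b1, b2, b3⟩ := ih hs (lew (by omega) hw) (by omega) (hl.congr a3 a4)
    exact ⟨l₂, _, .seq a1 (.ifFalse (by rw [a2]; exact he) b1), by rw [mul_add]; omega, b3⟩
  | @whileDone e p s hok he =>
    simp only [Prog.cost, Prog.deg] at hc hw
    obtain ⟨l₁, a1, a2, a3, a4⟩ := Expr.code_exec (w := w) hV hs e hok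
      (lew (by omega) hw) (r := 64) le_rfl hl
    exact ⟨l₁, _, .seq a1 (.loopDone (by rw [a2]; exact he)), by omega, hl.congr a3 a4⟩
  | @whileStep e p s s₁ s₂ t₁ t₂ hok he hp hl' ih1 ih2 =>
    have hc' := hc
    have hw' := hw
    simp only [Prog.cost, Prog.deg] at hc hw
    obtain ⟨l₁, a1, a2, a3, a4⟩ := Expr.code_exec (w := w) hV hs e hok
      (lew (by omega) hw) (r := 64) le_rfl hl
    obtain ⟨l₂, u₂, b1, b2, b3⟩ := ih1 hs (lew (by omega) hw) (by omega) (hl.congr a3 a4)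
    obtain ⟨l₃, u₃, c1, c2, c3⟩ := ih2 (hp.bdd hs) hw' hc' b3
    -- The condition is compiled twice, before the loop and at the end of its body. The induction
    -- hypothesis provides an execution of the remaining loop that starts with the first copy; that
    -- part is moved into the loop body as the second copy.
    cases c1 with
    | seq d1 d2 =>
      refine ⟨l₃, _, .seq a1 (.loopStep (by rw [a2]; exact he) (.seq b1 d1) d2), ?_, c3⟩
      have : e.cost + 1 ≤ c := by omega
      rw [mul_add, mul_add]; omega

/-! ### Total correctness with a time bound -/

/-- The program halts from `s` within `T` steps in a state that satisfies `R`. -/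
def WP (V S : ℕ) (p : Prog) (s : St) (T : ℕ) (R : St → Prop) : Prop :=
  ∃ s' t, HExec V S p s s' t ∧ t ≤ T ∧ R s'

/-- The program halts from `s` in a state that satisfies `R`. -/
def Halts (V S : ℕ) (p : Prog) (s : St) (R : St → Prop) : Prop :=
  ∃ s' t, HExec V S p s s' t ∧ R s'

section WPrules
variable {V S : ℕ} {p q : Prog} {s : St} {T T' : ℕ} {R R' : St → Prop} {e : Expr}

theorem WP.halts (h : WP V S p s T R) : Halts V S p s R := by
  obtain ⟨s', t, h1, -, h2⟩ := h
  exact ⟨s', t, h1, h2⟩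

theorem WP.mono (h : WP V S p s T R) (hT : T ≤ T') (hR : ∀ s', R s' → R' s') :
    WP V S p s T' R' := by
  obtain ⟨s', t, h1, h2, h3⟩ := h
  exact ⟨s', t, h1, h2.trans hT, hR _ h3⟩

theorem Halts.mono (h : Halts V S p s R) (hR : ∀ s', R s' → R' s') : Halts V S p s R' := by
  obtain ⟨s', t, h1, h3⟩ := h
  exact ⟨s', t, h1, hR _ h3⟩

theorem WP.skip (h : R s) : WP V S .skip s 1 R := ⟨s, 1, .skip s, le_rfl, h⟩

theorem WP.assign {x : Vr} (hok : e.ok V S s) (hv : e.eval s ≤ V) (h : R (s.set x (e.eval s))) :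
    WP V S (.assign x e) s 1 R := ⟨_, 1, .assign s x e hok hv, le_rfl, h⟩

theorem WP.store {a b : Expr} (ha : a.ok V S s) (hb : b.ok V S s) (hS : a.eval s < S)
    (hv : b.eval s ≤ V) (h : R (s.put (a.eval s) (b.eval s))) : WP V S (.store a b) s 1 R :=
  ⟨_, 1, .store s a b ha hb hS hv, le_rfl, h⟩

theorem WP.seq (h : WP V S p s T fun s₁ => WP V S q s₁ T' R) : WP V S (.seq p q) s (T + T') R := by
  obtain ⟨s₁, t₁, a1, a2, s₂, t₂, b1, b2, b3⟩ := h
  exact ⟨s₂, _, .seq a1 b1, by omega, b3⟩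

theorem Halts.seq (h : Halts V S p s fun s₁ => Halts V S q s₁ R) : Halts V S (.seq p q) s R := by
  obtain ⟨s₁, t₁, a1, s₂, t₂, b1, b3⟩ := h
  exact ⟨s₂, _, .seq a1 b1, b3⟩

theorem WP.ite (hok : e.ok V S s) (h1 : e.eval s ≠ 0 → WP V S p s T R)
    (h2 : e.eval s = 0 → WP V S q s T R) : WP V S (.ite e p q) s (T + 1) R := by
  by_cases he : e.eval s = 0
  · obtain ⟨s', t, a1, a2, a3⟩ := h2 he
    exact ⟨s', _, .iteFalse hok he a1, by omega, a3⟩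
  · obtain ⟨s', t, a1, a2, a3⟩ := h1 he
    exact ⟨s', _, .iteTrue hok he a1, by omega, a3⟩

/-- For loops with a known number of rounds, which is what gives time bounds. `Halts.while_measure`
serves loops of preprocessing, where termination is enough. -/
theorem WP.while_count (I : ℕ → St → Prop) (n : ℕ) (h0 : I 0 s)
    (hstep : ∀ k s, k < n → I k s → e.ok V S s ∧ e.eval s ≠ 0 ∧ WP V S p s T (I (k + 1)))
    (hdone : ∀ s, I n s → e.ok V S s ∧ e.eval s = 0) :
    WP V S (.while e p) s (n * (T + 1) + 1) (I n) := by
  have key : ∀ j k s, j + k = n → I k s → WP V S (.while e p) s (j * (T + 1) + 1) (I n) := by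
    intro j
    induction j with
    | zero =>
      intro k s hk hI
      obtain rfl : k = n := by omega
      obtain ⟨h1, h2⟩ := hdone s hI
      exact ⟨s, 1, .whileDone h1 h2, by omega, hI⟩
    | succ j ih =>
      intro k s hk hI
      obtain ⟨h1, h2, s₁, t₁, a1, a2, a3⟩ := hstep k s (by omega) hI
      obtain ⟨s₂, t₂, b1, b2, b3⟩ := ih (k + 1) s₁ (by omega) a3
      exact ⟨s₂, _, .whileStep h1 h2 a1 b1, by rw [Nat.succ_mul]; omega, b3⟩
  exact key n 0 s (by omega) h0

theorem Halts.while_measure (I : St → Prop) (μ : St → ℕ) (h0 : I s)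
    (hok : ∀ s, I s → e.ok V S s)
    (hstep : ∀ s, I s → e.eval s ≠ 0 → Halts V S p s fun s' => I s' ∧ μ s' < μ s) :
    Halts V S (.while e p) s fun s' => I s' ∧ e.eval s' = 0 := by
  induction hμ : μ s using Nat.strong_induction_on generalizing s with
  | _ j ih =>
    by_cases he : e.eval s = 0
    · exact ⟨s, 1, .whileDone (hok s h0) he, h0, he⟩
    · obtain ⟨s₁, t₁, a1, a2, a3⟩ := hstep s h0 he
      obtain ⟨s₂, t₂, b1, b2⟩ := ih _ (hμ ▸ a3) a2 rfl
      exact ⟨s₂, _, .whileStep (hok s h0) he a1 b1, b2⟩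

end WPrules

/-! ### Frame rules -/

/-- The variables that a program assigns to. -/
def Prog.writes : Prog → List Vr
  | .skip => []
  | .assign x _ => [x]
  | .store _ _ => []
  | .seq p q => p.writes ++ q.writes
  | .ite _ p q => p.writes ++ q.writes
  | .while _ p => p.writes

/-- The program does not write to the memory. -/
def Prog.readOnly : Prog → Bool
  | .skip => true
  | .assign _ _ => true
  | .store _ _ => false
  | .seq p q => p.readOnly && q.readOnly
  | .ite _ p q => p.readOnly && q.readOnly
  | .while _ p => p.readOnly

theorem HExec.var_eq {V S : ℕ} {p : Prog} {s s' : St} {t : ℕ} (h : HExec V S p s s' t) {x : Vr}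
    (hx : x ∉ p.writes) : s'.var x = s.var x := by
  induction h with
  | skip | whileDone | store => rfl
  | assign s y e => simp only [Prog.writes, List.mem_singleton] at hx; simp [hx]
  | seq _ _ ih1 ih2 =>
    simp only [Prog.writes, List.mem_append, not_or] at hx
    rw [ih2 hx.2, ih1 hx.1]
  | iteTrue _ _ _ ih => exact ih fun h => hx (List.mem_append_left _ h)
  | iteFalse _ _ _ ih => exact ih fun h => hx (List.mem_append_right _ h)
  | whileStep _ _ _ _ ih1 ih2 => rw [ih2 hx, ih1 hx]

theorem HExec.mem_eq {V S : ℕ} {p : Prog} {s s' : St} {t : ℕ} (h : HExec V S p s s' t)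
    (hp : p.readOnly = true) : s'.mem = s.mem := by
  induction h with
  | skip | whileDone | assign => rfl
  | store => simp [Prog.readOnly] at hp
  | seq _ _ ih1 ih2 =>
    simp only [Prog.readOnly, Bool.and_eq_true] at hp
    rw [ih2 hp.2, ih1 hp.1]
  | iteTrue _ _ _ ih => simp only [Prog.readOnly, Bool.and_eq_true] at hp; exact ih hp.1
  | iteFalse _ _ _ ih => simp only [Prog.readOnly, Bool.and_eq_true] at hp; exact ih hp.2
  | whileStep _ _ _ _ ih1 ih2 => rw [ih2 hp, ih1 hp]

/-- Supplies what specifications leave out: unassigned variables, the memory of a program without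
stores, and the bound on all values are preserved for syntactic reasons. -/
theorem WP.frame {V S : ℕ} {p : Prog} {s : St} {T : ℕ} {R : St → Prop} (h : WP V S p s T R) :
    WP V S p s T fun s' => R s' ∧ (∀ x, x ∉ p.writes → s'.var x = s.var x) ∧
      (p.readOnly = true → s'.mem = s.mem) ∧ (s.Bdd V → s'.Bdd V) := by
  obtain ⟨s', t, h1, h2, h3⟩ := h
  exact ⟨s', t, h1, h2, h3, fun x hx => h1.var_eq hx, fun hp => h1.mem_eq hp, h1.bdd⟩

theorem Halts.frame {V S : ℕ} {p : Prog} {s : St} {R : St → Prop} (h : Halts V S p s R) :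
    Halts V S p s fun s' => R s' ∧ (∀ x, x ∉ p.writes → s'.var x = s.var x) ∧
      (p.readOnly = true → s'.mem = s.mem) ∧ (s.Bdd V → s'.Bdd V) := by
  obtain ⟨s', t, h1, h3⟩ := h
  exact ⟨s', t, h1, h3, fun x hx => h1.var_eq hx, fun hp => h1.mem_eq hp, h1.bdd⟩

/-! ## Hashing letters -/

/-- The polynomial with the `d` lowest binary digits of `x` as coefficients, evaluated at `t`
modulo `p`. -/
def hashVal (p t : ℕ) : ℕ → ℕ → ℕ
  | 0, _ => 0
  | d + 1, x => (hashVal p t d (x / 2) * t + x % 2) % p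

/-- The number of evaluation points at which the hash values of `x` and `y` agree. -/
def agree (p d x y : ℕ) : ℕ := ((Finset.range p).filter fun t => hashVal p t d x = hashVal p t d y).card

/-- The polynomial with the `d` lowest binary digits of `x` as coefficients. -/
noncomputable def digitPoly (p : ℕ) : ℕ → ℕ → Polynomial (ZMod p)
  | 0, _ => 0
  | d + 1, x => digitPoly p d (x / 2) * Polynomial.X + Polynomial.C ((x % 2 : ℕ) : ZMod p)

theorem hashVal_lt {p : ℕ} (hp : 0 < p) (t d x : ℕ) : hashVal p t d x < p := by
  cases d with
  | zero => exact hp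
  | succ d => exact Nat.mod_lt _ hp

theorem hashVal_cast (p t d x : ℕ) : (hashVal p t d x : ZMod p) = (digitPoly p d x).eval (t : ZMod p) := by
  induction d generalizing x with
  | zero => simp [hashVal, digitPoly]
  | succ d ih => simp [hashVal, digitPoly, ih]

theorem digitPoly_degree_lt (p d x : ℕ) : (digitPoly p d x).degree < d := by
  rw [Polynomial.degree_lt_iff_coeff_zero]
  induction d generalizing x with
  | zero => simp [digitPoly]
  | succ d ih =>
    intro k hk
    obtain ⟨k, rfl⟩ : ∃ k', k = k' + 1 := ⟨k - 1, by omega⟩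
    simp [digitPoly, ih (x / 2) k (by omega)]

/-- The constant coefficient determines the parity because `0 ≠ 1` modulo `p`, and the higher
coefficients form the polynomial of `x / 2`. -/
theorem digitPoly_injOn {p : ℕ} (hp : 2 ≤ p) {d x y : ℕ} (hx : x < 2 ^ d) (hy : y < 2 ^ d)
    (h : digitPoly p d x = digitPoly p d y) : x = y := by
  induction d generalizing x y with
  | zero => simp at hx hy; omega
  | succ d ih =>
    have h0 := congrArg (fun q => Polynomial.coeff q 0) h
    have h1 : digitPoly p d (x / 2) = digitPoly p d (y / 2) := by
      ext k
      have := congrArg (fun q => Polynomial.coeff q (k + 1)) h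
      simpa [digitPoly, Polynomial.coeff_C] using this
    have h2 := ih (by rw [pow_succ] at hx; omega) (by rw [pow_succ] at hy; omega) h1
    simp only [digitPoly, Polynomial.coeff_add, Polynomial.mul_coeff_zero, Polynomial.coeff_X_zero,
      mul_zero, zero_add, Polynomial.coeff_C_zero] at h0
    rw [ZMod.natCast_eq_natCast_iff'] at h0
    rw [Nat.mod_eq_of_lt (show x % 2 < p by omega), Nat.mod_eq_of_lt (show y % 2 < p by omega)] at h0
    omega

theorem agree_self (p d x : ℕ) : agree p d x x = p := by simp [agree]

theorem agree_comm (p d x y : ℕ) : agree p d x y = agree p d y x := by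
  simp only [agree, eq_comm]

theorem agree_le (p d x y : ℕ) : agree p d x y ≤ p := by
  simpa [agree] using Finset.card_filter_le (Finset.range p) _

/-- An agreement is a root of the difference of the two digit polynomials, which is nonzero and of
degree below `d`; the points `t < p` are distinct in `ZMod p`. -/
theorem agree_le_of_ne {p : ℕ} (hp : p.Prime) {d x y : ℕ} (hx : x < 2 ^ d) (hy : y < 2 ^ d)
    (h : x ≠ y) : agree p d x y ≤ d := by
  have := Fact.mk hp
  set f := digitPoly p d x - digitPoly p d y with hf
  have hf0 : f ≠ 0 := fun h0 => h (digitPoly_injOn hp.two_le hx hy (sub_eq_zero.mp h0))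
  have hdeg : f.degree < d := (Polynomial.degree_sub_le _ _).trans_lt
    (max_lt (digitPoly_degree_lt p d x) (digitPoly_degree_lt p d y))
  have hcard : f.roots.toFinset.card ≤ d := by
    refine (Multiset.toFinset_card_le _).trans ?_
    have h1 := Polynomial.card_roots hf0
    exact_mod_cast h1.trans hdeg.le
  refine le_trans ?_ hcard
  refine Finset.card_le_card_of_injOn (fun t => (t : ZMod p)) ?_ ?_
  · intro t ht
    simp only [Finset.coe_filter, Set.mem_ofPred_eq] at ht
    rw [Finset.mem_coe, Multiset.mem_toFinset, Polynomial.mem_roots hf0, Polynomial.IsRoot.def, hf,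
      Polynomial.eval_sub, ← hashVal_cast, ← hashVal_cast, ht.2, sub_self]
  · intro t ht u hu htu
    simp only [Finset.coe_filter, Set.mem_ofPred_eq, Finset.mem_range] at ht hu
    have := (ZMod.natCast_eq_natCast_iff' _ _ _).mp htu
    rwa [Nat.mod_eq_of_lt ht.1, Nat.mod_eq_of_lt hu.1] at this

/-- The number of agreements determines the number of mismatches up to a factor `p / (p - d)`. -/
theorem mismatches_approx {p d m : ℕ} (hp : p.Prime) (f g : ℕ → ℕ) (hf : ∀ j < m, f j < 2 ^ d)
    (hg : ∀ j < m, g j < 2 ^ d) {H : ℕ} (hH : H = ((Finset.range m).filter fun j => f j ≠ g j).card) :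
    ∑ j ∈ Finset.range m, agree p d (f j) (g j) + (p - d) * H ≤ p * m ∧
      p * m ≤ ∑ j ∈ Finset.range m, agree p d (f j) (g j) + p * H := by
  have hH' : H = ∑ j ∈ Finset.range m, if f j ≠ g j then 1 else 0 := by rw [hH, Finset.card_filter]
  have hpm : p * m = ∑ j ∈ Finset.range m, p := by simp [mul_comm]
  rw [hH', hpm, Finset.mul_sum, Finset.mul_sum, ← Finset.sum_add_distrib, ← Finset.sum_add_distrib]
  -- Both inequalities hold for each position separately: a mismatch has at most `d` agreements, a
  -- match has exactly `p`.
  constructor <;> refine Finset.sum_le_sum fun j hj => ?_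
  · have hj := Finset.mem_range.mp hj
    split_ifs with h
    · have := agree_le_of_ne hp (hf j hj) (hg j hj) h
      have := agree_le p d (f j) (g j)
      omega
    · have := agree_le p d (f j) (g j)
      omega
  · split_ifs with h
    · omega
    · rw [not_ne_iff.mp h, agree_self]; omega

/-- Rounding down keeps the lower bound because `H` is an integer. The upper bound is `p * H / (p -
d)`, and `ε * p ≥ 2 * (d + 1) ≥ (1 + ε) * d` gives `p ≤ (1 + ε) * (p - d)`. -/
theorem answer_bounds {p d e m E H : ℕ} {ε : ℝ} (hε : 0 < ε) (hε1 : ε ≤ 1) (he : 1 / ε ≤ e)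
    (hpd : 2 * (d + 1) * e < p) (h1 : E + (p - d) * H ≤ p * m) (h2 : p * m ≤ E + p * H) :
    (H : ℝ) ≤ ((p * m - E) / (p - d) : ℕ) ∧ (((p * m - E) / (p - d) : ℕ) : ℝ) ≤ (1 + ε) * H := by
  have he1 : 1 ≤ e := by
    have : (1 : ℝ) ≤ e := le_trans (by rw [le_div_iff₀ hε]; linarith) he
    exact_mod_cast this
  have hd : 2 * d * e + 2 * d ≤ 2 * p := by nlinarith
  have hdp : d < p := by nlinarith
  have hpos : 0 < p - d := by omega
  constructor
  · exact_mod_cast (Nat.le_div_iff_mul_le hpos).mpr (by rw [mul_comm]; omega)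
  · refine (Nat.cast_div_le).trans ?_
    rw [div_le_iff₀ (by exact_mod_cast hpos), Nat.cast_sub hdp.le]
    have h3 : ((p * m - E : ℕ) : ℝ) ≤ p * H := by exact_mod_cast (by omega : p * m - E ≤ p * H)
    refine h3.trans ?_
    have h4 : (p : ℝ) ≤ (1 + ε) * (p - d) := by
      have h5 : 1 ≤ ε * e := by rwa [div_le_iff₀ hε, mul_comm] at he
      have h6 : (2 * (d + 1) * e : ℝ) < p := by exact_mod_cast hpd
      have h7 : (0 : ℝ) ≤ d := Nat.cast_nonneg d
      have h8 : 2 * (d + 1 : ℝ) ≤ ε * p := by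
        calc 2 * (d + 1 : ℝ) ≤ 2 * (d + 1) * (ε * e) := by nlinarith
          _ = ε * (2 * (d + 1) * e) := by ring
          _ ≤ ε * p := by nlinarith
      nlinarith
    nlinarith [Nat.cast_nonneg (α := ℝ) H]

/-! ## A fixed point Fourier transform with natural numbers

A complex number is represented by four naturals, its coefficients at `I ^ 0, …, I ^ 3`, scaled by
`Z`. -/

open Complex in
/-- The complex number that is represented by the coefficients `u 0, …, u 3`. -/
noncomputable def toC (Z : ℕ) (u : ℕ → ℕ) : ℂ := (∑ k ∈ Finset.range 4, (u k : ℂ) * I ^ k) / Z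

/-- One level of the transform. -/
def fftStep (N Z : ℕ) (tc ts : ℕ → ℕ) (l : ℕ) (f : ℕ → ℕ → ℕ) (ix k : ℕ) : ℕ :=
  f (ix / (2 * 2 ^ l) * 2 ^ l + ix % 2 ^ l) k +
    (f (ix / (2 * 2 ^ l) * 2 ^ l + ix % 2 ^ l + N / 2)
        ((k + 4 - ix % (2 * 2 ^ l) * (N / (2 * 2 ^ l)) / (N / 4)) % 4) *
        tc (ix % (2 * 2 ^ l) * (N / (2 * 2 ^ l)) % (N / 4)) +
      f (ix / (2 * 2 ^ l) * 2 ^ l + ix % 2 ^ l + N / 2)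
        ((k + 7 - ix % (2 * 2 ^ l) * (N / (2 * 2 ^ l)) / (N / 4)) % 4) *
        ts (ix % (2 * 2 ^ l) * (N / (2 * 2 ^ l)) % (N / 4))) / Z

/-- The levels of the transform. -/
def fftLevel (N Z : ℕ) (tc ts : ℕ → ℕ) (f : ℕ → ℕ → ℕ) : ℕ → ℕ → ℕ → ℕ
  | 0 => f
  | l + 1 => fftStep N Z tc ts l (fftLevel N Z tc ts f l)

/-- The levels of the exact transform with the root of unity `ω`. -/
noncomputable def fftExact (N : ℕ) (ω : ℂ) (a : ℕ → ℂ) : ℕ → ℕ → ℂ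
  | 0, ix => a ix
  | l + 1, ix => fftExact N ω a l (ix / (2 * 2 ^ l) * 2 ^ l + ix % 2 ^ l) +
      ω ^ (ix % (2 * 2 ^ l) * (N / (2 * 2 ^ l))) *
        fftExact N ω a l (ix / (2 * 2 ^ l) * 2 ^ l + ix % 2 ^ l + N / 2)

/-- The pointwise product that computes a cyclic correlation. -/
def corrProd (N Z : ℕ) (f g : ℕ → ℕ → ℕ) (ix k : ℕ) : ℕ :=
  (∑ j ∈ Finset.range 4, f ((N - ix) % N) j * g ix ((k + 4 - j) % 4)) / Z

/-- The table of twiddle factors is accurate up to `η`. -/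
def GoodTwiddles (N Z : ℕ) (tc ts : ℕ → ℕ) (η : ℝ) : Prop :=
  ∀ j < N / 4, tc j ≤ 2 * Z ∧ ts j ≤ 2 * Z ∧
    ‖((tc j : ℂ) + ts j * Complex.I) / Z - Complex.exp (2 * Real.pi * Complex.I / N) ^ j‖ ≤ η

/-! ### The exact transform and the correlation theorem -/

section exact

theorem sum_range_two_mul {M : Type*} [AddCommMonoid M] (f : ℕ → M) (h : ℕ) :
    ∑ v ∈ Finset.range (2 * h), f v =
      ∑ v ∈ Finset.range h, f (2 * v) + ∑ v ∈ Finset.range h, f (2 * v + 1) := by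
  induction h with
  | zero => simp
  | succ h ih =>
    rw [show 2 * (h + 1) = 2 * h + 1 + 1 by ring, Finset.sum_range_succ, Finset.sum_range_succ, ih,
      Finset.sum_range_succ, Finset.sum_range_succ]
    abel

/-- Both inputs of a butterfly are cells of the previous level, and the twiddle exponent is less
than `N`, so it lies in one of four quadrants. -/
theorem fft_index {K l ix : ℕ} (hl : l < K) (hix : ix < 2 ^ K) :
    ix / (2 * 2 ^ l) * 2 ^ l + ix % 2 ^ l + 2 ^ K / 2 < 2 ^ K ∧
      ix % (2 * 2 ^ l) * (2 ^ K / (2 * 2 ^ l)) < 2 ^ K := by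
  obtain ⟨r, rfl⟩ : ∃ r, K = r + (l + 1) := ⟨K - (l + 1), by omega⟩
  have hpos : 0 < 2 ^ l := by positivity
  have e1 : 2 ^ (r + (l + 1)) = 2 ^ r * (2 * 2 ^ l) := by rw [pow_add, pow_succ]; ring
  have e2 : 2 ^ r * (2 * 2 ^ l) / (2 * 2 ^ l) = 2 ^ r := Nat.mul_div_cancel _ (by positivity)
  have e3 : 2 ^ r * (2 * 2 ^ l) / 2 = 2 ^ r * 2 ^ l := by
    rw [show 2 ^ r * (2 * 2 ^ l) = 2 ^ r * 2 ^ l * 2 by ring]; simp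
  rw [e1] at hix ⊢
  rw [e2, e3]
  have h1 : ix / (2 * 2 ^ l) < 2 ^ r := Nat.div_lt_of_lt_mul (by rw [mul_comm]; exact hix)
  have h2 : ix % 2 ^ l < 2 ^ l := Nat.mod_lt _ hpos
  have h3 : ix % (2 * 2 ^ l) < 2 * 2 ^ l := Nat.mod_lt _ (by positivity)
  constructor
  · nlinarith
  · rw [mul_comm (2 ^ r)]
    exact Nat.mul_lt_mul_of_pos_right h3 (by positivity)

/-- Cell `r * 2 ^ l + u` on level `l` is the `u`-th Fourier coefficient of the subsequence of
indices congruent to `r` modulo `2 ^ (K - l)`. Splitting it into even and odd terms gives the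
subsequences of `r` and `r + 2 ^ (K - l - 1)` one level below. With this indexing the output appears
in natural order and no bit reversal is needed. -/
theorem fftExact_eq {K : ℕ} {ω : ℂ} (hω : ω ^ 2 ^ K = 1) (a : ℕ → ℂ) {l : ℕ} (hl : l ≤ K)
    {r u : ℕ} (hr : r < 2 ^ (K - l)) (hu : u < 2 ^ l) :
    fftExact (2 ^ K) ω a l (r * 2 ^ l + u) =
      ∑ v ∈ Finset.range (2 ^ l), a (r + v * 2 ^ (K - l)) * ω ^ (u * v * 2 ^ (K - l)) := by
  induction l generalizing r u with
  | zero =>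
    obtain rfl : u = 0 := by simpa using hu
    simp [fftExact]
  | succ l ih =>
    obtain ⟨c, rfl⟩ : ∃ c, K = c + (l + 1) := ⟨K - (l + 1), by omega⟩
    have hpos : 0 < 2 ^ l := by positivity
    rw [show c + (l + 1) - (l + 1) = c by omega] at hr ⊢
    have ec : c + (l + 1) - l = c + 1 := by omega
    have e1 : 2 ^ (c + (l + 1)) = 2 ^ c * (2 * 2 ^ l) := by rw [pow_add, pow_succ]; ring
    have hu' : u < 2 * 2 ^ l := by rwa [pow_succ, mul_comm] at hu
    have d1 : (r * 2 ^ (l + 1) + u) / (2 * 2 ^ l) = r := by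
      rw [pow_succ, mul_comm (2 ^ l) 2, mul_comm r, Nat.mul_add_div (by positivity),
        Nat.div_eq_of_lt hu', add_zero]
    have d2 : (r * 2 ^ (l + 1) + u) % (2 * 2 ^ l) = u := by
      rw [pow_succ, mul_comm (2 ^ l) 2, mul_comm r, Nat.mul_add_mod, Nat.mod_eq_of_lt hu']
    have d3 : (r * 2 ^ (l + 1) + u) % 2 ^ l = u % 2 ^ l := by
      rw [pow_succ, show r * (2 ^ l * 2) = 2 ^ l * (r * 2) by ring, Nat.mul_add_mod]
    have d4 : 2 ^ c * (2 * 2 ^ l) / (2 * 2 ^ l) = 2 ^ c := Nat.mul_div_cancel _ (by positivity)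
    have d5 : 2 ^ c * (2 * 2 ^ l) / 2 = 2 ^ c * 2 ^ l := by
      rw [show 2 ^ c * (2 * 2 ^ l) = 2 ^ c * 2 ^ l * 2 by ring]; simp
    -- The order of `ω ^ 2 ^ (c + 1)` divides `2 ^ l`, so only `u` modulo `2 ^ l` matters.
    have hmod : ∀ v, ω ^ (u % 2 ^ l * v * 2 ^ (c + 1)) = ω ^ (u * v * 2 ^ (c + 1)) := by
      intro v
      have : u * v * 2 ^ (c + 1) = u % 2 ^ l * v * 2 ^ (c + 1) + 2 ^ (c + (l + 1)) * (u / 2 ^ l * v) := by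
        conv_lhs => rw [← Nat.mod_add_div u (2 ^ l)]
        rw [e1, pow_succ]; ring
      rw [this, pow_add ω _ (2 ^ (c + (l + 1)) * _), pow_mul ω (2 ^ (c + (l + 1))), hω, one_pow, mul_one]
    have hum : u % 2 ^ l < 2 ^ l := Nat.mod_lt _ hpos
    have i1 := ih (by omega) (r := r) (u := u % 2 ^ l)
      (by rw [ec, pow_succ]; omega) hum
    have i2 := ih (by omega) (r := r + 2 ^ c) (u := u % 2 ^ l)
      (by rw [ec, pow_succ]; omega) hum
    rw [ec] at i1 i2
    simp only [fftExact]
    rw [d1, d2, d3]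
    rw [show r * 2 ^ l + u % 2 ^ l + 2 ^ (c + (l + 1)) / 2 = (r + 2 ^ c) * 2 ^ l + u % 2 ^ l by
      rw [e1, d5]; ring, i1, i2, show 2 ^ (c + (l + 1)) / (2 * 2 ^ l) = 2 ^ c by rw [e1, d4]]
    rw [show 2 ^ (l + 1) = 2 * 2 ^ l by ring, sum_range_two_mul, Finset.mul_sum]
    congr 1 <;> refine Finset.sum_congr rfl fun v _ => ?_
    · rw [hmod]; congr 2 <;> ring
    · rw [hmod, mul_left_comm, ← pow_add]; congr 2 <;> ring

theorem fftExact_top {K : ℕ} {ω : ℂ} (hω : ω ^ 2 ^ K = 1) (a : ℕ → ℂ) {u : ℕ} (hu : u < 2 ^ K) :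
    fftExact (2 ^ K) ω a K u = ∑ v ∈ Finset.range (2 ^ K), a v * ω ^ (u * v) := by
  have := fftExact_eq hω a le_rfl (r := 0) (by simp) hu
  simpa using this

/-- The correlation theorem for the discrete Fourier transform. -/
theorem dft_correlation {N : ℕ} (hN : 0 < N) {ω : ℂ} (hω : IsPrimitiveRoot ω N) (a b : ℕ → ℂ)
    {i : ℕ} (hi : i < N) :
    ∑ u ∈ Finset.range N, ((∑ j ∈ Finset.range N, a j * ω ^ ((N - u) % N * j)) *
        ∑ l ∈ Finset.range N, b l * ω ^ (u * l)) * ω ^ ((N - i) % N * u) =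
      N * ∑ j ∈ Finset.range N, a j * b ((i + j) % N) := by
  have hω1 : ω ^ N = 1 := hω.pow_eq_one
  have hω0 : ω ≠ 0 := fun h => by
    rw [h, zero_pow hN.ne'] at hω1; exact zero_ne_one hω1
  have hneg : ∀ u < N, ω ^ ((N - u) % N) = (ω ^ u)⁻¹ := by
    intro u hu
    apply eq_inv_of_mul_eq_one_left
    rw [← pow_eq_pow_mod _ hω1, ← pow_add, Nat.sub_add_cancel hu.le, hω1]
  -- Reversing the index inverts the root of unity. The sum over `u` then becomes a geometric sum
  -- with ratio `ω ^ (l - j - i)`, which vanishes unless `l` is congruent to `i + j` modulo `N`; so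
  -- a forward transform also serves as the inverse one.
  have step : ∀ u ∈ Finset.range N, ((∑ j ∈ Finset.range N, a j * ω ^ ((N - u) % N * j)) *
        ∑ l ∈ Finset.range N, b l * ω ^ (u * l)) * ω ^ ((N - i) % N * u) =
      ∑ j ∈ Finset.range N, ∑ l ∈ Finset.range N,
        a j * b l * (ω ^ l * (ω ^ j)⁻¹ * (ω ^ i)⁻¹) ^ u := by
    intro u hu
    rw [Finset.sum_mul_sum, Finset.sum_mul]
    refine Finset.sum_congr rfl fun j _ => ?_
    rw [Finset.sum_mul]
    refine Finset.sum_congr rfl fun l _ => ?_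
    rw [pow_mul ω ((N - u) % N), pow_mul ω ((N - i) % N), hneg u (Finset.mem_range.mp hu),
      hneg i hi, mul_pow, mul_pow, inv_pow, inv_pow, inv_pow, ← pow_mul, ← pow_mul, ← pow_mul,
      mul_comm u l, mul_comm u j]
    ring
  rw [Finset.sum_congr rfl step, Finset.sum_comm, Finset.mul_sum]
  refine Finset.sum_congr rfl fun j hj => ?_
  rw [Finset.sum_comm]
  have hj := Finset.mem_range.mp hj
  have key : ∀ l ∈ Finset.range N, ∑ u ∈ Finset.range N,
      a j * b l * (ω ^ l * (ω ^ j)⁻¹ * (ω ^ i)⁻¹) ^ u =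
        if l = (i + j) % N then N * (a j * b ((i + j) % N)) else 0 := by
    intro l hl
    have hl := Finset.mem_range.mp hl
    rw [← Finset.mul_sum]
    have hx : (ω ^ l * (ω ^ j)⁻¹ * (ω ^ i)⁻¹) ^ N = 1 := by
      rw [mul_pow, mul_pow, inv_pow, inv_pow, ← pow_mul, ← pow_mul, ← pow_mul, mul_comm l,
        mul_comm j, mul_comm i, pow_mul, pow_mul, pow_mul, hω1]; simp
    split_ifs with h
    · have : ω ^ l * (ω ^ j)⁻¹ * (ω ^ i)⁻¹ = 1 := by
        rw [h, ← pow_eq_pow_mod _ hω1, pow_add]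
        have := pow_ne_zero j hω0
        have := pow_ne_zero i hω0
        field_simp
      rw [this, ← h]; simp; ring
    · have hne : ω ^ l * (ω ^ j)⁻¹ * (ω ^ i)⁻¹ ≠ 1 := by
        intro h1
        have h2 : ω ^ l = ω ^ ((i + j) % N) := by
          rw [← pow_eq_pow_mod _ hω1, pow_add]
          have := pow_ne_zero j hω0
          have := pow_ne_zero i hω0
          field_simp at h1
          rw [h1]; ring
        exact h (hω.pow_inj hl (Nat.mod_lt _ hN) h2)
      have := mul_neg_geom_sum (ω ^ l * (ω ^ j)⁻¹ * (ω ^ i)⁻¹) N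
      rw [hx, sub_self] at this
      rw [(mul_eq_zero.mp this).resolve_left (sub_ne_zero.mpr hne.symm), mul_zero]
  rw [Finset.sum_congr rfl key, Finset.sum_ite_eq' , if_pos (Finset.mem_range.mpr (Nat.mod_lt _ hN))]

end exact

/-! ### Error analysis of the fixed point operations -/

section approx
open Complex

theorem norm_toC_le (Z : ℕ) (u : ℕ → ℕ) : ‖toC Z u‖ ≤ ((∑ k ∈ Finset.range 4, u k : ℕ) : ℝ) / Z := by
  rw [toC, norm_div, Complex.norm_natCast]
  gcongr
  push_cast
  refine (norm_sum_le _ _).trans (Finset.sum_le_sum fun k _ => ?_)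
  simp

/-- Multiplication by `I ^ q` shifts the four coefficients cyclically by `q`, and the term with `s *
I` shifts once more (`k + 7 - q` is `k - (q + 1)` modulo 4). No subtraction of coefficients occurs.
-/
theorem rotate_sum (u : ℕ → ℕ) {q : ℕ} (hq : q < 4) (c s : ℕ) :
    (∑ k ∈ Finset.range 4, ((u ((k + 4 - q) % 4) * c + u ((k + 7 - q) % 4) * s : ℕ) : ℂ) * I ^ k) =
      (∑ k ∈ Finset.range 4, (u k : ℂ) * I ^ k) * (I ^ q * (c + s * I)) := by
  have h3 : (I : ℂ) ^ 3 = -I := by rw [pow_succ, I_sq]; ring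
  have h2 : (I : ℂ) * I = -1 := I_mul_I
  interval_cases q <;> simp [Finset.sum_range_succ, h3] <;> ring_nf <;>
    simp only [I_sq, h3] <;> ring

/-- Since `I ^ 4 = 1`, a product is the cyclic convolution of length four of the coefficients. -/
theorem mul_sum_I (u v : ℕ → ℕ) :
    (∑ k ∈ Finset.range 4, ((∑ j ∈ Finset.range 4, u j * v ((k + 4 - j) % 4) : ℕ) : ℂ) * I ^ k) =
      (∑ k ∈ Finset.range 4, (u k : ℂ) * I ^ k) * ∑ k ∈ Finset.range 4, (v k : ℂ) * I ^ k := by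
  have h3 : (I : ℂ) ^ 3 = -I := by rw [pow_succ, I_sq]; ring
  simp [Finset.sum_range_succ, h3]
  ring_nf
  simp only [I_sq]
  ring

theorem toC_add (Z : ℕ) (u v : ℕ → ℕ) : toC Z (fun k => u k + v k) = toC Z u + toC Z v := by
  simp [toC, add_mul, Finset.sum_add_distrib, add_div]

/-- Each of the four coefficients loses a remainder below `Z`, which amounts to less than `1 / Z`
after scaling. -/
theorem toC_floor {Z : ℕ} (hZ : 0 < Z) (A : ℕ → ℕ) :
    ‖toC Z (fun k => A k / Z) - (∑ k ∈ Finset.range 4, (A k : ℂ) * I ^ k) / Z / Z‖ ≤ 4 / Z := by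
  have hZ' : (0 : ℝ) < Z := by exact_mod_cast hZ
  have hZc : (Z : ℂ) ≠ 0 := by exact_mod_cast hZ.ne'
  have key : toC Z (fun k => A k / Z) - (∑ k ∈ Finset.range 4, (A k : ℂ) * I ^ k) / Z / Z =
      -(∑ k ∈ Finset.range 4, ((A k % Z : ℕ) : ℂ) * I ^ k) / Z / Z := by
    rw [toC, eq_div_iff hZc, sub_mul, div_mul_cancel₀ _ hZc, eq_div_iff hZc, sub_mul,
      div_mul_cancel₀ _ hZc, div_mul_eq_mul_div, mul_div_cancel_right₀ _ hZc, Finset.sum_mul,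
      ← Finset.sum_sub_distrib, ← Finset.sum_neg_distrib]
    refine Finset.sum_congr rfl fun k _ => ?_
    have : (A k : ℂ) = ((A k % Z : ℕ) : ℂ) + Z * ((A k / Z : ℕ) : ℂ) := by
      exact_mod_cast (Nat.mod_add_div (A k) Z).symm
    rw [this]; ring
  rw [key, norm_div, norm_div, norm_neg, Complex.norm_natCast, div_le_div_iff_of_pos_right hZ',
    div_le_iff₀ hZ']
  refine (norm_sum_le _ _).trans ?_
  have : ∀ k ∈ Finset.range 4, ‖((A k % Z : ℕ) : ℂ) * I ^ k‖ ≤ Z := by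
    intro k _
    rw [norm_mul, norm_pow, norm_I, one_pow, mul_one, Complex.norm_natCast]
    exact_mod_cast (Nat.mod_lt _ hZ).le
  simpa using Finset.sum_le_card_nsmul _ _ _ this

theorem exp_primitive {N : ℕ} (hN : 0 < N) : IsPrimitiveRoot (exp (2 * Real.pi * I / N)) N :=
  Complex.isPrimitiveRoot_exp N hN.ne'

/-- The power with exponent `N / 4` is `I`, so a table of the first quadrant suffices. -/
theorem twiddle_quadrant {N : ℕ} (hN : 0 < N) (h4 : 4 ∣ N) (j : ℕ) :
    exp (2 * Real.pi * I / N) ^ j = I ^ (j / (N / 4)) * exp (2 * Real.pi * I / N) ^ (j % (N / 4)) := by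
  obtain ⟨M, rfl⟩ := h4
  have hM : 0 < M := by omega
  rw [Nat.mul_div_cancel_left _ (by omega : 0 < 4)]
  have hI : exp (2 * Real.pi * I / (4 * M : ℕ)) ^ M = I := by
    have hM' : (M : ℂ) ≠ 0 := by exact_mod_cast hM.ne'
    have : (M : ℂ) * (2 * Real.pi * I / (4 * M : ℕ)) = Real.pi / 2 * I := by
      push_cast; field_simp; ring
    rw [← Complex.exp_nat_mul, this, Complex.exp_pi_div_two_mul_I]
  conv_lhs => rw [← Nat.div_add_mod j M, pow_add, pow_mul, hI]

/-- In a butterfly `A + w * B` the coefficient sum is at most that of `A` plus four times that of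
`B`, because table entries are at most `2 * Z`. The error is the sum of both input errors, of `‖B‖ *
η` from the table and of `4 / Z` from rounding. A crude factor 8 per level covers both estimates and
costs only `8 ^ K = N ^ 3` overall. -/
theorem fftLevel_approx {N K Z G : ℕ} {tc ts : ℕ → ℕ} {η δ : ℝ} (hN : N = 2 ^ K) (hK : 2 ≤ K)
    (hZ : 0 < Z) (hη : 0 ≤ η) (hδ : 0 ≤ δ) (htw : GoodTwiddles N Z tc ts η) (f : ℕ → ℕ → ℕ) (a : ℕ → ℂ)
    (hG : ∀ ix < N, ∑ k ∈ Finset.range 4, f ix k ≤ G * Z)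
    (ha : ∀ ix < N, ‖toC Z (f ix) - a ix‖ ≤ δ) (l : ℕ) (hl : l ≤ K) :
    ∀ ix < N, ∑ k ∈ Finset.range 4, fftLevel N Z tc ts f l ix k ≤ 8 ^ l * G * Z ∧
      ‖toC Z (fftLevel N Z tc ts f l ix) - fftExact N (exp (2 * Real.pi * I / N)) a l ix‖ ≤
        8 ^ l * (δ + G * η + 4 / Z) := by
  have hNpos : 0 < N := by rw [hN]; positivity
  have h4 : 4 ∣ N := by rw [hN]; exact pow_dvd_pow 2 hK
  have hZ' : (0 : ℝ) < Z := by exact_mod_cast hZ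
  have hZc : (Z : ℂ) ≠ 0 := by exact_mod_cast hZ.ne'
  induction l with
  | zero =>
    intro ix hix
    refine ⟨by simpa [fftLevel] using hG ix hix, ?_⟩
    have := ha ix hix
    simp only [fftLevel, fftExact, pow_zero, one_mul]
    have h1 : 0 ≤ (G : ℝ) * η := by positivity
    have h2 : 0 ≤ (4 : ℝ) / Z := by positivity
    linarith
  | succ l ih =>
    intro ix hix
    have hidx := fft_index (K := K) (l := l) (ix := ix) (by omega) (by rw [← hN]; exact hix)
    rw [← hN] at hidx
    obtain ⟨hs, htw'⟩ := hidx
    set src := ix / (2 * 2 ^ l) * 2 ^ l + ix % 2 ^ l with hsrc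
    set tw := ix % (2 * 2 ^ l) * (N / (2 * 2 ^ l)) with htwdef
    obtain ⟨g1, e1⟩ := ih (by omega) src (by omega)
    obtain ⟨g2, e2⟩ := ih (by omega) (src + N / 2) hs
    set F := fftLevel N Z tc ts f l with hF
    set q := tw / (N / 4) with hq
    set j := tw % (N / 4) with hj
    have hN4 : 0 < N / 4 := Nat.div_pos (Nat.le_of_dvd hNpos h4) (by omega)
    have hq4 : q < 4 := by
      rw [hq]; apply Nat.div_lt_of_lt_mul; rw [mul_comm, Nat.mul_div_cancel' h4]; exact htw'
    have hj4 : j < N / 4 := Nat.mod_lt _ hN4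
    obtain ⟨t1, t2, t3⟩ := htw j hj4
    have hstep : ∀ k, fftLevel N Z tc ts f (l + 1) ix k = F src k +
        (F (src + N / 2) ((k + 4 - q) % 4) * tc j + F (src + N / 2) ((k + 7 - q) % 4) * ts j) / Z :=
      fun k => rfl
    have hperm : ∀ u : ℕ → ℕ, ∑ k ∈ Finset.range 4, (u ((k + 4 - q) % 4) + u ((k + 7 - q) % 4)) =
        2 * ∑ k ∈ Finset.range 4, u k := by
      intro u
      clear_value q
      interval_cases q <;> simp [Finset.sum_range_succ] <;> ring
    constructor
    · calc ∑ k ∈ Finset.range 4, fftLevel N Z tc ts f (l + 1) ix k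
          ≤ ∑ k ∈ Finset.range 4, (F src k +
            2 * (F (src + N / 2) ((k + 4 - q) % 4) + F (src + N / 2) ((k + 7 - q) % 4))) := by
            refine Finset.sum_le_sum fun k _ => ?_
            rw [hstep]
            refine Nat.add_le_add_left (Nat.div_le_of_le_mul ?_) _
            nlinarith [Nat.mul_le_mul_left (F (src + N / 2) ((k + 4 - q) % 4)) t1,
              Nat.mul_le_mul_left (F (src + N / 2) ((k + 7 - q) % 4)) t2]
        _ = ∑ k ∈ Finset.range 4, F src k + 4 * ∑ k ∈ Finset.range 4, F (src + N / 2) k := by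
            rw [Finset.sum_add_distrib, ← Finset.mul_sum, hperm]; ring
        _ ≤ 8 ^ (l + 1) * G * Z := by rw [pow_succ]; nlinarith [Nat.zero_le (8 ^ l * G * Z)]
    · set ω := exp (2 * Real.pi * I / N) with hω
      have hω1 : ‖ω ^ tw‖ = 1 := by
        have : ‖ω‖ = 1 := (exp_primitive hNpos).norm'_eq_one hNpos.ne'
        rw [norm_pow, this, one_pow]
      set w : ℂ := I ^ q * (((tc j : ℂ) + ts j * I) / Z) with hw
      have hwω : ‖w - ω ^ tw‖ ≤ η := by
        rw [hw, hω, twiddle_quadrant hNpos h4 tw, ← hq, ← hj, ← mul_sub, norm_mul, norm_pow, norm_I,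
          one_pow, one_mul]
        exact t3
      have hsplit : toC Z (fftLevel N Z tc ts f (l + 1) ix) = toC Z (F src) + toC Z (fun k =>
          (F (src + N / 2) ((k + 4 - q) % 4) * tc j + F (src + N / 2) ((k + 7 - q) % 4) * ts j) / Z) := by
        rw [← toC_add]; rfl
      have hfl := toC_floor hZ (fun k =>
        F (src + N / 2) ((k + 4 - q) % 4) * tc j + F (src + N / 2) ((k + 7 - q) % 4) * ts j)
      rw [rotate_sum _ hq4] at hfl
      have hmul : (∑ k ∈ Finset.range 4, (F (src + N / 2) k : ℂ) * I ^ k) *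
          (I ^ q * (tc j + ts j * I)) / Z / Z = toC Z (F (src + N / 2)) * w := by
        rw [hw, toC]; field_simp
      rw [hmul] at hfl
      have hexact : fftExact N ω a (l + 1) ix = fftExact N ω a l src +
          ω ^ tw * fftExact N ω a l (src + N / 2) := rfl
      rw [hsplit, hexact]
      set X := toC Z (fun k =>
        (F (src + N / 2) ((k + 4 - q) % 4) * tc j + F (src + N / 2) ((k + 7 - q) % 4) * ts j) / Z)
      set A := toC Z (F src)
      set B := toC Z (F (src + N / 2)) with hB
      set A' := fftExact N ω a l src
      set B' := fftExact N ω a l (src + N / 2)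
      have hBn : ‖B‖ ≤ 8 ^ l * G := by
        refine (norm_toC_le _ _).trans ?_
        rw [div_le_iff₀ hZ']
        exact_mod_cast g2
      have hdecomp : A + X - (A' + ω ^ tw * B') =
          (A - A') + (X - B * w) + B * (w - ω ^ tw) + ω ^ tw * (B - B') := by ring
      rw [hdecomp]
      have n1 := norm_add_le ((A - A') + (X - B * w) + B * (w - ω ^ tw)) (ω ^ tw * (B - B'))
      have n2 := norm_add_le ((A - A') + (X - B * w)) (B * (w - ω ^ tw))
      have n3 := norm_add_le (A - A') (X - B * w)
      rw [norm_mul, hω1, one_mul] at n1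
      rw [norm_mul B] at n2
      have n4 : ‖B‖ * ‖w - ω ^ tw‖ ≤ 8 ^ l * G * η :=
        mul_le_mul hBn hwω (norm_nonneg _) (by positivity)
      have p8 : (1 : ℝ) ≤ 8 ^ l := one_le_pow₀ (by norm_num)
      have n5 : (4 : ℝ) / Z ≤ 8 ^ l * (4 / Z) := by
        have : (0 : ℝ) ≤ 4 / Z := by positivity
        nlinarith
      have n6 : 0 ≤ (8 : ℝ) ^ l * δ := by positivity
      have n7 : 0 ≤ (8 : ℝ) ^ l * (G * η) := by positivity
      have n8 : 0 ≤ (8 : ℝ) ^ l * (4 / Z) := by positivity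
      rw [pow_succ]
      nlinarith

/-- The error splits into rounding, the error of `g` times the computed `f`, and the error of `f`
times the exact `b`. The coefficient sum of a cyclic convolution is the product of the coefficient
sums. -/
theorem corrProd_approx {N Z G : ℕ} {δ A B : ℝ} (hN : 0 < N) (hZ : 0 < Z) (f g : ℕ → ℕ → ℕ)
    (a b : ℕ → ℂ) (hδ : 0 ≤ δ)
    (hf : ∀ ix < N, ∑ k ∈ Finset.range 4, f ix k ≤ G * Z) (hg : ∀ ix < N, ∑ k ∈ Finset.range 4, g ix k ≤ G * Z)
    (hfA : (G : ℝ) ≤ A) (hB : ∀ ix < N, ‖b ix‖ ≤ B)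
    (hfa : ∀ ix < N, ‖toC Z (f ix) - a ix‖ ≤ δ) (hgb : ∀ ix < N, ‖toC Z (g ix) - b ix‖ ≤ δ) :
    ∀ ix < N, ∑ k ∈ Finset.range 4, corrProd N Z f g ix k ≤ G * G * Z ∧
      ‖toC Z (corrProd N Z f g ix) - a ((N - ix) % N) * b ix‖ ≤ A * δ + B * δ + 4 / Z := by
  intro ix hix
  have hZ' : (0 : ℝ) < Z := by exact_mod_cast hZ
  have hZc : (Z : ℂ) ≠ 0 := by exact_mod_cast hZ.ne'
  have hix' : (N - ix) % N < N := Nat.mod_lt _ hN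
  set F := f ((N - ix) % N)
  set H := g ix
  constructor
  · have h1 : ∑ k ∈ Finset.range 4, (∑ j ∈ Finset.range 4, F j * H ((k + 4 - j) % 4)) =
        (∑ k ∈ Finset.range 4, F k) * ∑ k ∈ Finset.range 4, H k := by
      simp [Finset.sum_range_succ]; ring
    have h2 : (∑ k ∈ Finset.range 4, corrProd N Z f g ix k) * Z ≤ G * Z * (G * Z) := by
      rw [Finset.sum_mul]
      calc _ ≤ ∑ k ∈ Finset.range 4, (∑ j ∈ Finset.range 4, F j * H ((k + 4 - j) % 4)) :=
            Finset.sum_le_sum fun k _ => Nat.div_mul_le_self _ _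
        _ ≤ _ := by rw [h1]; exact Nat.mul_le_mul (hf _ hix') (hg _ hix)
    exact Nat.le_of_mul_le_mul_right (by linarith) hZ
  · have hfl := toC_floor hZ (fun k => ∑ j ∈ Finset.range 4, F j * H ((k + 4 - j) % 4))
    rw [mul_sum_I] at hfl
    have hmul : (∑ k ∈ Finset.range 4, (F k : ℂ) * I ^ k) * (∑ k ∈ Finset.range 4, (H k : ℂ) * I ^ k) /
        Z / Z = toC Z F * toC Z H := by
      rw [toC, toC]; field_simp
    rw [hmul] at hfl
    have hX : toC Z (corrProd N Z f g ix) =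
        toC Z (fun k => (∑ j ∈ Finset.range 4, F j * H ((k + 4 - j) % 4)) / Z) := rfl
    rw [hX]
    set X := toC Z (fun k => (∑ j ∈ Finset.range 4, F j * H ((k + 4 - j) % 4)) / Z)
    have hdecomp : X - a ((N - ix) % N) * b ix = (X - toC Z F * toC Z H) +
        toC Z F * (toC Z H - b ix) + (toC Z F - a ((N - ix) % N)) * b ix := by ring
    rw [hdecomp]
    have n1 := norm_add_le ((X - toC Z F * toC Z H) + toC Z F * (toC Z H - b ix))
      ((toC Z F - a ((N - ix) % N)) * b ix)
    have n2 := norm_add_le (X - toC Z F * toC Z H) (toC Z F * (toC Z H - b ix))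
    rw [norm_mul] at n1 n2
    have hFn : ‖toC Z F‖ ≤ A := by
      refine (norm_toC_le _ _).trans (le_trans ?_ hfA)
      rw [div_le_iff₀ hZ']
      exact_mod_cast hf _ hix'
    have n3 : ‖toC Z F‖ * ‖toC Z H - b ix‖ ≤ A * δ :=
      mul_le_mul hFn (hgb _ hix) (norm_nonneg _) ((norm_nonneg _).trans hFn)
    have n4 : ‖toC Z F - a ((N - ix) % N)‖ * ‖b ix‖ ≤ δ * B :=
      mul_le_mul (hfa _ hix') (hB _ hix) (norm_nonneg _) hδ
    linarith

end approx

/-! ### Exact correlations by rounding -/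

section correlation
open Complex

/-- The fixed point representation of a sequence of naturals. -/
def embedNat (Z : ℕ) (α : ℕ → ℕ) (ix k : ℕ) : ℕ := if k = 0 then Z * α ix else 0

/-- The fixed point computation of a cyclic correlation. -/
def corrLevel (N K Z : ℕ) (tc ts : ℕ → ℕ) (α β : ℕ → ℕ) : ℕ → ℕ → ℕ → ℕ :=
  fftLevel N Z tc ts (corrProd N Z (fftLevel N Z tc ts (embedNat Z α) K)
    (fftLevel N Z tc ts (embedNat Z β) K))

theorem toC_re (Z : ℕ) (u : ℕ → ℕ) : (toC Z u).re = ((u 0 : ℝ) - u 2) / Z := by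
  have h3 : (I : ℂ) ^ 3 = -I := by rw [pow_succ, I_sq]; ring
  have : (∑ k ∈ Finset.range 4, (u k : ℂ) * I ^ k).re = (u 0 : ℝ) - u 2 := by
    simp [Finset.sum_range_succ, h3]; ring
  rw [toC, Complex.div_natCast_re, this]

/-- The summand `Z * N / 2` turns floor division into rounding to the nearest integer, and it also
keeps the truncated subtraction of `v` from truncating. The error `1 / 2` is far below the tolerance
`N / 2`. -/
theorem round_div {Z N c u v : ℕ} (hZ : 0 < Z) (hN : 8 ≤ N) (h2 : 2 ∣ N)
    (h : |((u : ℝ) - v) / Z - N * c| ≤ 1 / 2) : (u + Z * N / 2 - v) / (Z * N) = c := by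
  have hZ' : (0 : ℝ) < Z := by exact_mod_cast hZ
  obtain ⟨M, rfl⟩ := h2
  rw [show Z * (2 * M) / 2 = Z * M by rw [show Z * (2 * M) = Z * M * 2 by ring]; simp]
  rw [abs_le] at h
  have h1 : ((u : ℝ) - v) / Z = ((u : ℝ) - v) / Z := rfl
  have lo : (v : ℝ) + Z * (2 * M) * c ≤ u + Z / 2 := by
    have := h.1
    rw [neg_le_sub_iff_le_add, ← sub_le_iff_le_add, le_div_iff₀ hZ'] at this
    push_cast at this; nlinarith
  have hi : (u : ℝ) ≤ v + Z * (2 * M) * c + Z / 2 := by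
    have := h.2
    rw [sub_le_iff_le_add, div_le_iff₀ hZ'] at this
    push_cast at this; nlinarith
  have lo' : 2 * v + 2 * (Z * (2 * M) * c) ≤ 2 * u + Z := by
    have : (2 * v + 2 * (Z * (2 * M) * c) : ℝ) ≤ 2 * u + Z := by linarith
    exact_mod_cast this
  have hi' : 2 * u ≤ 2 * v + 2 * (Z * (2 * M) * c) + Z := by
    have : (2 * u : ℝ) ≤ 2 * v + 2 * (Z * (2 * M) * c) + Z := by linarith
    exact_mod_cast this
  have hZM : 4 * Z ≤ Z * M := by nlinarith
  apply Nat.div_eq_of_lt_le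
  · rw [show c * (Z * (2 * M)) = Z * (2 * M) * c by ring]; omega
  · rw [show (c + 1) * (Z * (2 * M)) = Z * (2 * M) * c + 2 * (Z * M) by ring]; omega

variable {N K Z : ℕ} {tc ts : ℕ → ℕ} {α β : ℕ → ℕ}

/-- Rounding errors are dominated by the error `N ^ (-12)` allowed for twiddle factors. The large
exponent 31 leaves room for the square root in `first_twiddle`, which halves the precision. -/
theorem four_div_scale_le (hN8 : 8 ≤ N) (hZ : Z = N ^ 31) : (4 : ℝ) / Z ≤ (1 / N : ℝ) ^ 12 := by
  have hNr : (8 : ℝ) ≤ N := by exact_mod_cast hN8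
  rw [hZ, one_div, inv_pow, div_le_iff₀ (by positivity)]
  push_cast
  rw [inv_mul_eq_div, le_div_iff₀ (by positivity)]
  calc (4 : ℝ) * (N : ℝ) ^ 12 ≤ (N : ℝ) ^ 19 * (N : ℝ) ^ 12 := by
        gcongr
        calc (4 : ℝ) ≤ (N : ℝ) ^ 1 := by linarith
          _ ≤ (N : ℝ) ^ 19 := pow_le_pow_right₀ (by linarith) (by norm_num)
    _ = (N : ℝ) ^ 31 := by ring

theorem embedNat_sum_le (hα : ∀ j, α j ≤ 1) (ix : ℕ) :
    ∑ k ∈ Finset.range 4, embedNat Z α ix k ≤ 1 * Z := by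
  simp only [embedNat, Finset.sum_range_succ, Finset.sum_range_zero]
  have := hα ix
  simp; nlinarith

theorem toC_embedNat (hZ : 0 < Z) (ix : ℕ) : toC Z (embedNat Z α ix) = α ix := by
  have hZc : (Z : ℂ) ≠ 0 := by exact_mod_cast hZ.ne'
  simp [toC, embedNat]
  field_simp

/-- The input is represented exactly and has size one, so the error is at most `8 ^ l ≤ N ^ 3` times
`2 * N ^ (-12)`. -/
theorem fft_indicator_approx (hN : N = 2 ^ K) (hN8 : 8 ≤ N) (hZ : Z = N ^ 31)
    (htw : GoodTwiddles N Z tc ts ((1 / N : ℝ) ^ 12)) (hα : ∀ j, α j ≤ 1) (l : ℕ) (hl : l ≤ K) :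
    ∀ ix < N, ∑ k ∈ Finset.range 4, fftLevel N Z tc ts (embedNat Z α) l ix k ≤ N ^ 3 * Z ∧
      ‖toC Z (fftLevel N Z tc ts (embedNat Z α) l ix) -
        fftExact N (exp (2 * Real.pi * I / N)) (fun j => (α j : ℂ)) l ix‖ ≤ 2 * (1 / N : ℝ) ^ 9 := by
  have hK : 2 ≤ K := by
    by_contra h
    have : N ≤ 2 ^ 1 := by rw [hN]; exact Nat.pow_le_pow_right (by norm_num) (by omega)
    omega
  have hNr : (8 : ℝ) ≤ N := by exact_mod_cast hN8
  have hZpos : 0 < Z := by rw [hZ]; positivity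
  have h8 : 8 ^ l ≤ N ^ 3 := by
    rw [hN, ← pow_mul, mul_comm, pow_mul]; exact Nat.pow_le_pow_right (by norm_num) hl
  intro ix hix
  obtain ⟨h1, h2⟩ := fftLevel_approx hN hK hZpos (by positivity) le_rfl htw (embedNat Z α)
    (fun j => (α j : ℂ)) (G := 1) (fun ix _ => embedNat_sum_le hα ix)
    (fun ix _ => by rw [toC_embedNat hZpos]; simp) l hl ix hix
  refine ⟨h1.trans ?_, h2.trans ?_⟩
  · rw [mul_one]; exact Nat.mul_le_mul_right _ h8
  · have h8' : (8 : ℝ) ^ l ≤ N ^ 3 := by exact_mod_cast h8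
    have hz := four_div_scale_le hN8 hZ
    calc (8 : ℝ) ^ l * (0 + (1 : ℕ) * (1 / N : ℝ) ^ 12 + 4 / Z)
        ≤ N ^ 3 * (0 + (1 : ℕ) * (1 / N : ℝ) ^ 12 + (1 / N : ℝ) ^ 12) := by gcongr
      _ = 2 * (1 / N : ℝ) ^ 9 := by
        field_simp
        norm_num

theorem norm_dft_le {ω : ℂ} (hω : ‖ω‖ = 1) (hα : ∀ j, α j ≤ 1) (u : ℕ) :
    ‖∑ v ∈ Finset.range N, (α v : ℂ) * ω ^ (u * v)‖ ≤ N := by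
  refine (norm_sum_le _ _).trans ?_
  have : ∀ v ∈ Finset.range N, ‖(α v : ℂ) * ω ^ (u * v)‖ ≤ 1 := by
    intro v _
    rw [norm_mul, norm_pow, hω, one_pow, mul_one, Complex.norm_natCast]
    exact_mod_cast hα v
  simpa using Finset.sum_le_card_nsmul _ _ _ this

/-- The products have coefficient sums up to `N ^ 6 * Z` and errors of order `N ^ (-6)`. The second
transform multiplies the errors by at most `N ^ 3` and adds the table error `N ^ 3 * N ^ 6 * N ^
(-12)`; the total is about `3 * N ^ (-3)`. -/
theorem corrLevel_approx (hN : N = 2 ^ K) (hN8 : 8 ≤ N) (hZ : Z = N ^ 31)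
    (htw : GoodTwiddles N Z tc ts ((1 / N : ℝ) ^ 12)) (hα : ∀ j, α j ≤ 1) (hβ : ∀ j, β j ≤ 1)
    (l : ℕ) (hl : l ≤ K) :
    ∀ ix < N, ∑ k ∈ Finset.range 4, corrLevel N K Z tc ts α β l ix k ≤ N ^ 9 * Z ∧
      ‖toC Z (corrLevel N K Z tc ts α β l ix) -
        fftExact N (exp (2 * Real.pi * I / N)) (fun u =>
          (∑ j ∈ Finset.range N, α j * exp (2 * Real.pi * I / N) ^ ((N - u) % N * j)) *
          ∑ j ∈ Finset.range N, β j * exp (2 * Real.pi * I / N) ^ (u * j)) l ix‖ ≤ 1 / 2 := by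
  have hK : 2 ≤ K := by
    by_contra h
    have : N ≤ 2 ^ 1 := by rw [hN]; exact Nat.pow_le_pow_right (by norm_num) (by omega)
    omega
  have hNr : (8 : ℝ) ≤ N := by exact_mod_cast hN8
  have hZpos : 0 < Z := by rw [hZ]; positivity
  have hNpos : 0 < N := by omega
  set ω := exp (2 * Real.pi * I / N) with hω
  have hω1 : ω ^ 2 ^ K = 1 := by rw [← hN]; exact (exp_primitive hNpos).pow_eq_one
  have hωn : ‖ω‖ = 1 := (exp_primitive hNpos).norm'_eq_one hNpos.ne'
  have top : ∀ γ : ℕ → ℕ, ∀ ix < N, fftExact N ω (fun j => (γ j : ℂ)) K ix =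
      ∑ j ∈ Finset.range N, (γ j : ℂ) * ω ^ (ix * j) := by
    intro γ ix hix
    rw [hN] at hix ⊢
    exact fftExact_top hω1 _ hix
  have hA := fft_indicator_approx hN hN8 hZ htw hα K le_rfl
  have hB := fft_indicator_approx hN hN8 hZ htw hβ K le_rfl
  have hP := corrProd_approx (δ := 2 * (1 / N : ℝ) ^ 9) (G := N ^ 3) (A := (N : ℝ) ^ 3) (B := N) hNpos hZpos
    (fftLevel N Z tc ts (embedNat Z α) K) (fftLevel N Z tc ts (embedNat Z β) K)
    (fun u => ∑ j ∈ Finset.range N, (α j : ℂ) * ω ^ (u * j))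
    (fun u => ∑ j ∈ Finset.range N, (β j : ℂ) * ω ^ (u * j)) (by positivity)
    (fun ix h => (hA ix h).1) (fun ix h => (hB ix h).1) (by push_cast; exact le_rfl)
    (fun ix _ => norm_dft_le hωn hβ ix)
    (fun ix h => by rw [← top α ix h]; exact (hA ix h).2)
    (fun ix h => by rw [← top β ix h]; exact (hB ix h).2)
  have h8 : 8 ^ l ≤ N ^ 3 := by
    rw [hN, ← pow_mul, mul_comm, pow_mul]; exact Nat.pow_le_pow_right (by norm_num) hl
  intro ix hix
  obtain ⟨h1, h2⟩ := fftLevel_approx hN hK hZpos (by positivity) (by positivity) htw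
    (corrProd N Z (fftLevel N Z tc ts (embedNat Z α) K) (fftLevel N Z tc ts (embedNat Z β) K))
    _ (fun ix h => (hP ix h).1) (fun ix h => (hP ix h).2) l hl ix hix
  refine ⟨h1.trans ?_, h2.trans ?_⟩
  · calc 8 ^ l * (N ^ 3 * N ^ 3) * Z ≤ N ^ 3 * (N ^ 3 * N ^ 3) * Z := by gcongr
      _ = N ^ 9 * Z := by ring
  · have h8' : (8 : ℝ) ^ l ≤ N ^ 3 := by exact_mod_cast h8
    have hz := four_div_scale_le hN8 hZ
    set x : ℝ := 1 / N with hx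
    have hNx : (N : ℝ) * x = 1 := by rw [hx]; field_simp
    have hx8 : x ≤ 1 / 8 := by
      rw [hx]; exact one_div_le_one_div_of_le (by norm_num) hNr
    have hx0 : 0 ≤ x := by positivity
    calc (8 : ℝ) ^ l * ((N : ℝ) ^ 3 * (2 * x ^ 9) + N * (2 * x ^ 9) + 4 / Z +
          ((N ^ 3 * N ^ 3 : ℕ) : ℝ) * x ^ 12 + 4 / Z)
        ≤ N ^ 3 * ((N : ℝ) ^ 3 * (2 * x ^ 9) + N * (2 * x ^ 9) + x ^ 12 +
          ((N ^ 3 * N ^ 3 : ℕ) : ℝ) * x ^ 12 + x ^ 12) := by gcongr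
      _ = 2 * ((N * x) ^ 6 * x ^ 3) + 2 * ((N * x) ^ 4 * x ^ 5) + 2 * ((N * x) ^ 3 * x ^ 9) +
          (N * x) ^ 9 * x ^ 3 := by push_cast; ring
      _ = 3 * x ^ 3 + 2 * x ^ 5 + 2 * x ^ 9 := by rw [hNx]; ring
      _ ≤ 3 * (1 / 8) ^ 3 + 2 * (1 / 8) ^ 5 + 2 * (1 / 8) ^ 9 := by gcongr
      _ ≤ 1 / 2 := by norm_num

/-- The fixed point computation gives the exact cyclic correlation after rounding. -/
theorem corrLevel_round (hN : N = 2 ^ K) (hN8 : 8 ≤ N) (hZ : Z = N ^ 31)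
    (htw : GoodTwiddles N Z tc ts ((1 / N : ℝ) ^ 12)) (hα : ∀ j, α j ≤ 1) (hβ : ∀ j, β j ≤ 1)
    {i : ℕ} (hi : i < N) :
    (corrLevel N K Z tc ts α β K ((N - i) % N) 0 + Z * N / 2 -
      corrLevel N K Z tc ts α β K ((N - i) % N) 2) / (Z * N) =
      ∑ j ∈ Finset.range N, α j * β ((i + j) % N) := by
  have hZpos : 0 < Z := by rw [hZ]; positivity
  have hNpos : 0 < N := by omega
  have hmod : (N - i) % N < N := Nat.mod_lt _ hNpos
  have h := (corrLevel_approx hN hN8 hZ htw hα hβ K le_rfl _ hmod).2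
  have hprim := exp_primitive hNpos
  have hω1 : exp (2 * Real.pi * I / N) ^ 2 ^ K = 1 := by rw [← hN]; exact hprim.pow_eq_one
  generalize exp (2 * Real.pi * I / N) = ω at h hprim hω1
  have h2N : 2 ∣ N := by
    rw [hN]; refine dvd_pow_self 2 ?_
    rintro rfl
    rw [hN] at hN8; simp at hN8
  refine round_div hZpos hN8 h2N ?_
  have hE : fftExact N ω (fun u =>
          (∑ j ∈ Finset.range N, (α j : ℂ) * ω ^ ((N - u) % N * j)) *
          ∑ j ∈ Finset.range N, (β j : ℂ) * ω ^ (u * j)) K ((N - i) % N) =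
      ((N * ∑ j ∈ Finset.range N, α j * β ((i + j) % N) : ℕ) : ℂ) := by
    push_cast
    rw [← dft_correlation hNpos hprim (fun j => (α j : ℂ)) (fun j => (β j : ℂ)) hi]
    have := fftExact_top hω1 (fun u => (∑ j ∈ Finset.range N, (α j : ℂ) * ω ^ ((N - u) % N * j)) *
          ∑ j ∈ Finset.range N, (β j : ℂ) * ω ^ (u * j)) (by rw [← hN]; exact hmod)
    rwa [← hN] at this
  rw [hE] at h
  have h' := (Complex.abs_re_le_norm _).trans h
  rw [Complex.sub_re, toC_re, Complex.natCast_re] at h'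
  push_cast at h' ⊢
  exact h'

theorem le_of_sum_range_four {u : ℕ → ℕ} {k b : ℕ} (hk : k < 4)
    (h : ∑ k ∈ Finset.range 4, u k ≤ b) : u k ≤ b :=
  (Finset.single_le_sum (f := u) (fun _ _ => Nat.zero_le _) (Finset.mem_range.mpr hk)).trans h

end correlation

/-! ### Computation of the twiddle factors -/

/-- Fixed point approximations of `cos (π / 2 ^ (j + 1))`. -/
def cosTab (Z : ℕ) : ℕ → ℕ
  | 0 => 0
  | j + 1 => Nat.sqrt (Z * (Z + cosTab Z j) / 2)

/-- Powers of a fixed point complex number in the first quadrant. -/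
def twPair (Z c s : ℕ) : ℕ → ℕ × ℕ
  | 0 => (Z, 0)
  | j + 1 => (((twPair Z c s j).1 * c - (twPair Z c s j).2 * s) / Z,
      ((twPair Z c s j).1 * s + (twPair Z c s j).2 * c) / Z)

theorem cosTab_le (Z j : ℕ) : cosTab Z j ≤ Z := by
  induction j with
  | zero => exact Nat.zero_le _
  | succ j ih =>
    rw [cosTab]
    refine (Nat.sqrt_le_sqrt (?_ : _ ≤ Z * Z)).trans (Nat.sqrt_eq Z).le
    apply Nat.div_le_of_le_mul
    nlinarith

theorem natSqrt_approx (x : ℕ) : (Nat.sqrt x : ℝ) ≤ √x ∧ √x ≤ Nat.sqrt x + 1 := by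
  constructor
  · exact Real.nat_sqrt_le_real_sqrt
  · exact Real.real_sqrt_le_nat_sqrt_succ

/-- The half-angle map `c ↦ √((1 + c) / 2)` does not increase distances of nonnegative arguments,
since both roots are at least `1 / 2`. So each step adds only the error `1 / Z` of the integer
square root; the division by two is exact because `Z` is even. -/
theorem cosTab_approx {Z : ℕ} (hZ : 0 < Z) (h2 : 2 ∣ Z) (j : ℕ) :
    |(cosTab Z j : ℝ) / Z - Real.cos (Real.pi / 2 ^ (j + 1))| ≤ j / Z := by
  have hZ' : (0 : ℝ) < Z := by exact_mod_cast hZ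
  induction j with
  | zero => simp [cosTab]
  | succ j ih =>
    set γ := Real.cos (Real.pi / 2 ^ (j + 1)) with hγ
    have hγ0 : 0 ≤ γ := by
      apply Real.cos_nonneg_of_neg_pi_div_two_le_of_le
      · have : 0 ≤ Real.pi / 2 ^ (j + 1) := by positivity
        linarith [Real.pi_pos]
      · apply div_le_div_of_nonneg_left Real.pi_pos.le (by norm_num)
        calc (2 : ℝ) = 2 ^ 1 := by norm_num
          _ ≤ 2 ^ (j + 1) := pow_le_pow_right₀ (by norm_num) (by omega)
    have hnext : Real.cos (Real.pi / 2 ^ (j + 1 + 1)) = √((1 + γ) / 2) := by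
      rw [hγ, show Real.pi / 2 ^ (j + 1 + 1) = Real.pi / 2 ^ (j + 1) / 2 by rw [pow_succ _ (j + 1)]; ring]
      rw [Real.cos_half]
      · have : 0 ≤ Real.pi / 2 ^ (j + 1) := by positivity
        linarith [Real.pi_pos]
      · exact div_le_self Real.pi_pos.le (one_le_pow₀ (by norm_num))
    rw [hnext, cosTab]
    set c := cosTab Z j
    have hy : ((Z * (Z + c) / 2 : ℕ) : ℝ) = Z ^ 2 * ((1 + c / Z) / 2) := by
      rw [Nat.cast_div (h2.mul_right _) (by norm_num)]
      push_cast; field_simp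
    have hsq := natSqrt_approx (Z * (Z + c) / 2)
    rw [hy, Real.sqrt_mul (by positivity), Real.sqrt_sq hZ'.le] at hsq
    set a := √((1 + c / Z : ℝ) / 2) with ha
    set b := √((1 + γ) / 2) with hb
    have hc0 : (0 : ℝ) ≤ (c : ℝ) / Z := by positivity
    have ha2 : a ^ 2 = (1 + c / Z : ℝ) / 2 := Real.sq_sqrt (by positivity)
    have hb2 : b ^ 2 = (1 + γ) / 2 := Real.sq_sqrt (by positivity)
    have ha0 : (1 / 2 : ℝ) ≤ a := Real.le_sqrt_of_sq_le (by linarith)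
    have hb0 : (1 / 2 : ℝ) ≤ b := Real.le_sqrt_of_sq_le (by linarith)
    have hab : |a - b| ≤ |(c : ℝ) / Z - γ| := by
      have h1 : (a - b) * (a + b) = (c / Z - γ) / 2 := by nlinarith
      have h2 : |a - b| * (a + b) = |(c : ℝ) / Z - γ| / 2 := by
        rw [← abs_of_nonneg (by linarith : 0 ≤ a + b), ← abs_mul, h1, abs_div, abs_two]
      nlinarith [abs_nonneg (a - b), abs_nonneg ((c : ℝ) / Z - γ)]
    have hq : |(Nat.sqrt (Z * (Z + c) / 2) : ℝ) / Z - a| ≤ 1 / Z := by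
      rw [abs_le]
      constructor
      · rw [neg_le_sub_iff_le_add, ← add_div, le_div_iff₀ hZ']; linarith
      · rw [sub_le_iff_le_add, div_le_iff₀ hZ', add_mul]
        have : 0 ≤ 1 / (Z : ℝ) * Z := by positivity
        linarith
    calc _ ≤ |(Nat.sqrt (Z * (Z + c) / 2) : ℝ) / Z - a| + |a - b| := abs_sub_le _ _ _
      _ ≤ 1 / Z + j / Z := add_le_add hq (hab.trans ih)
      _ = ((j + 1 : ℕ) : ℝ) / Z := by push_cast; ring

/-! ### Accuracy of the table of roots of unity -/

section twiddles
open Complex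

theorem norm_le_of_re_im {z z' : ℂ} (h1 : |z.re| ≤ |z'.re|) (h2 : z.im = z'.im) : ‖z‖ ≤ ‖z'‖ := by
  rw [Complex.norm_def, Complex.norm_def]
  apply Real.sqrt_le_sqrt
  rw [normSq_apply, normSq_apply, h2]
  have := mul_self_le_mul_self (abs_nonneg _) h1
  rw [abs_mul_abs_self, abs_mul_abs_self] at this
  linarith

theorem floor_pair {Z : ℕ} (hZ : 0 < Z) (a b : ℕ) :
    ‖(((a / Z : ℕ) : ℂ) + ((b / Z : ℕ) : ℂ) * I) / Z - ((a : ℂ) + b * I) / Z / Z‖ ≤ 4 / Z := by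
  have h := toC_floor hZ (fun k => if k = 0 then a else if k = 1 then b else 0)
  simpa [toC, Finset.sum_range_succ] using h

/-- The real part of a product may be truncated at zero if the exact value is not negative. -/
theorem truncated_product {Z u v c s : ℕ} (hZ : 0 < Z) {x : ℂ} (hx : 0 ≤ x.re) :
    ‖(((u * c - v * s : ℕ) : ℂ) + ((u * s + v * c : ℕ) : ℂ) * I) / Z / Z - x‖ ≤
      ‖((u : ℂ) + v * I) / Z * (((c : ℂ) + s * I) / Z) - x‖ := by
  have hZ' : (0 : ℝ) < Z := by exact_mod_cast hZ
  have hZc : (Z : ℂ) ≠ 0 := by exact_mod_cast hZ.ne'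
  have e1 : ((u : ℂ) + v * I) / Z * (((c : ℂ) + s * I) / Z) =
      ((((u * c : ℝ) - v * s : ℝ) : ℂ) + ((u * s + v * c : ℝ) : ℂ) * I) / Z / Z := by
    rw [div_mul_div_comm, div_div]
    congr 1
    push_cast
    ring_nf
    rw [I_sq]; ring
  rw [e1]
  apply norm_le_of_re_im
  · simp only [sub_re, div_natCast_re, add_re, mul_re, ofReal_re, natCast_re, I_re, mul_zero,
      natCast_im, I_im, mul_one, sub_zero, add_zero, ofReal_im]
    by_cases h : v * s ≤ u * c
    · rw [Nat.cast_sub h]; push_cast; exact le_rfl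
    · have h0 : u * c - v * s = 0 := by omega
      have h1 : ((u : ℝ) * c - v * s) / Z / Z ≤ 0 := by
        have : ((u : ℝ) * c) ≤ v * s := by exact_mod_cast (not_le.mp h).le
        exact div_nonpos_of_nonpos_of_nonneg (div_nonpos_of_nonpos_of_nonneg (by linarith) hZ'.le) hZ'.le
      rw [h0, Nat.cast_zero, zero_div, zero_div, zero_sub, abs_neg, abs_of_nonneg hx,
        abs_of_nonpos (by linarith)]
      linarith
  · simp

theorem exp_pow_re_nonneg {N j : ℕ} (hN : 0 < N) (hj : j ≤ N / 4) :
    0 ≤ (exp (2 * Real.pi * I / N) ^ j).re := by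
  have hN' : (0 : ℝ) < N := by exact_mod_cast hN
  rw [← Complex.exp_nat_mul, show (j : ℂ) * (2 * Real.pi * I / N) = ((2 * Real.pi * j / N : ℝ) : ℂ) * I by
    push_cast; ring, Complex.exp_ofReal_mul_I_re]
  apply Real.cos_nonneg_of_neg_pi_div_two_le_of_le
  · have : 0 ≤ 2 * Real.pi * j / N := by positivity
    linarith [Real.pi_pos]
  · rw [div_le_iff₀ hN']
    have : (4 * j : ℝ) ≤ N := by exact_mod_cast (by omega : 4 * j ≤ N)
    nlinarith [Real.pi_pos]

/-- At most `N` half-angle steps leave the cosine with error `N * N ^ (-31)`. The sine is `√(1 - c ^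
2)`, which is not Lipschitz near zero; `(a - b) ^ 2 ≤ |a ^ 2 - b ^ 2|` for nonnegative `a`, `b`
preserves half of the digits and gives the exponent 15. -/
theorem first_twiddle {N K Z : ℕ} (hN : N = 2 ^ K) (hN8 : 8 ≤ N) (hZ : Z = N ^ 31) :
    ‖((cosTab Z (K - 2) : ℂ) + (Nat.sqrt (Z * Z - cosTab Z (K - 2) * cosTab Z (K - 2)) : ℂ) * I) / Z -
      exp (2 * Real.pi * I / N)‖ ≤ 4 * (1 / N : ℝ) ^ 15 := by
  have hNr : (8 : ℝ) ≤ N := by exact_mod_cast hN8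
  have hZpos : 0 < Z := by rw [hZ]; positivity
  have hZ' : (0 : ℝ) < Z := by exact_mod_cast hZpos
  have hK : 3 ≤ K := by
    by_contra h
    have : N ≤ 2 ^ 2 := by rw [hN]; exact Nat.pow_le_pow_right (by norm_num) (by omega)
    omega
  have h2Z : 2 ∣ Z := by
    rw [hZ, hN, ← pow_mul]; exact dvd_pow_self 2 (by omega)
  set θ : ℝ := Real.pi / 2 ^ (K - 2 + 1) with hθ
  have hexp : exp (2 * Real.pi * I / N) = Real.cos θ + Real.sin θ * I := by
    rw [Complex.ofReal_cos, Complex.ofReal_sin, ← Complex.exp_mul_I]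
    congr 1
    rw [hθ, hN]
    obtain ⟨L, rfl⟩ : ∃ L, K = L + 3 := ⟨K - 3, by omega⟩
    rw [show L + 3 - 2 + 1 = L + 2 by omega]
    push_cast
    field_simp
    ring
  have hc := cosTab_approx hZpos h2Z (K - 2)
  rw [← hθ] at hc
  set c := cosTab Z (K - 2) with hcdef
  have hcZ : c ≤ Z := cosTab_le _ _
  set s := Nat.sqrt (Z * Z - c * c) with hs
  have hKN : ((K - 2 : ℕ) : ℝ) ≤ N := by
    have : K - 2 ≤ N := by rw [hN]; exact (Nat.sub_le _ _).trans Nat.lt_two_pow_self.le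
    exact_mod_cast this
  set x : ℝ := 1 / N with hx
  have hx0 : 0 ≤ x := by positivity
  have hx8 : x ≤ 1 / 8 := one_div_le_one_div_of_le (by norm_num) hNr
  have hNZ : (N : ℝ) / Z = x ^ 30 := by
    rw [hZ, hx]; push_cast; field_simp
  have h1Z : 1 / (Z : ℝ) = x ^ 31 := by rw [hZ, hx]; push_cast; field_simp
  have hc' : |(c : ℝ) / Z - Real.cos θ| ≤ x ^ 30 :=
    hc.trans (by rw [← hNZ]; gcongr)
  have hsin0 : 0 ≤ Real.sin θ := by
    apply Real.sin_nonneg_of_nonneg_of_le_pi (by positivity)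
    exact div_le_self Real.pi_pos.le (one_le_pow₀ (by norm_num))
  have hy : ((Z * Z - c * c : ℕ) : ℝ) = Z ^ 2 * (1 - (c / Z) ^ 2) := by
    rw [Nat.cast_sub (Nat.mul_le_mul hcZ hcZ)]; push_cast; field_simp
  have hcZ1 : (c : ℝ) / Z ≤ 1 := by rw [div_le_one hZ']; exact_mod_cast hcZ
  have hcZ0 : (0 : ℝ) ≤ (c : ℝ) / Z := by positivity
  have hsq := natSqrt_approx (Z * Z - c * c)
  rw [hy, Real.sqrt_mul (by positivity), Real.sqrt_sq hZ'.le] at hsq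
  set a := √(1 - ((c : ℝ) / Z) ^ 2) with ha
  have ha0 : 0 ≤ a := Real.sqrt_nonneg _
  have ha2 : a ^ 2 = 1 - ((c : ℝ) / Z) ^ 2 := Real.sq_sqrt (by nlinarith)
  have hq : |(s : ℝ) / Z - a| ≤ 1 / Z := by
    rw [abs_le]
    constructor
    · rw [neg_le_sub_iff_le_add, ← add_div, le_div_iff₀ hZ']; linarith
    · rw [sub_le_iff_le_add, div_le_iff₀ hZ', add_mul]
      have : 0 ≤ 1 / (Z : ℝ) * Z := by positivity
      linarith
  have hs' : |a - Real.sin θ| ≤ 2 * x ^ 15 := by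
    apply abs_le_of_sq_le_sq _ (by positivity)
    have h1 : (a - Real.sin θ) ^ 2 ≤ |a ^ 2 - Real.sin θ ^ 2| := by
      rw [← sq_abs, sq_sub_sq, abs_mul, pow_two, mul_comm |a + Real.sin θ|]
      refine mul_le_mul_of_nonneg_left ?_ (abs_nonneg _)
      rw [abs_of_nonneg (add_nonneg ha0 hsin0), abs_le]
      constructor <;> linarith
    have h2 : a ^ 2 - Real.sin θ ^ 2 = -((c / Z - Real.cos θ) * (c / Z + Real.cos θ)) := by
      rw [ha2, Real.sin_sq]; ring
    rw [h2, abs_neg, abs_mul] at h1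
    have h3 : |(c : ℝ) / Z + Real.cos θ| ≤ 2 := by
      rw [abs_le]; constructor <;> linarith [Real.neg_one_le_cos θ, Real.cos_le_one θ]
    have h4 := mul_le_mul hc' h3 (abs_nonneg _) (by positivity)
    have h5 : 0 ≤ x ^ 30 := by positivity
    calc _ ≤ _ := h1.trans h4
      _ ≤ (2 * x ^ 15) ^ 2 := by ring_nf; linarith
  rw [hexp]
  have hdecomp : ((c : ℂ) + (s : ℂ) * I) / Z - (Real.cos θ + Real.sin θ * I) =
      ((c / Z - Real.cos θ : ℝ) : ℂ) + ((s / Z - Real.sin θ : ℝ) : ℂ) * I := by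
    push_cast; ring
  rw [hdecomp]
  refine (norm_add_le _ _).trans ?_
  rw [norm_mul, norm_I, mul_one, Complex.norm_real, Complex.norm_real, Real.norm_eq_abs, Real.norm_eq_abs]
  have h6 := abs_sub_le ((s : ℝ) / Z) a (Real.sin θ)
  have h7 : x ^ 30 ≤ x ^ 15 := pow_le_pow_of_le_one hx0 (by linarith) (by norm_num)
  have h8 : x ^ 31 ≤ x ^ 16 := pow_le_pow_of_le_one hx0 (by linarith) (by norm_num)
  have h9 : x ^ 16 ≤ x ^ 15 := pow_le_pow_of_le_one hx0 (by linarith) (by norm_num)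
  rw [h1Z] at hq
  linarith

/-- Each multiplication by the first twiddle factor carries the old error along with factor `‖ω‖ =
1` and adds at most `2 * 4 * N ^ (-15)` from the factor and `N ^ (-15)` from rounding. Truncation at
zero in `twPair` is harmless by `truncated_product`, because exact powers in the first quadrant have
nonnegative real part. -/
theorem goodTwiddles_table {N K Z : ℕ} (hN : N = 2 ^ K) (hN8 : 8 ≤ N) (hZ : Z = N ^ 31) {c s : ℕ}
    (hc : c = cosTab Z (K - 2)) (hs : s = Nat.sqrt (Z * Z - c * c)) :
    GoodTwiddles N Z (fun j => (twPair Z c s j).1) (fun j => (twPair Z c s j).2) ((1 / N : ℝ) ^ 12) := by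
  have hNr : (8 : ℝ) ≤ N := by exact_mod_cast hN8
  have hZpos : 0 < Z := by rw [hZ]; positivity
  have hZ' : (0 : ℝ) < Z := by exact_mod_cast hZpos
  have hNpos : 0 < N := by omega
  have hfirst := first_twiddle hN hN8 hZ
  rw [← hc, ← hs] at hfirst
  set ω := exp (2 * Real.pi * I / N) with hω
  have hωn : ∀ j, ‖ω ^ j‖ = 1 := fun j => by
    rw [norm_pow, (exp_primitive hNpos).norm'_eq_one hNpos.ne', one_pow]
  set x : ℝ := 1 / N with hx
  have hx0 : 0 ≤ x := by positivity
  have hx8 : x ≤ 1 / 8 := one_div_le_one_div_of_le (by norm_num) hNr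
  have hNx : (N : ℝ) * x = 1 := by rw [hx]; field_simp
  have h4Z : (4 : ℝ) / Z ≤ x ^ 15 := by
    have : 1 / (Z : ℝ) = x ^ 31 := by rw [hZ, hx]; push_cast; field_simp
    rw [show (4 : ℝ) / Z = 4 * (1 / Z) by ring, this, show x ^ 31 = x ^ 15 * (x ^ 15 * x) by ring]
    have h1 : x ^ 15 ≤ 1 := pow_le_one₀ hx0 (by linarith)
    have h2 : 0 ≤ x ^ 15 := by positivity
    nlinarith [mul_nonneg h2 hx0, mul_nonneg h2 (mul_nonneg h2 hx0)]
  have hsmall : ∀ j : ℕ, j ≤ N → (j : ℝ) * (9 * x ^ 15) ≤ x ^ 12 := by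
    intro j hj
    have : (j : ℝ) ≤ N := by exact_mod_cast hj
    calc (j : ℝ) * (9 * x ^ 15) ≤ N * (9 * x ^ 15) := by gcongr
      _ = (N * x) * (9 * x ^ 14) := by ring
      _ = 9 * x ^ 2 * x ^ 12 := by rw [hNx]; ring
      _ ≤ 1 * x ^ 12 := by
        gcongr
        nlinarith
      _ = x ^ 12 := one_mul _
  have hx12 : x ^ 12 ≤ 1 := pow_le_one₀ hx0 (by linarith)
  have key : ∀ j, j ≤ N / 4 →
      ‖(((twPair Z c s j).1 : ℂ) + (twPair Z c s j).2 * I) / Z - ω ^ j‖ ≤ j * (9 * x ^ 15) := by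
    intro j
    induction j with
    | zero =>
      intro _
      have hZc : (Z : ℂ) ≠ 0 := by exact_mod_cast hZpos.ne'
      simp [twPair, div_self hZc]
    | succ j ih =>
      intro hj
      have ih := ih (by omega)
      set u := (twPair Z c s j).1
      set v := (twPair Z c s j).2
      have hstep : twPair Z c s (j + 1) = ((u * c - v * s) / Z, (u * s + v * c) / Z) := rfl
      rw [hstep]
      have h1 := floor_pair hZpos (u * c - v * s) (u * s + v * c)
      have h2 := truncated_product (u := u) (v := v) (c := c) (s := s) hZpos
        (exp_pow_re_nonneg hNpos hj)
      rw [← hω] at h2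
      set a := ((u : ℂ) + v * I) / Z
      set b := ((c : ℂ) + s * I) / Z
      have ha : ‖a‖ ≤ 2 := by
        have h3 := norm_sub_norm_le a (ω ^ j)
        rw [hωn] at h3
        have := hsmall j (by omega)
        linarith
      have h4 : ‖a * b - ω ^ (j + 1)‖ ≤ j * (9 * x ^ 15) + 8 * x ^ 15 := by
        rw [show a * b - ω ^ (j + 1) = a * (b - ω) + (a - ω ^ j) * ω by ring]
        refine (norm_add_le _ _).trans ?_
        rw [norm_mul, norm_mul]
        have h5 := mul_le_mul ha hfirst (norm_nonneg _) (by norm_num)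
        have h6 : ‖ω‖ = 1 := by simpa using hωn 1
        rw [h6]
        linarith
      refine (norm_sub_le_norm_sub_add_norm_sub _ _ _).trans ((add_le_add h1 (h2.trans h4)).trans ?_)
      push_cast
      linarith
  intro j hj
  have hk := (key j hj.le).trans (hsmall j (by omega))
  have hn : ‖(((twPair Z c s j).1 : ℂ) + (twPair Z c s j).2 * I) / Z‖ ≤ 2 := by
    have h3 := norm_sub_norm_le ((((twPair Z c s j).1 : ℂ) + (twPair Z c s j).2 * I) / Z) (ω ^ j)
    rw [hωn] at h3
    linarith
  refine ⟨?_, ?_, hk⟩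
  · have h := (Complex.abs_re_le_norm _).trans hn
    rw [div_natCast_re, abs_le] at h
    have h' := h.2
    rw [div_le_iff₀ hZ'] at h'
    simp at h'
    exact_mod_cast h'
  · have h := (Complex.abs_im_le_norm _).trans hn
    rw [div_natCast_im, abs_le] at h
    have h' := h.2
    rw [div_le_iff₀ hZ'] at h'
    simp at h'
    exact_mod_cast h'

end twiddles

/-! ## The programs -/

section programs
open Vr

/-- The hash value of the variable `z` at the point `t`. -/
def hashProg (z r : Vr) : Prog :=
  .seq (.assign r 0) <| .seq (.assign pw D) <| .while (Expr.lt 1 pw) <|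
    .seq (.assign pw (pw / 2)) (.assign r ((r * t + z / pw % 2) % p))

/-- The number of steps for one hash pair. -/
def phaseLen : Expr := 4 * N * (3 * (K + 1) + 1)

/-- Decoding of the step counter. -/
def stepHead : Prog :=
  .seq (.assign ph (g / phaseLen)) <| .seq (.assign c (g % phaseLen)) <|
  .seq (.assign sec (c / (4 * N))) <| .seq (.assign ix (c % (4 * N) / 4)) <|
  .seq (.assign kk (c % 4)) <| .seq (.assign grp (sec / (K + 1))) (.assign lv (sec % (K + 1)))

/-- The content of a transform cell. -/
def cellE (s i k : Expr) : Expr := .load (20 * N + (4 * N * s + 4 * i + k))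

/-- The index of the first input of a butterfly. -/
def srcE : Expr := ix / (2 * .pow2 (lv - 1)) * .pow2 (lv - 1) + ix % .pow2 (lv - 1)

/-- The exponent of the twiddle factor of a butterfly. -/
def twE : Expr := ix % (2 * .pow2 (lv - 1)) * (N / (2 * .pow2 (lv - 1)))

/-- One component of a butterfly. -/
def stepButterfly : Prog :=
  .store (20 * N + c) (cellE (sec - 1) srcE kk +
    (cellE (sec - 1) (srcE + N / 2) ((kk + 4 - twE / (N / 4)) % 4) * .load (18 * N + 2 * (twE % (N / 4))) +
      cellE (sec - 1) (srcE + N / 2) ((kk + 7 - twE / (N / 4)) % 4) *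
        .load (18 * N + 2 * (twE % (N / 4)) + 1)) / Z)

/-- One component of an indicator sequence of the pattern or of the text. -/
def stepIndicator : Prog :=
  .seq (.assign t (ph / p)) <|
  .seq (.assign xv (.load (2 * N + grp * m + ix) * Expr.lt ix (grp * n + (1 - grp) * m))) <|
  .seq (hashProg xv h) <|
  .store (20 * N + c)
    (Expr.eq kk 0 * (Z * (Expr.lt ix (grp * n + (1 - grp) * m) * Expr.eq h (ph % p))))

/-- One component of the pointwise product. -/
def stepProduct : Prog :=
  .store (20 * N + c) ((cellE K ((N - ix) % N) 0 * cellE (2 * K + 1) ix ((kk + 4 - 0) % 4) +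
    cellE K ((N - ix) % N) 1 * cellE (2 * K + 1) ix ((kk + 4 - 1) % 4) +
    cellE K ((N - ix) % N) 2 * cellE (2 * K + 1) ix ((kk + 4 - 2) % 4) +
    cellE K ((N - ix) % N) 3 * cellE (2 * K + 1) ix ((kk + 4 - 3) % 4)) / Z)

/-- Accumulation of the rounded result. -/
def stepResult : Prog :=
  .store (10 * N + 4 * N * (1 - yb) + (4 * ix + kk))
    (.load (10 * N + 4 * N * (1 - yb) + (4 * ix + kk)) * Expr.lt 0 ph +
      (cellE (3 * K + 2) ((N - ix) % N) 0 + Z * N / 2 - cellE (3 * K + 2) ((N - ix) % N) 2) / (Z * N))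

/-- One step of the computation of the numbers of agreements for the frozen strings. -/
def stepProg : Prog :=
  .seq stepHead <| .seq
    (.ite (Expr.lt 0 lv) stepButterfly <| .ite (Expr.lt grp 2) stepIndicator <|
      .ite (Expr.lt grp 3) stepProduct stepResult)
    (.assign g (g + 1))

/-- Addition of the numbers of agreements of the letter `o` with the letters `new` and `old`. -/
def compareProg : Prog :=
  .seq (.assign t 0) <| .while (Expr.lt t p) <|
    .seq (hashProg old h1) <| .seq (hashProg new h2) <| .seq (hashProg o h3) <|
    .seq (.assign pl (pl + Expr.eq h2 h3)) <| .seq (.assign mi (mi + Expr.eq h1 h3))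
    (.assign t (t + 1))

/-- The contribution of the log entry at `i` to a query at `a0`. -/
def entryProg : Prog :=
  .seq (.assign pos (.load i)) <| .seq (.assign old (.load (i + 1))) <|
  .seq (.assign new (.load (i + 2))) <|
  .ite (Expr.lt pos m) (.seq (.assign o (.load (4 * N + (m + a0 + pos)))) compareProg) <|
  .ite (Expr.lt pos (m + a0) + Expr.lt (m + a0 + m) (pos + 1)) .skip
    (.seq (.assign o (.load (pos - (m + a0)))) compareProg)

/-- The contributions of `len` log entries from the address `base` on. -/
def logProg (base len : Expr) : Prog :=
  .seq (.assign k 0) <| .while (Expr.lt k len) <|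
    .seq (.assign i (base + 3 * k)) <| .seq entryProg (.assign k (k + 1))

/-- The query. -/
def queryProg : Prog :=
  .seq (.assign pl (.load (10 * N + 4 * N * yb + 4 * a0))) <| .seq (.assign mi 0) <|
  .seq (logProg (6 * N + 2 * N * yb) lo) <| .seq (logProg (6 * N + 2 * N * (1 - yb)) cnt)
    (.assign a0 ((p * m + mi - pl) / (p - d)))

/-- Application of `len` log entries from the address `base` on to the string at `dst`. -/
def replayProg (dst base len : Expr) : Prog :=
  .seq (.assign k 0) <| .while (Expr.lt k len) <|
    .seq (.assign i (base + 3 * k)) <|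
    .seq (.store (dst + .load i) (.load (i + 2))) (.assign k (k + 1))

/-- The end of an epoch. -/
def flushProg : Prog :=
  .seq (replayProg (4 * N) (6 * N + 2 * N * yb) lo) <|
  .seq (replayProg (2 * N) (6 * N + 2 * N * (1 - yb)) cnt) <|
  .seq (.assign yb (1 - yb)) <| .seq (.assign lo cnt) <| .seq (.assign cnt 0) (.assign g 0)

/-- Substitution of the letter at `a0` by `a1`. -/
def updateProg : Prog :=
  .seq (.assign i (6 * N + 2 * N * (1 - yb) + 3 * cnt)) <|
  .seq (.store i a0) <| .seq (.store (i + 1) (.load a0)) <| .seq (.store (i + 2) a1) <|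
  .seq (.store a0 a1) <| .seq (.assign cnt (cnt + 1)) <| .seq (.assign q 0) <|
  .seq (.while (Expr.lt q Q) (.seq stepProg (.assign q (q + 1)))) <|
  .ite (Expr.eq cnt B) flushProg .skip

/-- Substitution of a letter of the text. -/
def updateTextProg : Prog := .seq (.assign a0 (m + a0)) updateProg

/-- The parameters of the data structure that do not depend on the prime. -/
def sizeProg (a : ℕ) : Prog :=
  .seq (.assign m a0) <| .seq (.assign n a1) <| .seq (.assign B 1) <| .seq (.assign K 0) <|
  .seq (.while (Expr.lt (B * B) m) (.seq (.assign B (B * 2)) (.assign K (K + 1)))) <|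
  .seq (.assign K (2 * K + 1)) <| .seq (.assign N (2 * (B * B))) <|
  .seq (.assign d (.lit a * K + 1)) <| .seq (.assign D (.pow2 d)) (.assign Z ((N : Expr).pow 31))

/-- The least prime above `2 (d + 1) e`. -/
def primeProg : Prog :=
  .seq (.assign p (2 * (d + 1) * e + 1)) <| .seq (.assign q 2) <| .while (Expr.lt q p) <|
    .ite (p % q) (.assign q (q + 1)) (.seq (.assign p (p + 1)) (.assign q 2))

/-- The integer square root of the variable `xv`. -/
def sqrtProg (r : Vr) : Prog :=
  .seq (.assign r 0) <| .while (Expr.lt ((r + 1) * (r + 1)) (xv + 1)) (.assign r (r + 1))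

/-- The table of twiddle factors. -/
def twiddleProg : Prog :=
  .seq (.assign c 0) <| .seq (.assign k 2) <|
  .seq (.while (Expr.lt k K) <| .seq (.assign xv (Z * (Z + c) / 2)) <|
    .seq (sqrtProg c) (.assign k (k + 1))) <|
  .seq (.assign xv (Z * Z - c * c)) <| .seq (sqrtProg s) <|
  .seq (.assign old Z) <| .seq (.assign new 0) <| .seq (.assign k 0) <|
  .while (Expr.lt k (N / 4)) <|
    .seq (.store (18 * N + 2 * k) old) <| .seq (.store (18 * N + 2 * k + 1) new) <|
    .seq (.assign xv ((old * c - new * s) / Z)) <|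
    .seq (.assign new ((old * s + new * c) / Z)) <| .seq (.assign old xv) (.assign k (k + 1))

/-- Copies of the strings. -/
def copyProg : Prog :=
  .seq (.assign k 0) <| .while (Expr.lt k (m + n)) <|
    .seq (.store (2 * N + k) (.load k)) <| .seq (.store (4 * N + k) (.load k)) (.assign k (k + 1))

/-- Preprocessing. -/
def initProg (a : ℕ) : Prog :=
  .seq (sizeProg a) <| .seq primeProg <| .seq twiddleProg <| .seq copyProg <|
  .seq (.assign yb 0) <| .seq (.assign lo 0) <| .seq (.assign cnt 0) <| .seq (.assign g 0) <|
  .seq (.assign Q (p * p * (8 * B * (3 * (K + 1) + 1)))) <| .seq (.assign q 0) <|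
  .seq (.while (Expr.lt q (B * Q)) (.seq stepProg (.assign q (q + 1)))) <|
  .seq (.assign yb 1) (.assign g 0)

/-- The data structure. -/
def hammingData (a : ℕ) : DynProgram where
  init := (initProg a).code
  updatePattern := updateProg.code
  updateText := updateTextProg.code
  query := queryProg.code

end programs

/-! ## Correctness of the background computation -/

/-- The parameters of the data structure. -/
structure Cfg where
  (m n e B N K D d p Z : ℕ)

/-- The relations between the parameters. -/
structure Cfg.Good (q : Cfg) : Prop where
  two_le_m : 2 ≤ q.m
  m_le_n : q.m ≤ q.n
  n_le : q.n ≤ 2 * q.m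
  m_le : q.m ≤ q.B * q.B
  two_le_B : 2 ≤ q.B
  N_eq : q.N = 2 * (q.B * q.B)
  N_pow : q.N = 2 ^ q.K
  D_eq : q.D = 2 ^ q.d
  prime : q.p.Prime
  d_lt : q.d < q.p
  Z_eq : q.Z = q.N ^ 31

namespace Cfg

/-- The number of steps for one hash pair. -/
def len (q : Cfg) : ℕ := 4 * q.N * (3 * (q.K + 1) + 1)

/-- The number of memory cells. -/
def space (q : Cfg) : ℕ := 20 * q.N + q.len

/-- A bound for all values. -/
def bound (q : Cfg) : ℕ := (q.N * q.p * q.D) ^ 100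

variable {q : Cfg} (hq : q.Good)

namespace Good
include hq

theorem eight_le : 8 ≤ q.N := by
  have := hq.two_le_B
  rw [hq.N_eq]; nlinarith

theorem p_pos : 0 < q.p := hq.prime.pos

theorem D_pos : 0 < q.D := by rw [hq.D_eq]; positivity

theorem Z_pos : 0 < q.Z := by
  have := hq.eight_le
  rw [hq.Z_eq]; positivity

/-- The exponent 100 in `bound` is generous: stored values are bounded by such products with much
smaller exponents. -/
theorem le_bound {i j k : ℕ} (hi : i ≤ 100) (hj : j ≤ 100) (hk : k ≤ 100) :
    q.N ^ i * q.p ^ j * q.D ^ k ≤ q.bound := by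
  have h1 := hq.eight_le
  have h2 := hq.p_pos
  have h3 := hq.D_pos
  rw [bound, mul_pow, mul_pow]
  gcongr
  all_goals omega

theorem N_pow_le {i : ℕ} (hi : i ≤ 100) : q.N ^ i ≤ q.bound := by
  simpa using hq.le_bound hi (Nat.zero_le 100) (Nat.zero_le 100)

theorem p_le : q.p ≤ q.bound := by
  simpa using hq.le_bound (Nat.zero_le 100) (show 1 ≤ 100 by norm_num) (Nat.zero_le 100)

theorem D_le : q.D ≤ q.bound := by
  simpa using hq.le_bound (Nat.zero_le 100) (Nat.zero_le 100) (show 1 ≤ 100 by norm_num)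

theorem two_le_bound : 2 ≤ q.bound := hq.prime.two_le.trans hq.p_le

theorem K_lt : q.K < q.N := by rw [hq.N_pow]; exact Nat.lt_two_pow_self

theorem three_le_K : 3 ≤ q.K := by
  by_contra h
  have := hq.eight_le
  have : q.N ≤ 2 ^ 2 := by rw [hq.N_pow]; exact Nat.pow_le_pow_right (by norm_num) (by omega)
  omega

theorem len_le : q.len ≤ 2 * q.N ^ 3 := by
  have h1 := hq.eight_le
  have h2 := hq.K_lt
  have : q.len ≤ 4 * q.N * (3 * q.N + 1) := by
    unfold len; gcongr; omega
  nlinarith [Nat.mul_le_mul h1 h1, Nat.mul_le_mul_left q.N (Nat.mul_le_mul h1 h1),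
    Nat.mul_le_mul_left (q.N * q.N) h1]

theorem space_le : q.space ≤ q.N ^ 4 := by
  have h1 := hq.eight_le
  have h2 := hq.len_le
  have h3 : 8 * q.N ^ 3 ≤ q.N ^ 4 := by rw [pow_succ q.N 3, mul_comm]; gcongr
  have h4 : 64 * q.N ≤ q.N ^ 3 := by
    have := Nat.mul_le_mul h1 h1
    calc 64 * q.N ≤ q.N * q.N * q.N := by gcongr
      _ = q.N ^ 3 := by ring
  unfold space; omega

theorem N_lt_bound : q.N ≤ q.bound := by simpa using hq.N_pow_le (show 1 ≤ 100 by norm_num)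

theorem space_le_bound : q.space ≤ q.bound := hq.space_le.trans (hq.N_pow_le (by norm_num))

end Good

variable (q)

/-- The variables hold the parameters. -/
structure Holds (s : St) : Prop where
  m : s.var .m = q.m
  n : s.var .n = q.n
  B : s.var .B = q.B
  N : s.var .N = q.N
  K : s.var .K = q.K
  D : s.var .D = q.D
  d : s.var .d = q.d
  p : s.var .p = q.p
  Z : s.var .Z = q.Z

/-- The variables that hold the parameters. -/
def params : List Vr := [.m, .n, .B, .N, .K, .D, .d, .p, .Z]

variable {q}

theorem Holds.congr {s s' : St} (h : q.Holds s) (h' : ∀ x ∈ params, s'.var x = s.var x) :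
    q.Holds s' := by
  constructor
  all_goals rw [h' _ (by simp [params])]
  exacts [h.m, h.n, h.B, h.N, h.K, h.D, h.d, h.p, h.Z]

/-! ### What the background computation has achieved after a given number of steps -/

variable (q) (tc ts : ℕ → ℕ) (F : ℕ → ℕ)

/-- The indicator sequence of the pattern for a hash pair. -/
def patInd (φ j : ℕ) : ℕ :=
  if j < q.m ∧ hashVal q.p (φ / q.p) q.d (F j) = φ % q.p then 1 else 0

/-- The indicator sequence of the text for a hash pair. -/
def textInd (φ j : ℕ) : ℕ :=
  if j < q.n ∧ hashVal q.p (φ / q.p) q.d (F (q.m + j)) = φ % q.p then 1 else 0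

/-- The cyclic correlation of the indicator sequences. -/
def corrCount (φ i : ℕ) : ℕ :=
  ∑ j ∈ Finset.range q.N, q.patInd F φ j * q.textInd F φ ((i + j) % q.N)

/-- The content of the transform cells for a hash pair. -/
def cell (φ sec : ℕ) : ℕ → ℕ → ℕ :=
  if sec / (q.K + 1) = 0 then fftLevel q.N q.Z tc ts (embedNat q.Z (q.patInd F φ)) (sec % (q.K + 1))
  else if sec / (q.K + 1) = 1 then
    fftLevel q.N q.Z tc ts (embedNat q.Z (q.textInd F φ)) (sec % (q.K + 1))
  else corrLevel q.N q.K q.Z tc ts (q.patInd F φ) (q.textInd F φ) (sec % (q.K + 1))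

/-- The state of the background computation for the hash pair `φ` after `c` steps; the results are
collected from the address `R` on. -/
structure Progress (R φ c : ℕ) (mem : ℕ → ℕ) : Prop where
  cells : ∀ sec ix k, sec < 3 * (q.K + 1) → ix < q.N → k < 4 → 4 * q.N * sec + 4 * ix + k < c →
    mem (20 * q.N + (4 * q.N * sec + 4 * ix + k)) = q.cell tc ts F φ sec ix k
  done : ∀ ix k, ix < q.N → k < 4 → 4 * q.N * (3 * (q.K + 1)) + 4 * ix + k < c →
    mem (R + (4 * ix + k)) = ∑ ψ ∈ Finset.range (φ + 1), q.corrCount F ψ ix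
  todo : ∀ ix k, ix < q.N → k < 4 → c ≤ 4 * q.N * (3 * (q.K + 1)) + 4 * ix + k → 0 < φ →
    mem (R + (4 * ix + k)) = ∑ ψ ∈ Finset.range φ, q.corrCount F ψ ix

variable {q tc ts F}

/-- Nothing is required of the memory at the start, so a new run may overwrite the remains of an old
one. -/
theorem Progress.start (R : ℕ) (mem : ℕ → ℕ) : q.Progress tc ts F R 0 0 mem :=
  ⟨fun _ _ _ _ _ _ h => absurd h (Nat.not_lt_zero _), fun _ _ _ _ h => absurd h (Nat.not_lt_zero _),
    fun _ _ _ _ _ h => absurd h (Nat.not_lt_zero _)⟩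

/-- Results that are complete for `φ` are the partial sums awaited by `φ + 1`; the transform cells
are given up. -/
theorem Progress.next {R φ : ℕ} {mem : ℕ → ℕ} (h : q.Progress tc ts F R φ q.len mem) :
    q.Progress tc ts F R (φ + 1) 0 mem := by
  refine ⟨fun _ _ _ _ _ _ h => absurd h (Nat.not_lt_zero _),
    fun _ _ _ _ h => absurd h (Nat.not_lt_zero _), fun ix k hix hk _ _ => h.done ix k hix hk ?_⟩
  have : q.len = 4 * q.N * (3 * (q.K + 1)) + 4 * q.N := by unfold len; ring
  omega

theorem Progress.congr {R φ c : ℕ} {mem mem' : ℕ → ℕ} (h : q.Progress tc ts F R φ c mem)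
    (h1 : ∀ l, 20 * q.N ≤ l → mem' l = mem l) (h2 : ∀ l < 4 * q.N, mem' (R + l) = mem (R + l)) :
    q.Progress tc ts F R φ c mem' :=
  ⟨fun sec ix k a b c d => by rw [h1 _ (by omega)]; exact h.cells sec ix k a b c d,
    fun ix k a b c => by rw [h2 _ (by omega)]; exact h.done ix k a b c,
    fun ix k a b c d => by rw [h2 _ (by omega)]; exact h.todo ix k a b c d⟩

/-- The expansion of a step number into section, index and component is unique, so any other step
before the successor is strictly earlier. -/
theorem index_lt {s i k s' i' k' N : ℕ} (hi : i < N) (hi' : i' < N) (hk : k < 4) (hk' : k' < 4)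
    (h : 4 * N * s + 4 * i + k < 4 * N * s' + 4 * i' + k' + 1)
    (hne : ¬ (s = s' ∧ i = i' ∧ k = k')) : 4 * N * s + 4 * i + k < 4 * N * s' + 4 * i' + k' := by
  by_contra h'
  have heq : 4 * N * s + 4 * i + k = 4 * N * s' + 4 * i' + k' := by omega
  have hs : s = s' := by
    rcases lt_trichotomy s s' with hlt | rfl | hlt
    · have := Nat.mul_le_mul_left (4 * N) (show s + 1 ≤ s' from hlt)
      rw [mul_add] at this; omega
    · rfl
    · have := Nat.mul_le_mul_left (4 * N) (show s' + 1 ≤ s from hlt)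
      rw [mul_add] at this; omega
  subst hs
  exact hne ⟨rfl, by omega, by omega⟩

/-- Step number `c` writes transform cell number `c`, and these cells lie above the array of
results. -/
theorem Progress.step_cell {R φ sec ix k : ℕ} {mem : ℕ → ℕ} (hR : R + 4 * q.N ≤ 20 * q.N)
    (hsec : sec < 3 * (q.K + 1)) (hix : ix < q.N) (hk : k < 4)
    (h : q.Progress tc ts F R φ (4 * q.N * sec + 4 * ix + k) mem) :
    q.Progress tc ts F R φ (4 * q.N * sec + 4 * ix + k + 1)
      (Function.update mem (20 * q.N + (4 * q.N * sec + 4 * ix + k)) (q.cell tc ts F φ sec ix k)) := by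
  have hlt := Nat.mul_le_mul_left (4 * q.N) (show sec + 1 ≤ 3 * (q.K + 1) from hsec)
  rw [mul_add (4 * q.N)] at hlt
  refine ⟨fun s' i' k' hs' hi' hk' hlt' => ?_, fun i' k' hi' hk' hlt' => ?_,
    fun i' k' hi' hk' hle hφ => ?_⟩
  · by_cases heq : s' = sec ∧ i' = ix ∧ k' = k
    · obtain ⟨rfl, rfl, rfl⟩ := heq
      rw [Function.update_self]
    · have h2 := index_lt hi' hix hk' hk hlt' heq
      rw [Function.update_of_ne (by omega)]
      exact h.cells s' i' k' hs' hi' hk' h2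
  · exfalso; omega
  · rw [Function.update_of_ne (by omega)]
    exact h.todo i' k' hi' hk' (by omega) hφ

/-- The last section owns no transform cells; each of its steps moves one entry of the results from
`todo` to `done`. -/
theorem Progress.step_result {R φ ix k : ℕ} {mem : ℕ → ℕ} (hR : R + 4 * q.N ≤ 20 * q.N)
    (hix : ix < q.N) (hk : k < 4)
    (h : q.Progress tc ts F R φ (4 * q.N * (3 * (q.K + 1)) + 4 * ix + k) mem) :
    q.Progress tc ts F R φ (4 * q.N * (3 * (q.K + 1)) + 4 * ix + k + 1)
      (Function.update mem (R + (4 * ix + k)) (∑ ψ ∈ Finset.range (φ + 1), q.corrCount F ψ ix)) := by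
  refine ⟨fun s' i' k' hs' hi' hk' hlt' => ?_, fun i' k' hi' hk' hlt' => ?_,
    fun i' k' hi' hk' hle hφ => ?_⟩
  · have := Nat.mul_le_mul_left (4 * q.N) (show s' + 1 ≤ 3 * (q.K + 1) from hs')
    rw [mul_add (4 * q.N)] at this
    rw [Function.update_of_ne (by omega)]
    exact h.cells s' i' k' hs' hi' hk' (by omega)
  · by_cases heq : i' = ix ∧ k' = k
    · obtain ⟨rfl, rfl⟩ := heq
      rw [Function.update_self]
    · rw [Function.update_of_ne (by omega)]
      exact h.done i' k' hi' hk' (by omega)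
  · rw [Function.update_of_ne (by omega)]
    exact h.todo i' k' hi' hk' (by omega) hφ

theorem patInd_le (φ j : ℕ) : q.patInd F φ j ≤ 1 := by unfold patInd; split_ifs <;> simp

theorem textInd_le (φ j : ℕ) : q.textInd F φ j ≤ 1 := by unfold textInd; split_ifs <;> simp

theorem corrCount_le (φ i : ℕ) : q.corrCount F φ i ≤ q.N := by
  have : ∀ j ∈ Finset.range q.N, q.patInd F φ j * q.textInd F φ ((i + j) % q.N) ≤ 1 :=
    fun j _ => Nat.mul_le_mul (patInd_le φ j) (textInd_le φ _)
  simpa [corrCount] using Finset.sum_le_card_nsmul _ _ _ this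

theorem sum_corrCount_le (φ i : ℕ) : ∑ ψ ∈ Finset.range φ, q.corrCount F ψ i ≤ φ * q.N := by
  have : ∀ ψ ∈ Finset.range φ, q.corrCount F ψ i ≤ q.N := fun ψ _ => corrCount_le ψ i
  simpa using Finset.sum_le_card_nsmul _ _ _ this

/-- The largest values occur in the final transform and are at most `N ^ 9 * Z = N ^ 40`. -/
theorem cell_le (hq : q.Good) (htw : GoodTwiddles q.N q.Z tc ts ((1 / q.N : ℝ) ^ 12)) (φ : ℕ)
    {sec ix k : ℕ} (hix : ix < q.N) (hk : k < 4) : q.cell tc ts F φ sec ix k ≤ q.N ^ 40 := by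
  have hl : sec % (q.K + 1) ≤ q.K := Nat.lt_succ_iff.mp (Nat.mod_lt _ (by omega))
  have h1 := hq.eight_le
  have e1 : q.N ^ 3 * q.Z ≤ q.N ^ 40 := by
    rw [hq.Z_eq, ← pow_add]; exact Nat.pow_le_pow_right (by omega) (by omega)
  have e2 : q.N ^ 9 * q.Z ≤ q.N ^ 40 := by rw [hq.Z_eq, ← pow_add]
  unfold cell
  split_ifs
  · exact (le_of_sum_range_four hk
      (fft_indicator_approx hq.N_pow h1 hq.Z_eq htw (patInd_le φ) _ hl ix hix).1).trans e1
  · exact (le_of_sum_range_four hk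
      (fft_indicator_approx hq.N_pow h1 hq.Z_eq htw (textInd_le φ) _ hl ix hix).1).trans e1
  · exact (le_of_sum_range_four hk
      (corrLevel_approx hq.N_pow h1 hq.Z_eq htw (patInd_le φ) (textInd_le φ) _ hl ix hix).1).trans e2

/-- A group of `K + 1` sections holds the levels of one transform, so inside a group the preceding
section is the preceding level. -/
theorem cell_succ {φ sec l : ℕ} (h : sec % (q.K + 1) = l + 1) :
    q.cell tc ts F φ sec = fftStep q.N q.Z tc ts l (q.cell tc ts F φ (sec - 1)) := by
  have h0 := Nat.div_add_mod sec (q.K + 1)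
  have hlt : sec % (q.K + 1) < q.K + 1 := Nat.mod_lt _ (by omega)
  have e : sec - 1 = (q.K + 1) * (sec / (q.K + 1)) + l := by omega
  have h1 : (sec - 1) / (q.K + 1) = sec / (q.K + 1) := by
    rw [e, Nat.mul_add_div (by omega), Nat.div_eq_of_lt (a := l) (by omega), add_zero]
  have h2 : (sec - 1) % (q.K + 1) = l := by
    rw [e, Nat.mul_add_mod, Nat.mod_eq_of_lt (by omega)]
  unfold cell
  rw [h1, h2, h]
  split_ifs <;> rfl

/-- Sections `K` and `2 * K + 1` are the finished transforms of pattern and text; the third group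
starts with their product. -/
theorem cell_product (φ : ℕ) : q.cell tc ts F φ (2 * (q.K + 1)) =
    corrProd q.N q.Z (q.cell tc ts F φ q.K) (q.cell tc ts F φ (2 * q.K + 1)) := by
  have a1 : 2 * (q.K + 1) / (q.K + 1) = 2 := Nat.mul_div_cancel _ (by omega)
  have a2 : 2 * (q.K + 1) % (q.K + 1) = 0 := Nat.mul_mod_left _ _
  have b1 : q.K / (q.K + 1) = 0 := Nat.div_eq_of_lt (by omega)
  have b2 : q.K % (q.K + 1) = q.K := Nat.mod_eq_of_lt (by omega)
  have e : 2 * q.K + 1 = (q.K + 1) * 1 + q.K := by ring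
  have c1 : (2 * q.K + 1) / (q.K + 1) = 1 := by
    rw [e, Nat.mul_add_div (by omega), b1]
  have c2 : (2 * q.K + 1) % (q.K + 1) = q.K := by rw [e, Nat.mul_add_mod, b2]
  simp only [cell, a1, a2, b1, b2, c1, c2]
  rfl

theorem cell_result (φ : ℕ) : q.cell tc ts F φ (3 * q.K + 2) =
    corrLevel q.N q.K q.Z tc ts (q.patInd F φ) (q.textInd F φ) q.K := by
  have b1 : q.K / (q.K + 1) = 0 := Nat.div_eq_of_lt (by omega)
  have b2 : q.K % (q.K + 1) = q.K := Nat.mod_eq_of_lt (by omega)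
  have e : 3 * q.K + 2 = (q.K + 1) * 2 + q.K := by ring
  have c1 : (3 * q.K + 2) / (q.K + 1) = 2 := by rw [e, Nat.mul_add_div (by omega), b1]
  have c2 : (3 * q.K + 2) % (q.K + 1) = q.K := by rw [e, Nat.mul_add_mod, b2]
  simp [cell, c1, c2]

end Cfg

/-! ### The four kinds of background steps -/

namespace Cfg
variable {q : Cfg} {tc ts : ℕ → ℕ} {F : ℕ → ℕ} {s : St}

/-- Horner's rule from the leading digit on: after `k` rounds `pw` is `2 ^ (d - k)` and `r` is the
hash of the `k` leading digits, which form `z / pw`. -/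
theorem hash_spec {V S : ℕ} {z r : Vr} (hD : s.var .D = 2 ^ q.d) (hp0 : 0 < s.var .p)
    (hDV : s.var .D ≤ V) (hpV : s.var .p ≤ V) (hz : z ≠ .pw) (hzr : z ≠ r) (hr : r ≠ .pw)
    (hrD : r ≠ .D) (hrt : r ≠ .t) (hrp : r ≠ .p) :
    WP V S (hashProg z r) s (3 * q.d + 3)
      fun s' => s'.var r = hashVal (s.var .p) (s.var .t) q.d (s.var z) ∧
        (∀ y, y ≠ r → y ≠ .pw → s'.var y = s.var y) ∧ s'.mem = s.mem := by
  have h1 : 1 ≤ V := by omega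
  refine (WP.seq (T := 1) (T' := 1 + (q.d * (2 + 1) + 1)) ?_).mono (by omega) fun _ h => h
  refine WP.assign (by simp) (by simp) ?_
  refine WP.seq (WP.assign (by simp) (by simpa [hrD.symm] using hDV) ?_)
  have hwhile := WP.while_count (V := V) (S := S) (e := Expr.lt 1 (Vr.pw : Expr))
    (p := .seq (.assign .pw (Vr.pw / 2)) (.assign r ((r * Vr.t + z / Vr.pw % 2) % Vr.p)))
    (T := 2) (s := (s.set r 0).set .pw (2 ^ q.d))
    (I := fun k s' => s'.var .pw = 2 ^ (q.d - k) ∧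
      s'.var r = hashVal (s.var .p) (s.var .t) k (s.var z / 2 ^ (q.d - k)) ∧
      (∀ y, y ≠ r → y ≠ .pw → s'.var y = s.var y) ∧ s'.mem = s.mem) q.d
    ?_ ?_ ?_
  · have e : (Expr.var Vr.D).eval (s.set r ((0 : Expr).eval s)) = 2 ^ q.d := by simp [hrD.symm, hD]
    rw [e]
    refine hwhile.mono le_rfl fun s' h => ?_
    obtain ⟨-, h2, h3, h4⟩ := h
    simp only [Nat.sub_self, pow_zero, Nat.div_one] at h2
    exact ⟨h2, h3, h4⟩
  · refine ⟨by simp, by simp [hr, hashVal], fun y h1 h2 => by simp [h1, h2], rfl⟩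
  · intro k s' hk ⟨a1, a2, a3, a4⟩
    have hpow : 2 ^ (q.d - k) = 2 * 2 ^ (q.d - (k + 1)) := by
      rw [← pow_succ']; congr 1; omega
    have hpos : 0 < 2 ^ (q.d - (k + 1)) := by positivity
    have hle : 2 ^ (q.d - k) ≤ 2 ^ q.d := Nat.pow_le_pow_right (by norm_num) (by omega)
    have ht := a3 .t hrt.symm (by simp)
    have hp := a3 .p hrp.symm (by simp)
    have hzz := a3 z hzr hz
    refine ⟨by simp, by simp [a1]; omega, ?_⟩
    refine WP.seq (T := 1) (T' := 1) (WP.assign (by simp) (by simp [a1]; omega) ?_)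
    refine WP.assign (by simp) ?_ ?_
    · simp only [Expr.eval_mod, Expr.eval_var, St.set_var, reduceCtorEq, if_false, hp]
      exact (Nat.mod_lt _ hp0).le.trans hpV
    · refine ⟨?_, ?_, fun y h1 h2 => ?_, ?_⟩
      · simp [hr.symm, a1, hpow]
      · simp only [Expr.eval_mod, Expr.eval_var, Expr.eval_add, Expr.eval_mul, Expr.eval_div,
          Expr.eval_ofNat, St.set_var, if_true, reduceCtorEq, if_false, if_neg hr, if_neg hz,
          ht, hp, hzz, a1, a2]
        have e1 : 2 ^ (q.d - k) / 2 = 2 ^ (q.d - (k + 1)) := by omega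
        rw [e1, hashVal, Nat.div_div_eq_div_mul, ← pow_succ,
          show q.d - (k + 1) + 1 = q.d - k by omega]
      · simp [h1, h2, a3 y h1 h2]
      · simp [a4]
  · rintro s' ⟨a1, -⟩
    simp [a1]

/-- The table of twiddle factors is in memory. -/
def HasTwiddles (q : Cfg) (tc ts : ℕ → ℕ) (mem : ℕ → ℕ) : Prop :=
  ∀ j < q.N / 4, mem (18 * q.N + 2 * j) = tc j ∧ mem (18 * q.N + 2 * j + 1) = ts j

theorem cell_addr {sec ix k : ℕ} (hsec : sec < 3 * (q.K + 1) + 1) (hix : ix < q.N) (hk : k < 4) :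
    4 * q.N * sec + 4 * ix + k < q.len := by
  have := Nat.mul_le_mul_left (4 * q.N) (show sec + 1 ≤ 3 * (q.K + 1) + 1 from hsec)
  rw [mul_add (4 * q.N)] at this
  unfold len; omega

theorem cell_addr' {sec ix k : ℕ} (hsec : sec < 3 * (q.K + 1) + 1) (hix : ix < q.N) (hk : k < 4) :
    20 * q.N + (4 * q.N * sec + 4 * ix + k) < q.space := by
  have := cell_addr hsec hix hk
  unfold space; omega

/-- A butterfly reads only cells of section `sec - 1`, and that whole section precedes the current
step, so `Progress.cells` applies. -/
theorem step_butterfly_spec (hq : q.Good) (htw : GoodTwiddles q.N q.Z tc ts ((1 / q.N : ℝ) ^ 12))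
    (hs : q.Holds s) (hT : q.HasTwiddles tc ts s.mem) {R φ sec ix k : ℕ} (hsec : sec < 3 * (q.K + 1))
    (hix : ix < q.N) (hk : k < 4) (hP : q.Progress tc ts F R φ (4 * q.N * sec + 4 * ix + k) s.mem)
    (v1 : s.var .c = 4 * q.N * sec + 4 * ix + k) (v2 : s.var .sec = sec) (v3 : s.var .ix = ix)
    (v4 : s.var .kk = k) (v5 : s.var .lv = sec % (q.K + 1)) (hlv : 0 < sec % (q.K + 1)) :
    WP q.bound q.space stepButterfly s 1 fun s' =>
      s' = s.put (20 * q.N + (4 * q.N * sec + 4 * ix + k)) (q.cell tc ts F φ sec ix k) := by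
  obtain ⟨l, hl⟩ : ∃ l, sec % (q.K + 1) = l + 1 := ⟨sec % (q.K + 1) - 1, by omega⟩
  have hlK : l < q.K := by have := Nat.mod_lt sec (show 0 < q.K + 1 by omega); omega
  have hsec0 : 1 ≤ sec := by
    rcases Nat.eq_zero_or_pos sec with rfl | h
    · simp at hlv
    · exact h
  have hidx := fft_index hlK (by rw [← hq.N_pow]; exact hix)
  rw [← hq.N_pow] at hidx
  obtain ⟨hsrc, htwi⟩ := hidx
  have h8 := hq.eight_le
  have h4 : 4 ∣ q.N := by rw [hq.N_pow]; exact pow_dvd_pow 2 (show 2 ≤ q.K by have := hq.three_le_K; omega)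
  have hN4 : 0 < q.N / 4 := by omega
  have hj : ix % (2 * 2 ^ l) * (q.N / (2 * 2 ^ l)) % (q.N / 4) < q.N / 4 := Nat.mod_lt _ hN4
  have hpow : 2 ^ l ≤ q.bound := by
    refine le_trans ?_ hq.N_lt_bound
    rw [hq.N_pow]; exact Nat.pow_le_pow_right (by norm_num) hlK.le
  have hrow := Nat.mul_le_mul_left (4 * q.N) (show sec - 1 + 1 ≤ sec by omega)
  rw [mul_add (4 * q.N)] at hrow
  have rd : ∀ i' k', i' < q.N → k' < 4 →
      s.mem (20 * q.N + (4 * q.N * (sec - 1) + 4 * i' + k')) = q.cell tc ts F φ (sec - 1) i' k' :=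
    fun i' k' hi' hk' => hP.cells _ _ _ (by omega) hi' hk' (by omega)
  have hval : (cellE (Vr.sec - 1) srcE Vr.kk +
    (cellE (Vr.sec - 1) (srcE + Vr.N / 2) ((Vr.kk + 4 - twE / (Vr.N / 4)) % 4) *
        .load (18 * Vr.N + 2 * (twE % (Vr.N / 4))) +
      cellE (Vr.sec - 1) (srcE + Vr.N / 2) ((Vr.kk + 7 - twE / (Vr.N / 4)) % 4) *
        .load (18 * Vr.N + 2 * (twE % (Vr.N / 4)) + 1)) / Vr.Z).eval s =
      q.cell tc ts F φ sec ix k := by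
    rw [cell_succ hl]
    simp only [cellE, srcE, twE, Expr.eval_add, Expr.eval_mul, Expr.eval_sub, Expr.eval_div,
      Expr.eval_mod, Expr.eval_load, Expr.eval_var, Expr.eval_ofNat, Expr.eval_pow2, hs.N, hs.Z,
      v2, v3, v4, v5, hl, Nat.add_sub_cancel]
    rw [rd _ _ (by omega) hk, rd _ _ hsrc (Nat.mod_lt _ (by norm_num)),
      rd _ _ hsrc (Nat.mod_lt _ (by norm_num)), (hT _ hj).1, (hT _ hj).2]
    rfl
  have hc : (20 * Vr.N + Vr.c : Expr).eval s = 20 * q.N + (4 * q.N * sec + 4 * ix + k) := by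
    simp only [Expr.eval_add, Expr.eval_mul, Expr.eval_var, Expr.eval_ofNat, hs.N, v1]
  refine WP.store (by simp) ?_ ?_ ?_ (by rw [hval, hc])
  · have a1 := cell_addr' (q := q) (sec := sec - 1) (ix := ix / (2 * 2 ^ l) * 2 ^ l + ix % 2 ^ l) (k := k)
      (by omega) (by omega) hk
    have a2 := fun k' => cell_addr' (q := q) (sec := sec - 1)
      (ix := ix / (2 * 2 ^ l) * 2 ^ l + ix % 2 ^ l + q.N / 2) (k := k' % 4) (by omega) hsrc
      (Nat.mod_lt _ (by norm_num))
    have a3 : 18 * q.N + 2 * (ix % (2 * 2 ^ l) * (q.N / (2 * 2 ^ l)) % (q.N / 4)) + 1 < q.space := by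
      unfold space; omega
    simp only [cellE, srcE, twE, Expr.eval_add, Expr.eval_mul, Expr.eval_sub, Expr.eval_div,
      Expr.eval_mod, Expr.eval_var, Expr.eval_ofNat, Expr.eval_pow2, hs.N,
      v2, v3, v4, v5, hl, Nat.add_sub_cancel, Expr.ok_add, Expr.ok_mul, Expr.ok_sub, Expr.ok_div,
      Expr.ok_mod, Expr.ok_load, Expr.ok_var, Expr.ok_ofNat, Expr.ok_pow2, hpow, true_and, and_true,
      a1, a2]
    exact ⟨by omega, a3⟩
  · rw [hc]; exact cell_addr' (by omega) hix hk
  · rw [hval]; exact (cell_le hq htw φ hix hk).trans (hq.N_pow_le (by norm_num))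

/-- The group number selects the pattern (0) or the text (1) through its offset and its length. Past
the end of the string the letter is replaced by zero and the indicator is masked, while the load
stays in range. -/
theorem step_indicator_spec (hq : q.Good) (hs : q.Holds s) (hF : ∀ j < q.m + q.n, s.mem (2 * q.N + j) = F j)
    (hb : s.Bdd q.bound) {φ sec ix k : ℕ} (hsec : sec < 3 * (q.K + 1)) (hφ : φ ≤ q.bound)
    (hix : ix < q.N) (hk : k < 4)
    (v1 : s.var .c = 4 * q.N * sec + 4 * ix + k) (v3 : s.var .ix = ix)
    (v4 : s.var .kk = k) (v6 : s.var .ph = φ) (v7 : s.var .grp = sec / (q.K + 1))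
    (hlv : sec % (q.K + 1) = 0) (hg : sec / (q.K + 1) < 2) :
    WP q.bound q.space stepIndicator s (3 * q.d + 6) fun s' =>
      s'.mem = Function.update s.mem (20 * q.N + (4 * q.N * sec + 4 * ix + k))
        (q.cell tc ts F φ sec ix k) := by
  have h8 := hq.eight_le
  have hmn := hq.m_le_n
  have hnm := hq.n_le
  have hmN := hq.m_le
  have hNB := hq.N_eq
  set γ := sec / (q.K + 1) with hγ
  have hγ1 : γ * q.m ≤ q.m := by nlinarith
  refine (WP.seq (T := 1) (T' := 1 + (3 * q.d + 3 + 1)) ?_).mono (by omega) fun _ h => h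
  refine WP.assign (by simp) (by simp [v6]; exact (Nat.div_le_self _ _).trans hφ) ?_
  have hload : 2 * q.N + γ * q.m + ix < q.space := by unfold space; omega
  refine WP.seq (WP.assign ?_ ?_ ?_)
  · simp [hs.N, hs.m, v3, v7, hload]
  · simp only [Expr.eval_mul, Expr.eval_load, Expr.eval_lt]
    split_ifs
    · rw [mul_one]; exact hb.mem _
    · simp
  set s₂ := (s.set .t ((Vr.ph / Vr.p : Expr).eval s)).set .xv
    ((.load (2 * Vr.N + Vr.grp * Vr.m + Vr.ix) *
      Expr.lt Vr.ix (Vr.grp * Vr.n + (1 - Vr.grp) * Vr.m) : Expr).eval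
        (s.set .t ((Vr.ph / Vr.p : Expr).eval s))) with hs₂
  have hD2 : s₂.var .D = 2 ^ q.d := by simp [hs₂, hs.D, hq.D_eq]
  have hp2 : s₂.var .p = q.p := by simp [hs₂, hs.p]
  have ht2 : s₂.var .t = φ / q.p := by simp [hs₂, hs.p, v6]
  have hx2 : s₂.var .xv = s.mem (2 * q.N + γ * q.m + ix) *
      if ix < γ * q.n + (1 - γ) * q.m then 1 else 0 := by
    simp [hs₂, hs.N, hs.m, hs.n, v3, v7]
  refine WP.seq ((hash_spec (q := q) (z := .xv) (r := .h) hD2 (by rw [hp2]; exact hq.p_pos)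
    (by rw [hD2, ← hq.D_eq]; exact hq.D_le)
    (by rw [hp2]; exact hq.p_le) (by simp) (by simp) (by simp) (by simp) (by simp)
    (by simp)).mono le_rfl fun s₃ h3 => ?_)
  obtain ⟨b1, b2, b3⟩ := h3
  have w : ∀ y : Vr, y ≠ .h → y ≠ .pw → y ≠ .xv → y ≠ .t → s₃.var y = s.var y := by
    intro y y1 y2 y3 y4
    rw [b2 y y1 y2, hs₂]; simp [y3, y4]
  have hN := w .N (by simp) (by simp) (by simp) (by simp)
  have hm := w .m (by simp) (by simp) (by simp) (by simp)
  have hn := w .n (by simp) (by simp) (by simp) (by simp)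
  have hp := w .p (by simp) (by simp) (by simp) (by simp)
  have hZ := w .Z (by simp) (by simp) (by simp) (by simp)
  have hc := w .c (by simp) (by simp) (by simp) (by simp)
  have hi := w .ix (by simp) (by simp) (by simp) (by simp)
  have hkk := w .kk (by simp) (by simp) (by simp) (by simp)
  have hph := w .ph (by simp) (by simp) (by simp) (by simp)
  have hgr := w .grp (by simp) (by simp) (by simp) (by simp)
  rw [hx2, ht2, hp2] at b1
  have hmem : s₃.mem = s.mem := by rw [b3]; rfl
  have haddr : (20 * Vr.N + Vr.c : Expr).eval s₃ = 20 * q.N + (4 * q.N * sec + 4 * ix + k) := by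
    simp only [Expr.eval_add, Expr.eval_mul, Expr.eval_var, Expr.eval_ofNat, hN, hs.N, hc, v1]
  have hval : (Expr.eq Vr.kk 0 * (Vr.Z * (Expr.lt Vr.ix (Vr.grp * Vr.n + (1 - Vr.grp) * Vr.m) *
      Expr.eq Vr.h (Vr.ph % Vr.p))) : Expr).eval s₃ = q.cell tc ts F φ sec ix k := by
    simp only [Expr.eval_mul, Expr.eval_eq, Expr.eval_lt, Expr.eval_var, Expr.eval_ofNat,
      Expr.eval_add, Expr.eval_sub, Expr.eval_mod, hm, hn, hp, hZ, hi, hkk, hph, hgr, hs.m, hs.n,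
      hs.p, hs.Z, v3, v4, v6, v7, b1]
    rw [cell, hlv]
    rcases (show γ = 0 ∨ γ = 1 by omega) with h0 | h0
    · rw [← hγ, h0]
      simp only [if_true, fftLevel, embedNat, patInd, Nat.zero_mul, Nat.sub_zero, one_mul, zero_add,
        add_zero]
      by_cases hk0 : k = 0
      · by_cases hlt : ix < q.m
        · simp [hk0, hlt, hF ix (by omega)]
        · simp [hlt]
      · simp [hk0]
    · rw [← hγ, h0]
      simp only [one_ne_zero, if_false, if_true, fftLevel, embedNat, textInd, one_mul, Nat.sub_self,
        zero_mul, add_zero]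
      by_cases hk0 : k = 0
      · by_cases hlt : ix < q.n
        · simp [hk0, hlt, add_assoc, hF (q.m + ix) (by omega)]
        · simp [hlt]
      · simp [hk0]
  refine WP.store (by simp) (by simp) ?_ ?_ ?_
  · rw [haddr]; exact cell_addr' (by omega) hix hk
  · have hZb : q.Z ≤ q.bound := by rw [hq.Z_eq]; exact hq.N_pow_le (by norm_num)
    simp only [Expr.eval_mul, Expr.eval_eq, Expr.eval_lt, Expr.eval_var, hZ, hs.Z]
    have hite : ∀ (P : Prop) [Decidable P], (if P then 1 else 0) ≤ 1 := fun P _ => by split_ifs <;> simp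
    refine (Nat.mul_le_mul (hite _) (Nat.mul_le_mul le_rfl (Nat.mul_le_mul (hite _) (hite _)))).trans ?_
    simpa using hZb
  · rw [haddr, hval, St.put_mem, hmem]

theorem step_product_spec (hq : q.Good) (htw : GoodTwiddles q.N q.Z tc ts ((1 / q.N : ℝ) ^ 12))
    (hs : q.Holds s) {R φ ix k : ℕ}
    (hix : ix < q.N) (hk : k < 4)
    (hP : q.Progress tc ts F R φ (4 * q.N * (2 * (q.K + 1)) + 4 * ix + k) s.mem)
    (v1 : s.var .c = 4 * q.N * (2 * (q.K + 1)) + 4 * ix + k) (v3 : s.var .ix = ix)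
    (v4 : s.var .kk = k) :
    WP q.bound q.space stepProduct s 1 fun s' =>
      s' = s.put (20 * q.N + (4 * q.N * (2 * (q.K + 1)) + 4 * ix + k))
        (q.cell tc ts F φ (2 * (q.K + 1)) ix k) := by
  have h8 := hq.eight_le
  have hi' : (q.N - ix) % q.N < q.N := Nat.mod_lt _ (by omega)
  have rd : ∀ s' i' k', s' < 2 * (q.K + 1) → i' < q.N → k' < 4 →
      s.mem (20 * q.N + (4 * q.N * s' + 4 * i' + k')) = q.cell tc ts F φ s' i' k' := by
    intro s' i' k' hs' hi' hk'
    have hrow := Nat.mul_le_mul_left (4 * q.N) (show s' + 1 ≤ 2 * (q.K + 1) by omega)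
    rw [mul_add (4 * q.N)] at hrow
    exact hP.cells _ _ _ (by omega) hi' hk' (by omega)
  have m4 : ∀ x, x % 4 < 4 := fun x => Nat.mod_lt _ (by norm_num)
  have haddr : (20 * Vr.N + Vr.c : Expr).eval s =
      20 * q.N + (4 * q.N * (2 * (q.K + 1)) + 4 * ix + k) := by
    simp only [Expr.eval_add, Expr.eval_mul, Expr.eval_var, Expr.eval_ofNat, hs.N, v1]
  have hval : ((cellE Vr.K ((Vr.N - Vr.ix) % Vr.N) 0 * cellE (2 * Vr.K + 1) Vr.ix ((Vr.kk + 4 - 0) % 4) +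
    cellE Vr.K ((Vr.N - Vr.ix) % Vr.N) 1 * cellE (2 * Vr.K + 1) Vr.ix ((Vr.kk + 4 - 1) % 4) +
    cellE Vr.K ((Vr.N - Vr.ix) % Vr.N) 2 * cellE (2 * Vr.K + 1) Vr.ix ((Vr.kk + 4 - 2) % 4) +
    cellE Vr.K ((Vr.N - Vr.ix) % Vr.N) 3 * cellE (2 * Vr.K + 1) Vr.ix ((Vr.kk + 4 - 3) % 4)) /
      Vr.Z : Expr).eval s = q.cell tc ts F φ (2 * (q.K + 1)) ix k := by
    rw [cell_product]
    simp only [cellE, Expr.eval_add, Expr.eval_mul, Expr.eval_sub, Expr.eval_div,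
      Expr.eval_mod, Expr.eval_load, Expr.eval_var, Expr.eval_ofNat, hs.N, hs.Z, hs.K, v3, v4]
    rw [rd _ _ 0 (by omega) hi' (by omega), rd _ _ 1 (by omega) hi' (by omega),
      rd _ _ 2 (by omega) hi' (by omega), rd _ _ 3 (by omega) hi' (by omega),
      rd _ _ _ (by omega) hix (m4 _), rd _ _ _ (by omega) hix (m4 _),
      rd _ _ _ (by omega) hix (m4 _), rd _ _ _ (by omega) hix (m4 _)]
    simp [corrProd, Finset.sum_range_succ]
  refine WP.store (by simp) ?_ ?_ ?_ (by rw [hval, haddr])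
  · have a1 := fun k' (hk' : k' < 4) => cell_addr' (q := q) (sec := q.K) (by omega) hi' hk'
    have a2 := fun k' => cell_addr' (q := q) (sec := 2 * q.K + 1) (k := k' % 4) (by omega) hix (m4 _)
    simp only [cellE, Expr.eval_add, Expr.eval_mul, Expr.eval_sub,
      Expr.eval_mod, Expr.eval_var, Expr.eval_ofNat, hs.N, hs.K, v3, v4,
      Expr.ok_add, Expr.ok_mul, Expr.ok_sub, Expr.ok_div,
      Expr.ok_mod, Expr.ok_load, Expr.ok_var, Expr.ok_ofNat, true_and, and_true, a2]
    exact ⟨⟨⟨a1 0 (by omega), a1 1 (by omega)⟩, a1 2 (by omega)⟩, a1 3 (by omega)⟩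
  · rw [haddr]; exact cell_addr' (by omega) hix hk
  · rw [hval]; exact (cell_le hq htw φ hix hk).trans (hq.N_pow_le (by norm_num))

/-- For the first hash pair the factor `Expr.lt 0 ph` discards the results of an earlier run, which
is why `Progress.todo` assumes `0 < φ`. Each count is kept in four equal cells, one for each
component step; a query reads the first. -/
theorem step_result_spec (hq : q.Good) (htw : GoodTwiddles q.N q.Z tc ts ((1 / q.N : ℝ) ^ 12))
    (hs : q.Holds s) {R φ ix k : ℕ}
    (hix : ix < q.N) (hk : k < 4) (hφ : φ < q.p * q.p)
    (hP : q.Progress tc ts F R φ (4 * q.N * (3 * (q.K + 1)) + 4 * ix + k) s.mem)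
    (v3 : s.var .ix = ix) (v4 : s.var .kk = k) (v6 : s.var .ph = φ)
    (hR : 10 * q.N + 4 * q.N * (1 - s.var .yb) = R) :
    WP q.bound q.space stepResult s 1 fun s' =>
      s' = s.put (R + (4 * ix + k)) (∑ ψ ∈ Finset.range (φ + 1), q.corrCount F ψ ix) := by
  have h8 := hq.eight_le
  have hi' : (q.N - ix) % q.N < q.N := Nat.mod_lt _ (by omega)
  have hR' : R ≤ 14 * q.N := by
    rw [← hR]; have : 1 - s.var .yb ≤ 1 := Nat.sub_le _ _
    nlinarith
  have rd : ∀ s' i' k', s' < 3 * (q.K + 1) → i' < q.N → k' < 4 →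
      s.mem (20 * q.N + (4 * q.N * s' + 4 * i' + k')) = q.cell tc ts F φ s' i' k' := by
    intro s' i' k' hs' hi' hk'
    have hrow := Nat.mul_le_mul_left (4 * q.N) (show s' + 1 ≤ 3 * (q.K + 1) by omega)
    rw [mul_add (4 * q.N)] at hrow
    exact hP.cells _ _ _ (by omega) hi' hk' (by omega)
  have haddr : (10 * Vr.N + 4 * Vr.N * (1 - Vr.yb) + (4 * Vr.ix + Vr.kk) : Expr).eval s =
      R + (4 * ix + k) := by
    simp only [Expr.eval_add, Expr.eval_sub, Expr.eval_mul, Expr.eval_var, Expr.eval_ofNat, hs.N, v3, v4, hR]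
  have hval : (.load (10 * Vr.N + 4 * Vr.N * (1 - Vr.yb) + (4 * Vr.ix + Vr.kk)) * Expr.lt 0 Vr.ph +
      (cellE (3 * Vr.K + 2) ((Vr.N - Vr.ix) % Vr.N) 0 + Vr.Z * Vr.N / 2 -
        cellE (3 * Vr.K + 2) ((Vr.N - Vr.ix) % Vr.N) 2) / (Vr.Z * Vr.N) : Expr).eval s =
      ∑ ψ ∈ Finset.range (φ + 1), q.corrCount F ψ ix := by
    rw [Expr.eval_add, Expr.eval_mul, Expr.eval_load, haddr]
    simp only [cellE, Expr.eval_add, Expr.eval_mul, Expr.eval_sub, Expr.eval_div, Expr.eval_lt,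
      Expr.eval_mod, Expr.eval_load, Expr.eval_var, Expr.eval_ofNat, hs.N, hs.Z, hs.K, v3, v6]
    rw [rd _ _ 0 (by omega) hi' (by omega), rd _ _ 2 (by omega) hi' (by omega), cell_result,
      corrLevel_round hq.N_pow h8 hq.Z_eq htw (patInd_le φ) (textInd_le φ) hix,
      Finset.sum_range_succ]
    congr 1
    split_ifs with h0
    · rw [mul_one]; exact hP.todo ix k hix hk le_rfl h0
    · obtain rfl : φ = 0 := by omega
      simp
  have hspace : R + (4 * ix + k) < q.space := by unfold space; omega
  refine WP.store (by simp) ?_ ?_ ?_ (by rw [hval, haddr])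
  · have a1 := fun k' (hk' : k' < 4) => cell_addr' (q := q) (sec := 3 * q.K + 2) (by omega) hi' hk'
    rw [Expr.ok_add, Expr.ok_mul, Expr.ok_load, haddr]
    simp only [cellE, Expr.eval_add, Expr.eval_mul, Expr.eval_sub,
      Expr.eval_mod, Expr.eval_var, Expr.eval_ofNat, hs.N, hs.K, v3,
      Expr.ok_add, Expr.ok_mul, Expr.ok_sub, Expr.ok_div, Expr.ok_lt,
      Expr.ok_mod, Expr.ok_load, Expr.ok_var, Expr.ok_ofNat, true_and, and_true]
    exact ⟨hspace, a1 0 (by omega), a1 2 (by omega)⟩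
  · rw [haddr]; exact hspace
  · rw [hval]
    refine (sum_corrCount_le _ _).trans ((Nat.mul_le_mul_right _ hφ).trans ?_)
    have := hq.le_bound (i := 1) (j := 2) (k := 0) (by norm_num) (by norm_num) (by norm_num)
    refine le_trans (le_of_eq ?_) this
    ring

end Cfg

/-! ### A full step of the background computation -/

namespace Cfg
variable {q : Cfg} {tc ts : ℕ → ℕ} {F : ℕ → ℕ} {s : St}

/-- The address of the results of the background computation. -/
def resultAddr (q : Cfg) (y : ℕ) : ℕ := 10 * q.N + 4 * q.N * (1 - y)

/-- The parts of a state that the background computation depends on. -/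
structure Background (q : Cfg) (tc ts F : ℕ → ℕ) (s : St) : Prop where
  holds : q.Holds s
  twiddles : q.HasTwiddles tc ts s.mem
  frozen : ∀ j < q.m + q.n, s.mem (2 * q.N + j) = F j
  progress : q.Progress tc ts F (q.resultAddr (s.var .yb)) (s.var .g / q.len) (s.var .g % q.len) s.mem
  bdd : s.Bdd q.bound

theorem Good.len_pos (hq : q.Good) : 0 < q.len := by
  have := hq.eight_le
  unfold len; positivity

theorem Good.total_le (hq : q.Good) : q.p * q.p * q.len ≤ q.bound := by
  have h8 := hq.eight_le
  have h1 := hq.le_bound (i := 4) (j := 2) (k := 0) (by norm_num) (by norm_num) (by norm_num)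
  refine le_trans ?_ h1
  calc q.p * q.p * q.len ≤ q.p * q.p * (2 * q.N ^ 3) := Nat.mul_le_mul_left _ hq.len_le
    _ ≤ q.p * q.p * (q.N * q.N ^ 3) := by gcongr; omega
    _ = _ := by ring

theorem resultAddr_le (q : Cfg) (y : ℕ) : 10 * q.N ≤ q.resultAddr y ∧ q.resultAddr y ≤ 14 * q.N := by
  unfold resultAddr
  have : 1 - y ≤ 1 := Nat.sub_le _ _
  constructor
  · omega
  · nlinarith

theorem stepHead_spec (hs : q.Holds s) (hg : s.var .g ≤ q.bound) :
    WP q.bound q.space stepHead s 7 fun s' => s'.mem = s.mem ∧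
      s'.var .ph = s.var .g / q.len ∧ s'.var .c = s.var .g % q.len ∧
      s'.var .sec = s.var .g % q.len / (4 * q.N) ∧ s'.var .ix = s.var .g % q.len % (4 * q.N) / 4 ∧
      s'.var .kk = s.var .g % q.len % 4 ∧ s'.var .grp = s.var .g % q.len / (4 * q.N) / (q.K + 1) ∧
      s'.var .lv = s.var .g % q.len / (4 * q.N) % (q.K + 1) := by
  have hlen : ∀ s' : St, s'.var .N = q.N → s'.var .K = q.K → phaseLen.eval s' = q.len := by
    intro s' h1 h2
    simp [phaseLen, h1, h2, len]
  have hok : ∀ s' : St, phaseLen.ok q.bound q.space s' := by intro s'; simp [phaseLen]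
  have hgm : s.var .g % q.len ≤ q.bound := (Nat.mod_le _ _).trans hg
  have hm4 : s.var .g % q.len / (4 * q.N) ≤ q.bound := (Nat.div_le_self _ _).trans hgm
  refine (WP.seq (T := 1) (T' := 1 + (1 + (1 + (1 + (1 + 1))))) ?_).mono (by omega) fun _ h => h
  refine WP.assign (by simp [hok]) (by simpa using (Nat.div_le_self _ _).trans hg) ?_
  refine WP.seq (WP.assign (by simp [hok]) (by simpa using (Nat.mod_le _ _).trans hg) ?_)
  have e1 := hlen (s.set .ph ((Vr.g / phaseLen : Expr).eval s)) (by simp [hs.N]) (by simp [hs.K])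
  have e0 := hlen s hs.N hs.K
  simp only [Expr.eval_div, Expr.eval_mod, e0, Expr.eval_var, St.set_var, reduceCtorEq, if_false] at e1 ⊢
  simp only [e1]
  refine WP.seq (WP.assign (by simp) (by simpa [hs.N] using hm4) ?_)
  refine WP.seq (WP.assign (by simp) ?_ ?_)
  · simp [hs.N]; exact (Nat.div_le_self _ _).trans ((Nat.mod_le _ _).trans hgm)
  refine WP.seq (WP.assign (by simp) ?_ ?_)
  · simp; exact (Nat.mod_le _ _).trans hgm
  refine WP.seq (WP.assign (by simp) ?_ ?_)
  · simp [hs.N, hs.K]; exact (Nat.div_le_self _ _).trans hm4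
  refine WP.assign (by simp) ?_ ?_
  · simp [hs.N, hs.K]; exact (Nat.mod_le _ _).trans hm4
  simp [hs.N, hs.K]

/-- A positive level is a butterfly. On level zero the group decides: 0 and 1 are indicator
sequences, 2 is the pointwise product, and 3 consists of the single section that adds to the
results. -/
theorem step_body_spec (hq : q.Good) (htw : GoodTwiddles q.N q.Z tc ts ((1 / q.N : ℝ) ^ 12))
    (hs : q.Holds s) (hT : q.HasTwiddles tc ts s.mem)
    (hF : ∀ j < q.m + q.n, s.mem (2 * q.N + j) = F j) (hb : s.Bdd q.bound) {R φ c : ℕ}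
    (hc : c < q.len) (hφ : φ < q.p * q.p) (hP : q.Progress tc ts F R φ c s.mem)
    (hR : q.resultAddr (s.var .yb) = R)
    (v1 : s.var .c = c) (v2 : s.var .sec = c / (4 * q.N)) (v3 : s.var .ix = c % (4 * q.N) / 4)
    (v4 : s.var .kk = c % 4) (v5 : s.var .lv = c / (4 * q.N) % (q.K + 1)) (v6 : s.var .ph = φ)
    (v7 : s.var .grp = c / (4 * q.N) / (q.K + 1)) :
    WP q.bound q.space (.ite (Expr.lt 0 (Vr.lv : Expr)) stepButterfly <|
        .ite (Expr.lt (Vr.grp : Expr) 2) stepIndicator <|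
        .ite (Expr.lt (Vr.grp : Expr) 3) stepProduct stepResult) s (3 * q.d + 8) fun s' =>
      q.Progress tc ts F R φ (c + 1) s'.mem ∧
        ∀ l < 20 * q.N, ¬ (R ≤ l ∧ l < R + 4 * q.N) → s'.mem l = s.mem l := by
  have h8 := hq.eight_le
  have hR' := q.resultAddr_le (s.var .yb)
  rw [hR] at hR'
  set sec := c / (4 * q.N) with hsec
  set ix := c % (4 * q.N) / 4 with hixd
  set k := c % 4 with hkd
  have hix : ix < q.N := by
    have := Nat.mod_lt c (show 0 < 4 * q.N by omega)
    omega
  have hk : k < 4 := Nat.mod_lt _ (by norm_num)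
  have hcd : c = 4 * q.N * sec + 4 * ix + k := by
    have h1 := Nat.div_add_mod c (4 * q.N)
    have h2 := Nat.div_add_mod (c % (4 * q.N)) 4
    rw [Nat.mod_mod_of_dvd c (dvd_mul_right 4 q.N), ← hixd, ← hkd] at h2
    rw [← hsec] at h1
    omega
  have hsec4 : sec < 3 * (q.K + 1) + 1 := Nat.div_lt_of_lt_mul hc
  have hlvK := Nat.mod_lt sec (show 0 < q.K + 1 by omega)
  have hdm := Nat.div_add_mod sec (q.K + 1)
  have hφb : φ ≤ q.bound := hφ.le.trans <| (Nat.le_mul_of_pos_right _ hq.len_pos).trans hq.total_le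
  have hcell : ∀ s' : St, sec < 3 * (q.K + 1) → s'.mem = Function.update s.mem
      (20 * q.N + (4 * q.N * sec + 4 * ix + k)) (q.cell tc ts F φ sec ix k) →
      q.Progress tc ts F R φ (c + 1) s'.mem ∧
        ∀ l < 20 * q.N, ¬ (R ≤ l ∧ l < R + 4 * q.N) → s'.mem l = s.mem l := by
    intro s' hsec3 h
    rw [h]
    refine ⟨?_, fun l hl _ => Function.update_of_ne (by omega) _ _⟩
    rw [hcd]
    exact Progress.step_cell (by omega) hsec3 hix hk (by rw [← hcd]; exact hP)
  rw [hcd] at v1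
  by_cases hlv : 0 < sec % (q.K + 1)
  · have hsec3 : sec < 3 * (q.K + 1) := by
      by_contra h
      have : sec = 3 * (q.K + 1) := by omega
      rw [this, Nat.mul_mod_left] at hlv
      exact lt_irrefl _ hlv
    refine (WP.ite (T := 1) (by simp) (fun _ => ?_) (fun h => ?_)).mono (by omega) fun _ h => h
    · refine (step_butterfly_spec hq htw hs hT hsec3 hix hk (by rw [← hcd]; exact hP) v1 v2 v3 v4 v5
        hlv).mono le_rfl fun s' h => hcell s' hsec3 (by rw [h]; rfl)
    · simp [v5, hlv.ne'] at h
  · have hlv0 : sec % (q.K + 1) = 0 := by omega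
    refine (WP.ite (T := 3 * q.d + 7) (by simp) (fun h => ?_) (fun _ => ?_)).mono (by omega) fun _ h => h
    · simp [v5, hlv0] at h
    by_cases h2 : sec / (q.K + 1) < 2
    · have hsec3 : sec < 3 * (q.K + 1) := by nlinarith
      refine (WP.ite (T := 3 * q.d + 6) (by simp) (fun _ => ?_) (fun h => ?_)).mono (by omega) fun _ h => h
      · exact (step_indicator_spec hq hs hF hb hsec3 hφb hix hk v1 v3 v4 v6 v7 hlv0 h2).mono
          le_rfl fun s' h => hcell s' hsec3 h
      · simp [v7] at h; omega
    · refine (WP.ite (T := 2) (by simp) (fun h => ?_) (fun _ => ?_)).mono (by omega) fun _ h => h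
      · simp [v7] at h; omega
      by_cases h3 : sec / (q.K + 1) < 3
      · have hsec2 : sec = 2 * (q.K + 1) := by
          have : sec / (q.K + 1) = 2 := by omega
          rw [← hdm, this, hlv0]; ring
        refine (WP.ite (T := 1) (by simp) (fun _ => ?_) (fun h => ?_)).mono (by omega) fun _ h => h
        · rw [hsec2] at hcd v1
          refine (step_product_spec hq htw hs hix hk (by rw [← hcd]; exact hP) v1 v3 v4).mono le_rfl
            fun s' h => hcell s' (by omega) (by rw [h, hsec2]; rfl)
        · simp [v7] at h; omega
      · have hsec3 : sec = 3 * (q.K + 1) := by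
          have : 3 ≤ sec / (q.K + 1) := by omega
          have := Nat.mul_le_mul_left (q.K + 1) this
          rw [mul_comm (q.K + 1) 3] at this
          omega
        refine (WP.ite (T := 1) (by simp) (fun h => ?_) (fun _ => ?_)).mono (by omega) fun _ h => h
        · simp [v7] at h; omega
        · rw [hsec3] at hcd
          refine (step_result_spec hq htw hs hix hk hφ (by rw [← hcd]; exact hP) v3 v4 v6 hR).mono le_rfl
            fun s' h => ?_
          rw [h, St.put_mem]
          refine ⟨?_, fun l hl hl' => Function.update_of_ne (by omega) _ _⟩
          conv => arg 7; rw [hcd]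
          exact Progress.step_result (by omega) hix hk (by rw [← hcd]; exact hP)

/-- If the step completes a hash pair, the clock carries over and `Progress.next` changes `(φ, len)`
to `(φ + 1, 0)`. Twiddle table and frozen string are disjoint from the cells that a step may write.
-/
theorem step_spec (hq : q.Good) (htw : GoodTwiddles q.N q.Z tc ts ((1 / q.N : ℝ) ^ 12))
    (hB : q.Background tc ts F s) (hg : s.var .g < q.p * q.p * q.len) :
    WP q.bound q.space stepProg s (3 * q.d + 16) fun s' => q.Background tc ts F s' ∧
      s'.var .g = s.var .g + 1 ∧ ∀ l < 20 * q.N,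
        ¬ (q.resultAddr (s.var .yb) ≤ l ∧ l < q.resultAddr (s.var .yb) + 4 * q.N) → s'.mem l = s.mem l := by
  obtain ⟨hs, hT, hF, hP, hb⟩ := hB
  have hlen := hq.len_pos
  have hgb := hg.le.trans hq.total_le
  have h8 := hq.eight_le
  have hRle := q.resultAddr_le (s.var .yb)
  have hnN : q.m + q.n ≤ 2 * q.N := by
    have := hq.n_le; have := hq.m_le; have := hq.N_eq; omega
  have hframe : WP q.bound q.space stepProg s (3 * q.d + 16) fun s' =>
      (s'.var .g = s.var .g + 1 ∧
      q.Progress tc ts F (q.resultAddr (s.var .yb)) (s.var .g / q.len) (s.var .g % q.len + 1) s'.mem ∧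
        ∀ l < 20 * q.N, ¬ (q.resultAddr (s.var .yb) ≤ l ∧ l < q.resultAddr (s.var .yb) + 4 * q.N) →
          s'.mem l = s.mem l) := by
    refine (WP.seq (T := 7) (T' := (3 * q.d + 8) + 1) ?_).mono (by omega) fun _ h => h
    refine (stepHead_spec hs hgb).frame.mono le_rfl fun s₁ h => ?_
    obtain ⟨⟨m1, w6, w1, w2, w3, w4, w7, w5⟩, f1, -, f2⟩ := h
    refine WP.seq ?_
    refine (step_body_spec (F := F) (R := q.resultAddr (s.var .yb)) hq htw
      (hs.congr fun x hx => f1 x ?_) (by rw [m1]; exact hT) (by rw [m1]; exact hF)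
      (f2 hb) (Nat.mod_lt _ hlen) (Nat.div_lt_of_lt_mul (by rw [mul_comm]; exact hg)) (by rw [m1]; exact hP)
      (by rw [f1 .yb (by simp [stepHead, Prog.writes])]) w1 w2 w3 w4 w5 w6 w7).frame.mono le_rfl
      fun s₂ h => ?_
    · simp only [params, List.mem_cons, List.not_mem_nil, or_false] at hx
      rcases hx with rfl | rfl | rfl | rfl | rfl | rfl | rfl | rfl | rfl <;>
        simp [stepHead, Prog.writes]
    obtain ⟨⟨a1, a2⟩, f3, -, -⟩ := h
    have hg2 : s₂.var .g = s.var .g := by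
      rw [f3 .g (by decide), f1 .g (by decide)]
    refine WP.assign (by simp) ?_ ⟨?_, a1, fun l h1 h2 => ?_⟩
    · simp [hg2]; exact Nat.succ_le_of_lt (lt_of_lt_of_le hg hq.total_le)
    · simp [hg2]
    · rw [St.set_mem, a2 l h1 h2, m1]
  refine hframe.frame.mono le_rfl fun s' h => ?_
  obtain ⟨⟨a1, a2, a3⟩, f1, -, f2⟩ := h
  have hy : s'.var .yb = s.var .yb := f1 .yb (by decide)
  refine ⟨⟨hs.congr fun x hx => f1 x ?_, fun j hj => ?_, fun j hj => ?_, ?_, f2 hb⟩, a1, a3⟩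
  · simp only [params, List.mem_cons, List.not_mem_nil, or_false] at hx
    rcases hx with rfl | rfl | rfl | rfl | rfl | rfl | rfl | rfl | rfl <;> decide
  · rw [a3 _ (by omega) (by omega), a3 _ (by omega) (by omega)]
    exact hT j hj
  · rw [a3 _ (by omega) (by omega)]; exact hF j hj
  · rw [hy, a1]
    by_cases hlast : s.var .g % q.len + 1 = q.len
    · have e := Nat.div_add_mod (s.var .g) q.len
      have e1 : s.var .g + 1 = q.len * (s.var .g / q.len + 1) := by rw [mul_add]; omega
      have h1 : (s.var .g + 1) / q.len = s.var .g / q.len + 1 := by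
        rw [e1, Nat.mul_div_cancel_left _ hlen]
      have h2 : (s.var .g + 1) % q.len = 0 := by rw [e1, Nat.mul_mod_right]
      rw [h1, h2]
      rw [hlast] at a2
      exact a2.next
    · have hlt : s.var .g % q.len + 1 < q.len := by
        have := Nat.mod_lt (s.var .g) hlen; omega
      have e := Nat.div_add_mod (s.var .g) q.len
      have e1 : s.var .g + 1 = q.len * (s.var .g / q.len) + (s.var .g % q.len + 1) := by omega
      have h1 : (s.var .g + 1) / q.len = s.var .g / q.len := by
        conv_lhs => rw [e1]
        rw [Nat.mul_add_div hlen, Nat.div_eq_of_lt hlt, add_zero]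
      have h2 : (s.var .g + 1) % q.len = s.var .g % q.len + 1 := by
        conv_lhs => rw [e1]
        rw [Nat.mul_add_mod, Nat.mod_eq_of_lt hlt]
      rw [h1, h2]
      exact a2

end Cfg

/-! ## Queries -/

namespace Cfg
variable {q : Cfg} {tc ts : ℕ → ℕ} {X F G : ℕ → ℕ} {s : St}

/-- The total number of agreements of the pattern of `Y` with the text of `Y'` at position `i`. -/
def matchSum (q : Cfg) (Y Y' : ℕ → ℕ) (i : ℕ) : ℕ :=
  ∑ j ∈ Finset.range q.m, agree q.p q.d (Y j) (Y' (q.m + i + j))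

/-- The memory holds a log of `len` substitutions, from the address `b` on, that leads from the
string `A` to the string `B`. -/
def IsLog (q : Cfg) (b len : ℕ) (mem A B : ℕ → ℕ) : Prop :=
  ∃ Y : ℕ → ℕ → ℕ, Y 0 = A ∧ Y len = B ∧ ∀ k < len, mem (b + 3 * k) < q.m + q.n ∧
    mem (b + 3 * k + 1) = Y k (mem (b + 3 * k)) ∧
    Y (k + 1) = Function.update (Y k) (mem (b + 3 * k)) (mem (b + 3 * k + 2))

theorem IsLog.congr {b len : ℕ} {mem mem' A B : ℕ → ℕ} (h : q.IsLog b len mem A B)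
    (h' : ∀ l, b ≤ l → l < b + 3 * len → mem' l = mem l) : q.IsLog b len mem' A B := by
  obtain ⟨Y, h0, h1, h2⟩ := h
  refine ⟨Y, h0, h1, fun k hk => ?_⟩
  rw [h' _ (by omega) (by omega), h' _ (by omega) (by omega), h' _ (by omega) (by omega)]
  exact h2 k hk

theorem IsLog.append {b len : ℕ} {mem A B : ℕ → ℕ} (h : q.IsLog b len mem A B)
    (h1 : mem (b + 3 * len) < q.m + q.n) (h2 : mem (b + 3 * len + 1) = B (mem (b + 3 * len))) :
    q.IsLog b (len + 1) mem A
      (Function.update B (mem (b + 3 * len)) (mem (b + 3 * len + 2))) := by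
  obtain ⟨Y, e0, e1, e2⟩ := h
  refine ⟨fun k => if k ≤ len then Y k else
    Function.update B (mem (b + 3 * len)) (mem (b + 3 * len + 2)), by simpa using e0, by simp,
    fun k hk => ?_⟩
  rcases Nat.lt_succ_iff_lt_or_eq.mp hk with hlt | rfl
  · simp only [hlt.le, if_true, Nat.succ_le_of_lt hlt]
    exact e2 k hlt
  · simp [e1, h1, h2]

/-- The contribution of a substituted letter of the pattern. -/
def patContrib (q : Cfg) (G : ℕ → ℕ) (i pos v : ℕ) : ℕ :=
  if pos < q.m then agree q.p q.d v (G (q.m + i + pos)) else 0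

/-- The contribution of a substituted letter of the text. -/
def textContrib (q : Cfg) (X : ℕ → ℕ) (i pos v : ℕ) : ℕ :=
  if q.m + i ≤ pos ∧ pos < q.m + i + q.m then agree q.p q.d v (X (pos - (q.m + i))) else 0

/-- One substitution changes one summand. Old and new terms are placed on opposite sides to avoid
subtraction in `ℕ`. -/
theorem sum_update_aux {m : ℕ} (f : ℕ → ℕ → ℕ) (Y : ℕ → ℕ) (a x : ℕ) :
    ∑ j ∈ Finset.range m, f j (Function.update Y a x j) + (if a < m then f a (Y a) else 0) =
      ∑ j ∈ Finset.range m, f j (Y j) + (if a < m then f a x else 0) := by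
  by_cases h : a < m
  · rw [if_pos h, if_pos h, ← Finset.add_sum_erase _ _ (Finset.mem_range.mpr h),
      ← Finset.add_sum_erase _ (fun j => f j (Y j)) (Finset.mem_range.mpr h), Function.update_self]
    have : ∑ j ∈ (Finset.range m).erase a, f j (Function.update Y a x j) =
        ∑ j ∈ (Finset.range m).erase a, f j (Y j) :=
      Finset.sum_congr rfl fun j hj => by rw [Function.update_of_ne (Finset.ne_of_mem_erase hj)]
    rw [this]; ring
  · rw [if_neg h, if_neg h]
    congr 1
    refine Finset.sum_congr rfl fun j hj => ?_
    rw [Function.update_of_ne (by have := Finset.mem_range.mp hj; omega)]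

theorem matchSum_update_pat (Y : ℕ → ℕ) (i pos x : ℕ) :
    q.matchSum (Function.update Y pos x) G i + q.patContrib G i pos (Y pos) =
      q.matchSum Y G i + q.patContrib G i pos x :=
  sum_update_aux (fun j v => agree q.p q.d v (G (q.m + i + j))) Y pos x

theorem matchSum_update_text (Y : ℕ → ℕ) (i pos x : ℕ) :
    q.matchSum X (Function.update Y pos x) i + q.textContrib X i pos (Y pos) =
      q.matchSum X Y i + q.textContrib X i pos x := by
  by_cases h : q.m + i ≤ pos
  · have := sum_update_aux (m := q.m) (fun j v => agree q.p q.d (X j) v) (fun j => Y (q.m + i + j))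
      (pos - (q.m + i)) x
    have e : ∀ j, Function.update (fun j => Y (q.m + i + j)) (pos - (q.m + i)) x j =
        Function.update Y pos x (q.m + i + j) := by
      intro j
      simp only [Function.update_apply]
      congr 1
      exact propext ⟨fun h => by omega, fun h => by omega⟩
    simp only [e, Nat.add_sub_cancel' h] at this
    have e2 : (pos - (q.m + i) < q.m) ↔ (q.m + i ≤ pos ∧ pos < q.m + i + q.m) :=
      ⟨fun h => by omega, fun h => by omega⟩
    simp only [e2] at this
    simp only [matchSum, textContrib, agree_comm q.p q.d x, agree_comm q.p q.d (Y pos)]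
    exact this
  · have e : q.matchSum X (Function.update Y pos x) i = q.matchSum X Y i :=
      Finset.sum_congr rfl fun j _ => by rw [Function.update_of_ne (by omega)]
    simp [e, textContrib, h]

/-- The contribution of a substituted letter. -/
def contrib (q : Cfg) (X G : ℕ → ℕ) (i pos v : ℕ) : ℕ :=
  q.patContrib G i pos v + q.textContrib X i pos v

/-- The sum of the contributions of the first `len` entries of a log; `f` selects the old (`1`) or
the new (`2`) letter. -/
def logSum (q : Cfg) (X G : ℕ → ℕ) (i : ℕ) (mem : ℕ → ℕ) (b f len : ℕ) : ℕ :=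
  ∑ k ∈ Finset.range len, q.contrib X G i (mem (b + 3 * k)) (mem (b + 3 * k + f))

/-- The comparison partners `X` and `G` stay fixed along the log, so the effects of single
substitutions telescope. Adding this identity for the logs from `G` to `F` and from `F` to `X`
cancels all mixed terms and leaves `M X X + old = M G G + new`. -/
theorem IsLog.sums {b len : ℕ} {mem A B : ℕ → ℕ} (h : q.IsLog b len mem A B) (X G : ℕ → ℕ) (i : ℕ) :
    q.matchSum B G i + q.matchSum X B i + q.logSum X G i mem b 1 len =
      q.matchSum A G i + q.matchSum X A i + q.logSum X G i mem b 2 len := by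
  obtain ⟨Y, rfl, rfl, h2⟩ := h
  have key : ∀ j ≤ len, q.matchSum (Y j) G i + q.matchSum X (Y j) i + q.logSum X G i mem b 1 j =
      q.matchSum (Y 0) G i + q.matchSum X (Y 0) i + q.logSum X G i mem b 2 j := by
    intro j
    induction j with
    | zero => intro _; rfl
    | succ j ih =>
      intro hj
      have ih := ih (by omega)
      obtain ⟨-, e1, e2⟩ := h2 j (by omega)
      have a := matchSum_update_pat (q := q) (G := G) (Y j) i (mem (b + 3 * j)) (mem (b + 3 * j + 2))
      have c := matchSum_update_text (q := q) (X := X) (Y j) i (mem (b + 3 * j)) (mem (b + 3 * j + 2))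
      rw [← e2] at a c
      simp only [logSum, Finset.sum_range_succ, contrib, e1] at ih ⊢
      omega
  exact key len le_rfl

/-- A position cannot lie both in the pattern and in the text, so at most one of the two
contributions is nonzero. -/
theorem contrib_le (hq : q.Good) (i pos v : ℕ) : q.contrib X G i pos v ≤ q.p := by
  have := hq.p_pos
  unfold contrib patContrib textContrib
  split_ifs
  · omega
  · simpa using agree_le _ _ _ _
  · simpa using agree_le _ _ _ _
  · simp

theorem logSum_le (hq : q.Good) (i : ℕ) (mem : ℕ → ℕ) (b f len : ℕ) :
    q.logSum X G i mem b f len ≤ len * q.p := by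
  have : ∀ k ∈ Finset.range len,
      q.contrib X G i (mem (b + 3 * k)) (mem (b + 3 * k + f)) ≤ q.p := fun k _ => contrib_le hq _ _ _
  simpa [logSum] using Finset.sum_le_card_nsmul _ _ _ this

theorem sum_range_mul_split (f : ℕ → ℕ) (a p : ℕ) :
    ∑ ψ ∈ Finset.range (a * p), f ψ = ∑ t ∈ Finset.range a, ∑ r ∈ Finset.range p, f (t * p + r) := by
  induction a with
  | zero => simp
  | succ a ih => rw [Nat.succ_mul, Finset.sum_range_add, ih, Finset.sum_range_succ]

/-- The correlations for all hash pairs count the agreements. -/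
theorem sum_corrCount (hq : q.Good) (F : ℕ → ℕ) {i : ℕ} (hi : i + q.m ≤ q.n) :
    ∑ ψ ∈ Finset.range (q.p * q.p), q.corrCount F ψ i = q.matchSum F F i := by
  have hp := hq.p_pos
  have hnN : q.n ≤ q.N := by have := hq.n_le; have := hq.m_le; have := hq.N_eq; omega
  have hcorr : ∀ ψ, q.corrCount F ψ i = ∑ j ∈ Finset.range q.m,
      if hashVal q.p (ψ / q.p) q.d (F j) = ψ % q.p ∧
        hashVal q.p (ψ / q.p) q.d (F (q.m + i + j)) = ψ % q.p then 1 else 0 := by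
    intro ψ
    -- Since `i + j < n ≤ N`, the cyclic index does not wrap around.
    rw [corrCount, ← Finset.sum_subset (Finset.range_mono (show q.m ≤ q.N by omega))]
    · refine Finset.sum_congr rfl fun j hj => ?_
      have hj := Finset.mem_range.mp hj
      rw [Nat.mod_eq_of_lt (by omega), patInd, textInd, ← add_assoc]
      by_cases h1 : hashVal q.p (ψ / q.p) q.d (F j) = ψ % q.p <;>
        by_cases h2 : hashVal q.p (ψ / q.p) q.d (F (q.m + i + j)) = ψ % q.p <;>
        simp [h1, h2, hj, show i + j < q.n by omega]
    · intro j _ hj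
      have : ¬ j < q.m := fun h => hj (Finset.mem_range.mpr h)
      simp [patInd, this]
  rw [Finset.sum_congr rfl fun ψ _ => hcorr ψ, sum_range_mul_split]
  simp only [matchSum, agree, Finset.card_filter]
  rw [Finset.sum_comm (s := Finset.range q.m)]
  refine Finset.sum_congr rfl fun t _ => ?_
  rw [Finset.sum_comm]
  refine Finset.sum_congr rfl fun j _ => ?_
  -- For a fixed point `t` only the value `r` equal to the hash of the pattern letter contributes.
  have e : ∀ r ∈ Finset.range q.p, (if hashVal q.p ((t * q.p + r) / q.p) q.d (F j) = (t * q.p + r) % q.p ∧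
      hashVal q.p ((t * q.p + r) / q.p) q.d (F (q.m + i + j)) = (t * q.p + r) % q.p then 1 else 0) =
      if hashVal q.p t q.d (F j) = r then
        (if hashVal q.p t q.d (F j) = hashVal q.p t q.d (F (q.m + i + j)) then 1 else 0) else 0 := by
    intro r hr
    have hr := Finset.mem_range.mp hr
    have e1 : (t * q.p + r) / q.p = t := by
      rw [mul_comm, Nat.mul_add_div hp, Nat.div_eq_of_lt hr, add_zero]
    have e2 : (t * q.p + r) % q.p = r := by rw [mul_comm, Nat.mul_add_mod, Nat.mod_eq_of_lt hr]
    rw [e1, e2]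
    by_cases h1 : hashVal q.p t q.d (F j) = r
    · simp [h1, eq_comm]
    · simp [h1]
  rw [Finset.sum_congr rfl e, Finset.sum_ite_eq, if_pos (Finset.mem_range.mpr (hashVal_lt hp _ _ _))]

theorem compare_spec (hq : q.Good) (hs : q.Holds s) (h1 : s.var .pl + q.p ≤ q.bound)
    (h2 : s.var .mi + q.p ≤ q.bound) :
    WP q.bound q.space compareProg s (q.p * (9 * q.d + 13) + 2) fun s' =>
      s'.var .pl = s.var .pl + agree q.p q.d (s.var .new) (s.var .o) ∧
      s'.var .mi = s.var .mi + agree q.p q.d (s.var .old) (s.var .o) := by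
  have hp0 := hq.p_pos
  have hpb := hq.p_le
  set cnt : ℕ → ℕ → ℕ := fun x k => ∑ t ∈ Finset.range k,
    if hashVal q.p t q.d x = hashVal q.p t q.d (s.var .o) then 1 else 0 with hcnt
  have hcle : ∀ x k, cnt x k ≤ k := by
    intro x k
    have : ∀ t ∈ Finset.range k, (if hashVal q.p t q.d x = hashVal q.p t q.d (s.var .o)
      then 1 else 0) ≤ 1 := fun t _ => by split_ifs <;> simp
    exact (Finset.sum_le_card_nsmul _ _ _ this).trans (by simp)
  refine (WP.seq (T := 1) (T' := q.p * (9 * q.d + 12 + 1) + 1) ?_).mono (le_of_eq (by ring)) fun _ h => h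
  refine WP.assign (by simp) (by simp) ?_
  refine (WP.while_count (I := fun k s' => s'.var .t = k ∧ s'.var .pl = s.var .pl + cnt (s.var .new) k ∧
    s'.var .mi = s.var .mi + cnt (s.var .old) k ∧ s'.var .p = q.p ∧ s'.var .D = q.D ∧
    s'.var .new = s.var .new ∧ s'.var .old = s.var .old ∧ s'.var .o = s.var .o) q.p ?_ ?_ ?_).mono
    le_rfl fun s' h => ?_
  · simp [hcnt, hs.p, hs.D]
  · rintro k s₀ hk ⟨a1, a2, a3, a4, a5, a6, a7, a8⟩
    refine ⟨by simp, by simp [a1, a4, hk], ?_⟩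
    have hash : ∀ (z r : Vr) (s' : St), s'.var .p = q.p → s'.var .D = q.D → z ≠ .pw → z ≠ r → r ≠ .pw →
        r ≠ .D → r ≠ .t → r ≠ .p → WP q.bound q.space (hashProg z r) s' (3 * q.d + 3)
        fun s'' => s''.var r = hashVal q.p (s'.var .t) q.d (s'.var z) ∧
        (∀ y, y ≠ r → y ≠ .pw → s''.var y = s'.var y) ∧ s''.mem = s'.mem := by
      intro z r s' e1 e2 g1 g2 g3 g4 g5 g6
      have := hash_spec (q := q) (V := q.bound) (S := q.space) (s := s') (z := z) (r := r)
        (by rw [e2, hq.D_eq]) (by rw [e1]; exact hp0) (by rw [e2]; exact hq.D_le)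
        (by rw [e1]; exact hpb) g1 g2 g3 g4 g5 g6
      rwa [e1] at this
    refine (WP.seq (T := 3 * q.d + 3) (T' := (3 * q.d + 3) + ((3 * q.d + 3) + (1 + (1 + 1)))) ?_).mono
      (by omega) fun _ h => h
    refine (hash .old .h1 s₀ a4 a5 (by simp) (by simp) (by simp) (by simp) (by simp) (by simp)).mono
      le_rfl fun s₁ b => ?_
    obtain ⟨b1, b2, -⟩ := b
    refine WP.seq ((hash .new .h2 s₁ (by rw [b2 _ (by simp) (by simp), a4])
      (by rw [b2 _ (by simp) (by simp), a5]) (by simp) (by simp) (by simp) (by simp) (by simp)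
      (by simp)).mono le_rfl fun s₂ c => ?_)
    obtain ⟨c1, c2, -⟩ := c
    refine WP.seq ((hash .o .h3 s₂ (by rw [c2 _ (by simp) (by simp), b2 _ (by simp) (by simp), a4])
      (by rw [c2 _ (by simp) (by simp), b2 _ (by simp) (by simp), a5]) (by simp) (by simp) (by simp)
      (by simp) (by simp) (by simp)).mono le_rfl fun s₃ d => ?_)
    obtain ⟨d1, d2, -⟩ := d
    have w : ∀ y : Vr, y ≠ .h1 → y ≠ .h2 → y ≠ .h3 → y ≠ .pw → s₃.var y = s₀.var y := by
      intro y y1 y2 y3 y4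
      rw [d2 y y3 y4, c2 y y2 y4, b2 y y1 y4]
    have e1 : s₃.var .h1 = hashVal q.p k q.d (s.var .old) := by
      rw [d2 _ (by simp) (by simp), c2 _ (by simp) (by simp), b1, a1, a7]
    have e2 : s₃.var .h2 = hashVal q.p k q.d (s.var .new) := by
      rw [d2 _ (by simp) (by simp), c1, b2 _ (by simp) (by simp), b2 _ (by simp) (by simp), a1, a6]
    have e3 : s₃.var .h3 = hashVal q.p k q.d (s.var .o) := by
      rw [d1, c2 _ (by simp) (by simp), c2 _ (by simp) (by simp), b2 _ (by simp) (by simp),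
        b2 _ (by simp) (by simp), a1, a8]
    have e4 : s₃.var .t = k := by rw [w _ (by simp) (by simp) (by simp) (by simp), a1]
    have e5 : s₃.var .pl = s.var .pl + cnt (s.var .new) k := by
      rw [w _ (by simp) (by simp) (by simp) (by simp), a2]
    have e6 : s₃.var .mi = s.var .mi + cnt (s.var .old) k := by
      rw [w _ (by simp) (by simp) (by simp) (by simp), a3]
    have e7 : s₃.var .p = q.p := by rw [w _ (by simp) (by simp) (by simp) (by simp), a4]
    have e8 : s₃.var .D = q.D := by rw [w _ (by simp) (by simp) (by simp) (by simp), a5]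
    have e9 : s₃.var .new = s.var .new := by rw [w _ (by simp) (by simp) (by simp) (by simp), a6]
    have e10 : s₃.var .old = s.var .old := by rw [w _ (by simp) (by simp) (by simp) (by simp), a7]
    have e11 : s₃.var .o = s.var .o := by rw [w _ (by simp) (by simp) (by simp) (by simp), a8]
    have k1 : cnt (s.var .new) (k + 1) = cnt (s.var .new) k +
        if hashVal q.p k q.d (s.var .new) = hashVal q.p k q.d (s.var .o) then 1 else 0 :=
      Finset.sum_range_succ _ _
    have k2 : cnt (s.var .old) (k + 1) = cnt (s.var .old) k +
        if hashVal q.p k q.d (s.var .old) = hashVal q.p k q.d (s.var .o) then 1 else 0 :=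
      Finset.sum_range_succ _ _
    have l1 := hcle (s.var .new) (k + 1)
    have l2 := hcle (s.var .old) (k + 1)
    refine WP.seq (WP.assign (by simp) ?_ ?_)
    · simp only [Expr.eval_add, Expr.eval_var, Expr.eval_eq, e2, e3, e5]; omega
    refine WP.seq (WP.assign (by simp) ?_ ?_)
    · simp only [Expr.eval_add, Expr.eval_var, Expr.eval_eq, St.set_var, reduceCtorEq, if_false,
        e1, e3, e6]; omega
    refine WP.assign (by simp) ?_ ?_
    · simp [e4]; omega
    · simp [e1, e2, e3, e4, e5, e6, e7, e8, e9, e10, e11, k1, k2, add_assoc]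
  · rintro s' ⟨a1, -, -, a4, -⟩
    simp [a1, a4]
  · obtain ⟨-, a2, a3, -⟩ := h
    rw [a2, a3]
    simp only [agree, Finset.card_filter, hcnt, and_self]

theorem Good.len_le_two (hq : q.Good) : q.m + q.n ≤ 2 * q.N := by
  have := hq.n_le; have := hq.m_le; have := hq.N_eq; omega

/-- A pattern position is compared with the text of `G`, a position in the window with the pattern
of `X`, and any other text position contributes nothing. The sum of two comparison bits in the
program acts as a disjunction. -/
theorem entry_spec (hq : q.Good) (hs : q.Holds s) (hb : s.Bdd q.bound)
    (hX : ∀ j < q.m + q.n, s.mem j = X j) (hG : ∀ j < q.m + q.n, s.mem (4 * q.N + j) = G j)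
    (hi : s.var .a0 + q.m ≤ q.n) (haddr : s.var .i + 2 < q.space)
    (h1 : s.var .pl + q.p ≤ q.bound) (h2 : s.var .mi + q.p ≤ q.bound) :
    WP q.bound q.space entryProg s (q.p * (9 * q.d + 13) + 8) fun s' =>
      s'.var .pl = s.var .pl +
        q.contrib X G (s.var .a0) (s.mem (s.var .i)) (s.mem (s.var .i + 2)) ∧
      s'.var .mi = s.var .mi +
        q.contrib X G (s.var .a0) (s.mem (s.var .i)) (s.mem (s.var .i + 1)) := by
  have hMN := hq.len_le_two
  have hS : 20 * q.N < q.space := by have := hq.len_pos; unfold space; omega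
  refine (WP.seq (T := 1) (T' := 1 + (1 + (q.p * (9 * q.d + 13) + 5))) ?_).mono (by omega) fun _ h => h
  refine WP.assign (by simp; omega) (by simpa using hb.mem _) ?_
  refine WP.seq (WP.assign (by simp; omega) (by simpa using hb.mem _) ?_)
  refine WP.seq (WP.assign (by simp; omega) (by simpa using hb.mem _) ?_)
  set s₁ := (((s.set Vr.pos _).set Vr.old _).set Vr.new _) with hs₁
  have e0 : s₁.var .pos = s.mem (s.var .i) := by simp [hs₁]
  have e1 : s₁.var .old = s.mem (s.var .i + 1) := by simp [hs₁]
  have e2 : s₁.var .new = s.mem (s.var .i + 2) := by simp [hs₁]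
  have e3 : s₁.var .a0 = s.var .a0 := by simp [hs₁]
  have e4 : s₁.var .pl = s.var .pl := by simp [hs₁]
  have e5 : s₁.var .mi = s.var .mi := by simp [hs₁]
  have e6 : s₁.mem = s.mem := rfl
  have hs1 : q.Holds s₁ := hs.congr fun x hx => by
    simp only [params, List.mem_cons, List.not_mem_nil, or_false] at hx
    rcases hx with rfl | rfl | rfl | rfl | rfl | rfl | rfl | rfl | rfl <;> simp [hs₁]
  clear_value s₁
  set pos := s.mem (s.var .i) with hpos
  have fin : ∀ (E : Expr) (w : ℕ), E.ok q.bound q.space s₁ → E.eval s₁ = w → w ≤ q.bound →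
      WP q.bound q.space (.seq (.assign .o E) compareProg) s₁ (q.p * (9 * q.d + 13) + 3) fun s' =>
        s'.var .pl = s.var .pl + agree q.p q.d (s.mem (s.var .i + 2)) w ∧
        s'.var .mi = s.var .mi + agree q.p q.d (s.mem (s.var .i + 1)) w := by
    intro E w hE hw hwb
    refine (WP.seq (T := 1) (T' := q.p * (9 * q.d + 13) + 2) ?_).mono (by omega) fun _ h => h
    refine WP.assign hE (by rw [hw]; exact hwb) ?_
    refine (compare_spec hq (hs1.congr fun x hx => ?_) (by simp [e4, h1]) (by simp [e5, h2])).mono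
      le_rfl fun s' h => ?_
    · simp only [params, List.mem_cons, List.not_mem_nil, or_false] at hx
      rcases hx with rfl | rfl | rfl | rfl | rfl | rfl | rfl | rfl | rfl <;> simp
    · simpa [hw, e1, e2, e4, e5] using h
  refine (WP.ite (T := q.p * (9 * q.d + 13) + 4) (by simp) (fun h => ?_) (fun h => ?_)).mono
    (by omega) fun _ h => h
  · have hlt : pos < q.m := by simpa [e0, hs1.m] using h
    have hGb := hb.mem (4 * q.N + (q.m + s.var .a0 + pos))
    rw [hG _ (by omega)] at hGb
    refine (fin _ (G (q.m + s.var .a0 + pos)) ?_ ?_ hGb).mono (by omega) fun s' h' => ?_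
    · simp [hs1.N, hs1.m, e3, e0]; omega
    · simp [hs1.N, hs1.m, e3, e0, e6, hG (q.m + s.var .a0 + pos) (by omega)]
    · simpa [contrib, patContrib, textContrib, hlt, show ¬ q.m + s.var .a0 ≤ pos by omega] using h'
  · have hge : q.m ≤ pos := by simpa [e0, hs1.m] using h
    refine (WP.ite (T := q.p * (9 * q.d + 13) + 3) (by simp) (fun h => ?_) (fun h => ?_)).mono
      (by omega) fun _ h => h
    · have hout : ¬ (q.m + s.var .a0 ≤ pos ∧ pos < q.m + s.var .a0 + q.m) := by
        intro hc
        apply h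
        simp [e0, e3, hs1.m]
        omega
      refine (WP.skip ?_).mono (by omega) fun _ h => h
      simp [contrib, patContrib, textContrib, hge, hout, e4, e5]
    · have hin : q.m + s.var .a0 ≤ pos ∧ pos < q.m + s.var .a0 + q.m := by
        simp [e0, e3, hs1.m] at h
        omega
      have hXb := hb.mem (pos - (q.m + s.var .a0))
      rw [hX _ (by omega)] at hXb
      refine (fin _ (X (pos - (q.m + s.var .a0))) ?_ ?_ hXb).mono (by omega) fun s' h' => ?_
      · simp [hs1.m, e3, e0]; omega
      · simp [hs1.m, e3, e0, e6, hX (pos - (q.m + s.var .a0)) (by omega)]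
      · simpa [contrib, patContrib, textContrib, show ¬ pos < q.m by omega, hin] using h'

/-- The address and the length are expressions that are evaluated anew in each round; the hypotheses
ask that they keep their values as long as only variables written by the loop change. -/
theorem log_spec (hq : q.Good) (hs : q.Holds s) (hb : s.Bdd q.bound)
    (hX : ∀ j < q.m + q.n, s.mem j = X j) (hG : ∀ j < q.m + q.n, s.mem (4 * q.N + j) = G j)
    (hi : s.var .a0 + q.m ≤ q.n) {base len : Expr} {b l : ℕ}
    (hbase : ∀ s' : St, (∀ x, x ∉ (logProg base len).writes → s'.var x = s.var x) →
      base.eval s' = b ∧ base.ok q.bound q.space s')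
    (hlen : ∀ s' : St, (∀ x, x ∉ (logProg base len).writes → s'.var x = s.var x) →
      len.eval s' = l ∧ len.ok q.bound q.space s')
    (haddr : b + 3 * l ≤ q.space) (h1 : s.var .pl + l * q.p ≤ q.bound)
    (h2 : s.var .mi + l * q.p ≤ q.bound) :
    WP q.bound q.space (logProg base len) s (l * (q.p * (9 * q.d + 13) + 11) + 2) fun s' =>
      s'.var .pl = s.var .pl + q.logSum X G (s.var .a0) s.mem b 2 l ∧
      s'.var .mi = s.var .mi + q.logSum X G (s.var .a0) s.mem b 1 l := by
  have hw : (logProg base len).writes = Vr.k :: Vr.i :: (entryProg.writes ++ [Vr.k]) := rfl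
  have hwr : ∀ x, x ∉ (logProg base len).writes → x ≠ .k ∧ x ≠ .i ∧ x ∉ entryProg.writes := by
    intro x hx
    rw [hw] at hx
    simp only [List.mem_cons, List.mem_append, not_or] at hx
    exact ⟨hx.1, hx.2.1, hx.2.2.1⟩
  have hSb := hq.space_le_bound
  refine (WP.seq (T := 1) (T' := l * ((q.p * (9 * q.d + 13) + 10) + 1) + 1) ?_).mono
    (le_of_eq (by ring)) fun _ h => h
  refine WP.assign (by simp) (by simp) ?_
  refine (WP.while_count (I := fun k s' => s'.var .k = k ∧
    s'.var .pl = s.var .pl + q.logSum X G (s.var .a0) s.mem b 2 k ∧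
    s'.var .mi = s.var .mi + q.logSum X G (s.var .a0) s.mem b 1 k ∧ s'.mem = s.mem ∧ s'.Bdd q.bound ∧
    ∀ x, x ∉ (logProg base len).writes → s'.var x = s.var x) l ?_ ?_ ?_).mono
    le_rfl fun s' h => ⟨h.2.1, h.2.2.1⟩
  · refine ⟨by simp, by simp [logSum], by simp [logSum], rfl, hb.set _ (by simp), fun x hx => ?_⟩
    simp [(hwr x hx).1]
  · rintro k s₀ hk ⟨a1, a2, a3, a4, a5, a6⟩
    obtain ⟨l1, l2⟩ := hlen s₀ a6
    refine ⟨by simp [l2], by simp [l1, a1, hk], ?_⟩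
    obtain ⟨b1, b2⟩ := hbase s₀ a6
    refine (WP.seq (T := 1) (T' := (q.p * (9 * q.d + 13) + 8) + 1) ?_).mono (by omega) fun _ h => h
    refine WP.assign (by simp [b2]) (by simp [b1, a1]; omega) ?_
    have ei : (base + 3 * Vr.k : Expr).eval s₀ = b + 3 * k := by simp [b1, a1]
    rw [ei]
    have hw0 : ∀ x ∈ (.a0 :: params), x ∉ (logProg base len).writes := by
      intro x hx
      rw [hw]
      simp only [params, List.mem_cons, List.not_mem_nil, or_false] at hx
      rcases hx with rfl | rfl | rfl | rfl | rfl | rfl | rfl | rfl | rfl | rfl <;> decide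
    have ha0 : s₀.var .a0 = s.var .a0 := a6 _ (hw0 _ (by simp))
    have m1 : q.logSum X G (s.var .a0) s.mem b 2 k ≤ k * q.p := logSum_le hq _ _ _ _ _
    have m2 : q.logSum X G (s.var .a0) s.mem b 1 k ≤ k * q.p := logSum_le hq _ _ _ _ _
    have m3 : k * q.p + q.p ≤ l * q.p := by rw [← Nat.succ_mul]; exact Nat.mul_le_mul_right _ hk
    refine WP.seq ((entry_spec (X := X) (G := G) hq (hs.congr fun x hx => ?_)
      (a5.set _ (by omega)) (by simpa [a4] using hX) (by simpa [a4] using hG)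
      (by simpa [ha0] using hi) (by simp; omega) (by simp [a2]; omega)
      (by simp [a3]; omega)).frame.mono le_rfl fun s₁ h => ?_)
    · have : x ≠ .i := by
        rintro rfl; simp [params] at hx
      simp [this, a6 x (hw0 x (List.mem_cons_of_mem _ hx))]
    obtain ⟨⟨c1, c2⟩, c3, c4, c5⟩ := h
    have hk1 : s₁.var .k = k := by rw [c3 _ (by decide)]; simp [a1]
    refine WP.assign (by simp) (by simp [hk1]; omega) ⟨by simp [hk1], ?_, ?_, ?_, ?_, fun x hx => ?_⟩
    · simp [c1, a2, a4, ha0, logSum, Finset.sum_range_succ, add_assoc]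
    · simp [c2, a3, a4, ha0, logSum, Finset.sum_range_succ, add_assoc]
    · rw [St.set_mem, c4 rfl]; exact a4
    · exact (c5 (a5.set _ (by omega))).set _ (by simp [hk1]; omega)
    · obtain ⟨x1, x2, x3⟩ := hwr x hx
      rw [St.set_var, if_neg x1, c3 x x3, St.set_var, if_neg x2, a6 x hx]
  · rintro s' ⟨a1, -, -, -, -, a6⟩
    obtain ⟨l1, l2⟩ := hlen s' a6
    simp [l1, l2, a1]

end Cfg

/-! ## The invariant of the data structure -/

namespace Cfg
variable {q : Cfg} {tc ts : ℕ → ℕ} {X F G : ℕ → ℕ} {s s' : St}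

/-- The number of background steps for each update. -/
def stride (q : Cfg) : ℕ := q.p * q.p * (8 * q.B * (3 * (q.K + 1) + 1))

theorem Good.B_mul_stride (hq : q.Good) : q.B * q.stride = q.p * q.p * q.len := by
  rw [stride, len, hq.N_eq]; ring

/-- The variables that persist from one operation to the next. -/
def persistent : List Vr := params ++ [.yb, .g, .lo, .cnt, .Q]

/-- The state of the data structure for the current string `X`, the string `F` at the start of the
epoch and the string `G` at the start of the previous epoch. -/
structure Core (q : Cfg) (tc ts X F G : ℕ → ℕ) (s : St) : Prop where
  background : q.Background tc ts F s
  current : ∀ j < q.m + q.n, s.mem j = X j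
  base : ∀ j < q.m + q.n, s.mem (4 * q.N + j) = G j
  older : q.IsLog (6 * q.N + 2 * q.N * s.var .yb) (s.var .lo) s.mem G F
  newer : q.IsLog (6 * q.N + 2 * q.N * (1 - s.var .yb)) (s.var .cnt) s.mem F X
  counts : ∀ i, i + q.m ≤ q.n →
    s.mem (10 * q.N + 4 * q.N * s.var .yb + 4 * i) = q.matchSum G G i
  lo_le : s.var .lo ≤ q.B
  cnt_le : s.var .cnt ≤ q.B
  yb_le : s.var .yb ≤ 1
  stride_eq : s.var .Q = q.stride

theorem Background.congr (h : q.Background tc ts F s)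
    (hv : ∀ x ∈ params ++ [.yb, .g], s'.var x = s.var x)
    (hm : ∀ l, (2 * q.N ≤ l ∧ l < 4 * q.N) ∨ 10 * q.N ≤ l → s'.mem l = s.mem l)
    (hb : s'.Bdd q.bound) (hmn : q.m + q.n ≤ 2 * q.N) : q.Background tc ts F s' := by
  have hR := q.resultAddr_le (s.var .yb)
  refine ⟨h.holds.congr fun x hx => hv x (by simp [hx]), fun j hj => ?_, fun j hj => ?_, ?_, hb⟩
  · rw [hm _ (Or.inr (by omega)), hm _ (Or.inr (by omega))]; exact h.twiddles j hj
  · rw [hm _ (Or.inl (by omega))]; exact h.frozen j hj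
  · rw [hv .yb (by simp), hv .g (by simp)]
    exact h.progress.congr (fun l hl => hm l (Or.inr (by omega)))
      fun l _ => hm _ (Or.inr (by omega))

theorem Core.congr (hq : q.Good) (h : q.Core tc ts X F G s)
    (hv : ∀ x ∈ persistent, s'.var x = s.var x) (hm : s'.mem = s.mem) (hb : s'.Bdd q.bound) :
    q.Core tc ts X F G s' := by
  obtain ⟨h1, h2, h3, h4, h5, h6, h7, h8, h9, h10⟩ := h
  have e1 := hv .yb (by simp [persistent])
  have e2 := hv .lo (by simp [persistent])
  have e3 := hv .cnt (by simp [persistent])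
  have e4 := hv .Q (by simp [persistent])
  refine ⟨h1.congr (fun x hx => hv x ?_) (fun l _ => by rw [hm]) hb hq.len_le_two, ?_, ?_, ?_, ?_,
    ?_, ?_, ?_, ?_, ?_⟩
  · simp only [persistent, List.mem_append, List.mem_cons, List.not_mem_nil, or_false] at hx ⊢
    tauto
  all_goals simp only [hm, e1, e2, e3, e4]
  all_goals assumption

/-- Background steps write only to the array of results that is not in use and to cells from `20 *
N` on, so the strings, the logs and the counts for `G` survive. -/
theorem Core.step_mem (hq : q.Good) (h : q.Core tc ts X F G s) (h1 : q.Background tc ts F s')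
    (hv : ∀ x ∈ [Vr.yb, .lo, .cnt, .Q], s'.var x = s.var x)
    (hm : ∀ l < 20 * q.N, ¬ (q.resultAddr (s.var .yb) ≤ l ∧
      l < q.resultAddr (s.var .yb) + 4 * q.N) → s'.mem l = s.mem l) :
    q.Core tc ts X F G s' := by
  have hB := hq.two_le_B
  have hBB := Nat.mul_le_mul_right q.B hB
  have hN := hq.N_eq
  have hmn := hq.len_le_two
  have hn := hq.n_le
  have hmB := hq.m_le
  obtain ⟨-, h2, h3, h4, h5, h6, h7, h8, h9, h10⟩ := h
  have e1 := hv .yb (by simp)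
  have e2 := hv .lo (by simp)
  have e3 := hv .cnt (by simp)
  have e4 := hv .Q (by simp)
  have low : ∀ l < 10 * q.N, s'.mem l = s.mem l := fun l hl => hm l (by omega) fun hc => by
    have := q.resultAddr_le (s.var .yb); omega
  have hy : 2 * q.N * s.var .yb ≤ 2 * q.N * 1 := Nat.mul_le_mul_left _ h9
  have hy' : 2 * q.N * (1 - s.var .yb) ≤ 2 * q.N * 1 := Nat.mul_le_mul_left _ (by omega)
  refine ⟨h1, fun j hj => ?_, fun j hj => ?_, ?_, ?_, fun i hi => ?_, ?_, ?_, ?_, ?_⟩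
  · rw [low _ (by omega)]; exact h2 j hj
  · rw [low _ (by omega)]; exact h3 j hj
  · rw [e1, e2]; exact h4.congr fun l _ _ => low l (by omega)
  · rw [e1, e3]; exact h5.congr fun l _ _ => low l (by omega)
  · rw [e1, hm _ ?_ ?_]
    · exact h6 i hi
    · have : 4 * q.N * s.var .yb ≤ 4 * q.N * 1 := Nat.mul_le_mul_left _ h9
      omega
    · unfold resultAddr
      interval_cases s.var .yb <;> omega
  all_goals simp only [e1, e2, e3, e4]
  all_goals assumption

theorem matchSum_le (Y Y' : ℕ → ℕ) (i : ℕ) : q.matchSum Y Y' i ≤ q.p * q.m := by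
  have : ∀ j ∈ Finset.range q.m, agree q.p q.d (Y j) (Y' (q.m + i + j)) ≤ q.p :=
    fun j _ => agree_le _ _ _ _
  have := Finset.sum_le_card_nsmul _ _ _ this
  rw [Finset.card_range, smul_eq_mul, mul_comm] at this
  exact this

/-- Correctness of the query. -/
theorem query_spec (hq : q.Good) (h : q.Core tc ts X F G s) (hi : s.var .a0 + q.m ≤ q.n) :
    WP q.bound q.space queryProg s (2 * (q.B * (q.p * (9 * q.d + 13) + 11)) + 7) fun s' =>
      s'.var .a0 = (q.p * q.m - q.matchSum X X (s.var .a0)) / (q.p - q.d) := by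
  have hB := hq.two_le_B
  have hBB := Nat.mul_le_mul_right q.B hB
  have hN := hq.N_eq
  have hmn := hq.len_le_two
  have hn := hq.n_le
  have hmB := hq.m_le
  have h8 := hq.eight_le
  obtain ⟨h1, h2, h3, h4, h5, h6, h7, h8, h9, h10⟩ := h
  have hs := h1.holds
  have hb := h1.bdd
  have hS : 20 * q.N < q.space := by have := hq.len_pos; unfold space; omega
  have hlen : q.space ≤ q.bound := hq.space_le_bound
  have y1 : 4 * q.N * s.var .yb ≤ 4 * q.N * 1 := Nat.mul_le_mul_left _ h9
  have y2 : 2 * q.N * s.var .yb ≤ 2 * q.N * 1 := Nat.mul_le_mul_left _ h9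
  have y3 : 2 * q.N * (1 - s.var .yb) ≤ 2 * q.N * 1 := Nat.mul_le_mul_left _ (by omega)
  set i := s.var .a0 with hid
  have hM := matchSum_le (q := q) G G i
  have hMX := matchSum_le (q := q) X X i
  have hbig : q.p * q.m + s.var .lo * q.p + s.var .cnt * q.p ≤ q.bound := by
    have := hq.le_bound (i := 2) (j := 1) (k := 0) (by norm_num) (by norm_num) (by norm_num)
    have e1 : s.var .lo * q.p ≤ q.B * q.p := Nat.mul_le_mul_right _ h7
    have e2 : s.var .cnt * q.p ≤ q.B * q.p := Nat.mul_le_mul_right _ h8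
    have e3 : (q.m + q.B + q.B) * q.p ≤ (q.N * q.N) * q.p := by
      refine Nat.mul_le_mul_right _ ?_
      have := Nat.mul_le_mul_right q.N hq.eight_le
      omega
    have e4 : (q.m + q.B + q.B) * q.p = q.p * q.m + q.B * q.p + q.B * q.p := by ring
    have e5 : q.N ^ 2 * q.p ^ 1 * q.D ^ 0 = (q.N * q.N) * q.p := by ring
    omega
  have hT : ∀ l, l ≤ q.B → l * (q.p * (9 * q.d + 13) + 11) + 2 ≤
      q.B * (q.p * (9 * q.d + 13) + 11) + 2 := fun l hl =>
    Nat.add_le_add_right (Nat.mul_le_mul_right _ hl) _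
  refine (WP.seq (T := 1) (T' := 1 + ((q.B * (q.p * (9 * q.d + 13) + 11) + 2) +
    ((q.B * (q.p * (9 * q.d + 13) + 11) + 2) + 1))) ?_).mono (by omega) fun _ h => h
  refine WP.assign (by simp [hs.N]; omega) (by simpa using hb.mem _) ?_
  refine WP.seq (WP.assign (by simp) (by simp) ?_)
  set s₁ := (s.set .pl _).set .mi _ with hs₁
  have m1 : s₁.mem = s.mem := rfl
  have v1 : s₁.var .pl = q.matchSum G G i := by
    simp [hs₁, hs.N]; exact h6 i hi
  have v2 : s₁.var .mi = 0 := by simp [hs₁]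
  have v3 : ∀ x, x ≠ .pl → x ≠ .mi → s₁.var x = s.var x := fun x h1 h2 => by simp [hs₁, h1, h2]
  have b1 : s₁.Bdd q.bound := (hb.set _ (by simpa using hb.mem _)).set _ (by simp)
  clear_value s₁
  have hs1 : q.Holds s₁ := hs.congr fun x hx => v3 x (by rintro rfl; simp [params] at hx)
    (by rintro rfl; simp [params] at hx)
  have w0 : ∀ x ∈ ([.yb, .lo, .cnt, .a0] ++ params), x ∉ (logProg (6 * Vr.N + 2 * Vr.N * Vr.yb) Vr.lo).writes := by decide
  have w0' : ∀ x ∈ ([.yb, .lo, .cnt, .a0] ++ params), x ∉ (logProg (6 * Vr.N + 2 * Vr.N * (1 - Vr.yb)) Vr.cnt).writes := by decide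
  refine WP.seq (((log_spec (X := X) (G := G) (b := 6 * q.N + 2 * q.N * s.var .yb) (l := s.var .lo)
    hq hs1 b1 (by simpa [m1] using h2) (by simpa [m1] using h3)
    (by rw [v3 _ (by simp) (by simp)]; exact hi) (fun s' hs' => ?_) (fun s' hs' => ?_) (by omega)
    (by rw [v1]; omega) (by rw [v2]; omega)).frame.mono (hT _ h7)) fun s₂ h => ?_)
  · rw [Expr.eval_add, Expr.eval_mul, Expr.eval_mul, Expr.eval_mul]
    simp [hs' .N (w0 _ (by decide)), hs' .yb (w0 _ (by decide)), hs1.N, v3]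
  · simp [hs' .lo (w0 _ (by decide)), v3]
  obtain ⟨⟨c1, c2⟩, c3, c4, c5⟩ := h
  have m2 : s₂.mem = s.mem := (c4 rfl).trans m1
  rw [v3 .a0 (by simp) (by simp), ← hid, m1, v1] at c1
  rw [v3 .a0 (by simp) (by simp), ← hid, m1, v2, zero_add] at c2
  have v4 : ∀ x ∈ ([.yb, .lo, .cnt, .a0] ++ params), s₂.var x = s.var x := by
    intro x hx
    rw [c3 x (w0 x hx), v3 x (by rintro rfl; revert hx; decide) (by rintro rfl; revert hx; decide)]
  have hs2 : q.Holds s₂ := hs.congr fun x hx => v4 x (List.mem_append_right _ hx)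
  have L2 : q.logSum X G i s.mem (6 * q.N + 2 * q.N * s.var .yb) 2 (s.var .lo) ≤ _ := logSum_le hq _ _ _ _ _
  have L1 : q.logSum X G i s.mem (6 * q.N + 2 * q.N * s.var .yb) 1 (s.var .lo) ≤ _ := logSum_le hq _ _ _ _ _
  refine WP.seq (((log_spec (X := X) (G := G) (b := 6 * q.N + 2 * q.N * (1 - s.var .yb))
    (l := s.var .cnt) hq hs2 (c5 b1) (by simpa [m2] using h2) (by simpa [m2] using h3)
    (by rw [v4 _ (by decide)]; exact hi) (fun s' hs' => ?_) (fun s' hs' => ?_) (by omega)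
    (by rw [c1]; omega) (by rw [c2]; omega)).frame.mono (hT _ h8)) fun s₃ h => ?_)
  · rw [Expr.eval_add, Expr.eval_mul, Expr.eval_mul, Expr.eval_mul, Expr.eval_sub]
    simp [hs' .N (w0' _ (by decide)), hs' .yb (w0' _ (by decide)), hs2.N, v4 .yb (by decide)]
  · simp [hs' .cnt (w0' _ (by decide)), v4 .cnt (by decide)]
  obtain ⟨⟨d1, d2⟩, d3, -, -⟩ := h
  rw [v4 .a0 (by decide), ← hid, m2, c1] at d1
  rw [v4 .a0 (by decide), ← hid, m2, c2] at d2
  have M2 : q.logSum X G i s.mem (6 * q.N + 2 * q.N * (1 - s.var .yb)) 2 (s.var .cnt) ≤ _ :=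
    logSum_le hq _ _ _ _ _
  have M1 : q.logSum X G i s.mem (6 * q.N + 2 * q.N * (1 - s.var .yb)) 1 (s.var .cnt) ≤ _ :=
    logSum_le hq _ _ _ _ _
  -- The two log identities together say that `pl - mi` is the number of agreements of the current
  -- strings; it is at most `p * m`, so the subtraction in the answer is not truncated.
  have S1 := h4.sums X G i
  have S2 := h5.sums X G i
  have v5 : ∀ x ∈ ([.yb, .lo, .cnt, .a0] ++ params), s₃.var x = s.var x := fun x hx => by
    rw [d3 x (w0' x hx), v4 x hx]
  have hval : ((Vr.p * Vr.m + Vr.mi - Vr.pl) / (Vr.p - Vr.d) : Expr).eval s₃ =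
      (q.p * q.m - q.matchSum X X i) / (q.p - q.d) := by
    have e : q.p * q.m + s₃.var .mi - s₃.var .pl = q.p * q.m - q.matchSum X X i := by omega
    rw [← e]
    simp [v5 .p (by decide), v5 .m (by decide), v5 .d (by decide), hs.p, hs.m, hs.d]
  refine WP.assign (by simp) ?_ ?_
  · rw [hval]; exact (Nat.div_le_self _ _).trans (by omega)
  · rw [hval]; simp

/-- Running the background computation for `M` steps. -/
theorem run_spec (hq : q.Good) (htw : GoodTwiddles q.N q.Z tc ts ((1 / q.N : ℝ) ^ 12))
    (h : q.Background tc ts F s) {E : Expr} {M : ℕ} (h0 : s.var .q = 0)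
    (hE : ∀ s' : St, s'.var .Q = s.var .Q → s'.var .B = s.var .B →
      E.eval s' = M ∧ E.ok q.bound q.space s') (hM : s.var .g + M ≤ q.p * q.p * q.len) :
    WP q.bound q.space (.while (Expr.lt Vr.q E) (.seq stepProg (.assign .q (Vr.q + 1)))) s
      (M * (3 * q.d + 18) + 1) fun s' => q.Background tc ts F s' ∧
      s'.var .g = s.var .g + M ∧ ∀ l < 20 * q.N, ¬ (q.resultAddr (s.var .yb) ≤ l ∧
        l < q.resultAddr (s.var .yb) + 4 * q.N) → s'.mem l = s.mem l := by
  have hMb := hM.trans hq.total_le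
  refine (WP.while_count (T := 3 * q.d + 16 + 1) (I := fun k s' => (q.Background tc ts F s' ∧
      s'.var .g = s.var .g + k ∧ ∀ l < 20 * q.N, ¬ (q.resultAddr (s.var .yb) ≤ l ∧
        l < q.resultAddr (s.var .yb) + 4 * q.N) → s'.mem l = s.mem l) ∧ s'.var .q = k ∧
      s'.var .Q = s.var .Q ∧ s'.var .B = s.var .B ∧ s'.var .yb = s.var .yb) M ?_ ?_ ?_).mono
      (le_of_eq (by ring)) fun s' h => h.1
  · exact ⟨⟨h, rfl, fun _ _ _ => rfl⟩, h0, rfl, rfl, rfl⟩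
  · rintro k s₀ hk ⟨⟨a1, a2, a3⟩, a4, a5, a6, a7⟩
    obtain ⟨e1, e2⟩ := hE s₀ a5 a6
    refine ⟨by simp [e2], by simp [e1, a4, hk], WP.seq ?_⟩
    refine (step_spec hq htw a1 (by omega)).frame.mono le_rfl fun s₁ h => ?_
    obtain ⟨⟨b1, b2, b3⟩, b4, -, b5⟩ := h
    have f1 := b4 .q (by decide)
    have f2 := b4 .Q (by decide)
    have f3 := b4 .B (by decide)
    have f4 := b4 .yb (by decide)
    refine WP.assign (by simp) (by simp [f1, a4]; omega) ⟨⟨?_, ?_, fun l l1 l2 => ?_⟩, ?_⟩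
    · refine b1.congr (fun x hx => ?_) (fun _ _ => rfl) (b1.bdd.set _ (by simp [f1, a4]; omega))
        hq.len_le_two
      rw [St.set_var, if_neg (by rintro rfl; revert hx; decide)]
    · simp [b2, a2, add_assoc]
    · rw [a7] at b3
      rw [St.set_mem, b3 l l1 l2, a3 l l1 l2]
    · simp [f1, f2, f3, f4, a4, a5, a6, a7]
  · rintro s' ⟨-, a4, a5, a6, -⟩
    obtain ⟨e1, e2⟩ := hE s' a5 a6
    simp [e1, e2, a4]

/-- Replaying a log. -/
theorem replay_spec {A B : ℕ → ℕ} {dst base len : Expr} {a b l : ℕ} (hb : s.Bdd q.bound)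
    (hdst : ∀ s' : St, (∀ x, x ≠ .k → x ≠ .i → s'.var x = s.var x) →
      dst.eval s' = a ∧ dst.ok q.bound q.space s')
    (hbase : ∀ s' : St, (∀ x, x ≠ .k → x ≠ .i → s'.var x = s.var x) →
      base.eval s' = b ∧ base.ok q.bound q.space s')
    (hlen : ∀ s' : St, (∀ x, x ≠ .k → x ≠ .i → s'.var x = s.var x) →
      len.eval s' = l ∧ len.ok q.bound q.space s')
    (ha : a + (q.m + q.n) ≤ b ∨ b + 3 * l ≤ a) (ha' : a + (q.m + q.n) ≤ q.space)
    (hb' : b + 3 * l ≤ q.space) (hSb : q.space ≤ q.bound) (hlog : q.IsLog b l s.mem A B)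
    (hA : ∀ j < q.m + q.n, s.mem (a + j) = A j) :
    WP q.bound q.space (replayProg dst base len) s (4 * l + 2) fun s' =>
      (∀ j < q.m + q.n, s'.mem (a + j) = B j) ∧
      (∀ j, ¬ (a ≤ j ∧ j < a + (q.m + q.n)) → s'.mem j = s.mem j) := by
  obtain ⟨Y, rfl, rfl, hY⟩ := hlog
  refine (WP.seq (T := 1) (T' := l * (3 + 1) + 1) ?_).mono (by omega) fun _ h => h
  refine WP.assign (by simp) (by simp) ?_
  refine (WP.while_count (I := fun k s' => s'.var .k = k ∧
    (∀ j < q.m + q.n, s'.mem (a + j) = Y k j) ∧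
    (∀ j, ¬ (a ≤ j ∧ j < a + (q.m + q.n)) → s'.mem j = s.mem j) ∧ s'.Bdd q.bound ∧
    ∀ x, x ≠ .k → x ≠ .i → s'.var x = s.var x) l ?_ ?_ ?_).mono le_rfl fun s' h => ⟨h.2.1, h.2.2.1⟩
  · exact ⟨by simp, hA, fun _ _ => rfl, hb.set _ (by simp), fun x h1 h2 => by simp [h1]⟩
  · rintro k s₀ hk ⟨a1, a2, a3, a4, a5⟩
    obtain ⟨l1, l2⟩ := hlen s₀ a5
    refine ⟨by simp [l2], by simp [l1, a1, hk], ?_⟩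
    obtain ⟨b1, b2⟩ := hbase s₀ a5
    refine (WP.seq (T := 1) (T' := 1 + 1) ?_).mono (by omega) fun _ h => h
    refine WP.assign (by simp [b2]) (by simp [b1, a1]; omega) ?_
    obtain ⟨y1, y2, y3⟩ := hY k hk
    set s₁ := s₀.set .i _ with hs₁
    have e1 : s₁.var .i = b + 3 * k := by simp [hs₁, b1, a1]
    have e2 : s₁.var .k = k := by simp [hs₁, a1]
    have e3 : ∀ x, x ≠ .k → x ≠ .i → s₁.var x = s.var x := fun x h1 h2 => by
      rw [hs₁, St.set_var, if_neg h2, a5 x h1 h2]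
    have e4 : s₁.mem = s₀.mem := rfl
    have e5 : s₁.Bdd q.bound := a4.set _ (by simp [b1, a1]; omega)
    clear_value s₁
    obtain ⟨d1, d2⟩ := hdst s₁ e3
    have m0 := a3 (b + 3 * k) (by omega)
    have m2 := a3 (b + 3 * k + 2) (by omega)
    have ev1 : (dst + .load Vr.i : Expr).eval s₁ = a + s.mem (b + 3 * k) := by
      simp [d1, e1, e4, m0]
    have ev2 : (Expr.load (Vr.i + 2)).eval s₁ = s.mem (b + 3 * k + 2) := by
      simp [e1, e4, m2]
    have hv : s.mem (b + 3 * k + 2) ≤ q.bound := hb.mem _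
    refine WP.seq (WP.store (by simp [d2, e1]; omega) (by simp [e1]; omega) (by rw [ev1]; omega)
      (by rw [ev2]; exact hv) ?_)
    rw [ev1, ev2]
    refine WP.assign (by simp) (by simp [e2]; omega) ⟨by simp [e2], fun j hj => ?_, fun j hj => ?_,
      (e5.put _ hv).set _ (by simp [e2]; omega), fun x h1 h2 => by simp [h1, e3 x h1 h2]⟩
    · simp only [St.set_mem, St.put_mem, y3, Function.update_apply, e4]
      by_cases hje : j = s.mem (b + 3 * k)
      · simp [hje]
      · rw [if_neg hje, if_neg (by omega), a2 j hj]
    · rw [St.set_mem, St.put_mem, Function.update_of_ne (by omega), e4]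
      exact a3 j hj
  · rintro s' ⟨a1, -, -, -, a6⟩
    obtain ⟨l1, l2⟩ := hlen s' a6
    simp [l1, l2, a1]

/-! ### Epochs: logging, the end of an epoch, and updates -/

/-- The state of the data structure between two operations. -/
structure Inv (q : Cfg) (tc ts X : ℕ → ℕ) (s : St) : Prop where
  core : ∃ F G, q.Core tc ts X F G s
  cnt_lt : s.var .cnt < q.B
  clock : s.var .g = s.var .cnt * q.stride

/-- The part of an update before the background computation. -/
def appendProg : Prog :=
  .seq (.assign .i (6 * Vr.N + 2 * Vr.N * (1 - Vr.yb) + 3 * Vr.cnt)) <|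
  .seq (.store Vr.i Vr.a0) <| .seq (.store (Vr.i + 1) (.load Vr.a0)) <|
  .seq (.store (Vr.i + 2) Vr.a1) <| .seq (.store Vr.a0 Vr.a1) (.assign .cnt (Vr.cnt + 1))

/-- The entry records position, old letter and new letter before the letter is overwritten. The log
lies above the current string, so its three stores do not disturb it, and a log of `B` entries fits
because `3 * B ≤ 2 * N`. -/
theorem append_spec (hq : q.Good) (h : q.Core tc ts X F G s) (hc : s.var .cnt < q.B)
    (ha : s.var .a0 < q.m + q.n) :
    WP q.bound q.space appendProg s 6 fun s' =>
      q.Core tc ts (Function.update X (s.var .a0) (s.var .a1)) F G s' ∧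
      s'.var .cnt = s.var .cnt + 1 := by
  have hB := hq.two_le_B
  have hBB := Nat.mul_le_mul_right q.B hB
  have hN := hq.N_eq
  have hmn := hq.len_le_two
  obtain ⟨h1, h2, h3, h4, h5, h6, h7, h8, h9, h10⟩ := h
  have hs := h1.holds
  have hb := h1.bdd
  have hS : 20 * q.N < q.space := by have := hq.len_pos; unfold space; omega
  have hlen : q.space ≤ q.bound := hq.space_le_bound
  have y1 : 4 * q.N * s.var .yb ≤ 4 * q.N * 1 := Nat.mul_le_mul_left _ h9
  have y2 : 2 * q.N * s.var .yb + 2 * q.N * (1 - s.var .yb) = 2 * q.N := by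
    rw [← mul_add, Nat.add_sub_cancel' h9, mul_one]
  have y3 : 2 * q.N * s.var .yb = 0 ∨ 2 * q.N * s.var .yb = 2 * q.N := by
    interval_cases s.var .yb <;> simp
  set A := 6 * q.N + 2 * q.N * (1 - s.var .yb) + 3 * s.var .cnt with hA
  set pos := s.var .a0 with hpos
  have hAd : ∀ k < 3, A + k ≠ pos := by omega
  have e0 : (6 * Vr.N + 2 * Vr.N * (1 - Vr.yb) + 3 * Vr.cnt : Expr).eval s = A := by
    rw [Expr.eval_add, Expr.eval_add, Expr.eval_mul, Expr.eval_mul, Expr.eval_mul, Expr.eval_sub]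
    simp [hs.N, hA]
  refine (WP.seq (T := 1) (T' := 1 + (1 + (1 + (1 + 1)))) ?_).mono (by omega) fun _ h => h
  refine WP.assign (by simp) (by rw [e0]; omega) ?_
  rw [e0]
  refine WP.seq (WP.store (by simp) (by simp) (by simp; omega) (by simpa using hb.var _) ?_)
  refine WP.seq (WP.store (by simp) (by simp; omega) (by simp; omega) ?_ ?_)
  · simp only [Expr.eval_load, Expr.eval_var, St.put_var, St.set_var, St.put_mem, St.set_mem,
      reduceCtorEq, if_false, if_true, Function.update_apply]
    split_ifs
    exacts [hb.var _, hb.mem _]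
  refine WP.seq (WP.store (by simp) (by simp) (by simp; omega) (by simpa using hb.var _) ?_)
  refine WP.seq (WP.store (by simp) (by simp) (by simp; omega) (by simpa using hb.var _) ?_)
  refine WP.assign (by simp) (by simp; omega) ?_
  simp only [Expr.eval_var, Expr.eval_add, Expr.eval_ofNat, Expr.eval_load, St.set_var, St.put_var,
    St.put_mem, St.set_mem, reduceCtorEq, if_false, if_true, ← hpos, and_true]
  rw [Function.update_of_ne (by have := hAd 0; omega)]
  set s' := St.set _ .cnt _ with hs'
  have hm : s'.mem = Function.update (Function.update (Function.update (Function.update s.mem A pos)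
    (A + 1) (s.mem pos)) (A + 2) (s.var .a1)) pos (s.var .a1) := rfl
  have hmo : ∀ l, l ≠ pos → ¬ (A ≤ l ∧ l < A + 3) → s'.mem l = s.mem l := by
    intro l l1 l2
    rw [hm, Function.update_of_ne l1, Function.update_of_ne (by omega),
      Function.update_of_ne (by omega), Function.update_of_ne (by omega)]
  have hv : ∀ x, x ≠ .i → x ≠ .cnt → s'.var x = s.var x := fun x x1 x2 => by simp [hs', x1, x2]
  have hcnt : s'.var .cnt = s.var .cnt + 1 := by simp [hs']
  have hb' : s'.Bdd q.bound := ((((((hb.set _ (by omega)).put _ (hb.var _)).put _ (hb.mem _)).put _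
    (hb.var _)).put _ (hb.var _)).set _ (by omega))
  clear_value s'
  have m0 : s'.mem A = pos := by
    rw [hm, Function.update_of_ne (by have := hAd 0; omega), Function.update_of_ne (by omega),
      Function.update_of_ne (by omega), Function.update_self]
  have m1 : s'.mem (A + 1) = s.mem pos := by
    rw [hm, Function.update_of_ne (by have := hAd 1; omega), Function.update_of_ne (by omega),
      Function.update_self]
  have m2 : s'.mem (A + 2) = s.var .a1 := by
    rw [hm, Function.update_of_ne (by have := hAd 2; omega), Function.update_self]
  have vy := hv .yb (by simp) (by simp)
  have vl := hv .lo (by simp) (by simp)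
  have vQ := hv .Q (by simp) (by simp)
  refine ⟨h1.congr (fun x hx => hv x (by rintro rfl; revert hx; decide)
    (by rintro rfl; revert hx; decide)) (fun l hl => hmo l (by omega) (by omega)) hb' hmn,
    fun j hj => ?_, fun j hj => ?_, ?_, ?_, fun i hi => ?_, ?_, ?_, ?_, ?_⟩
  · by_cases hj' : j = pos
    · rw [hj', hm, Function.update_self, Function.update_self]
    · rw [hmo j hj' (by omega), Function.update_of_ne hj', h2 j hj]
  · rw [hmo _ (by omega) (by omega), h3 j hj]
  · rw [vy, vl]
    refine h4.congr fun l l1 l2 => hmo l (by omega) ?_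
    omega
  · rw [vy, hcnt]
    have := (h5.congr (mem' := s'.mem) fun l l1 l2 => hmo l (by omega) (by omega)).append
      (by rw [← hA, m0]; exact ha) (by rw [← hA, m1, m0, h2 _ ha])
    rwa [← hA, m0, m2] at this
  · rw [vy, hmo _ (by omega) (by omega)]; exact h6 i hi
  · rw [vl]; exact h7
  · rw [hcnt]; exact hc
  · rw [vy]; exact h9
  · rw [vQ]; exact h10

/-- The triple `(X, F, G)` becomes `(X, X, F)`. Replaying the older log turns the copy of `G` into
`F`, replaying the newer one turns the frozen copy into `X`; this takes `O(B)` steps, where copying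
would take linear time. Flipping `yb` makes the finished counts current and the newer log the older
one. -/
theorem flush_spec (hq : q.Good) (h : q.Core tc ts X F G s) (hc : s.var .cnt = q.B)
    (hg : s.var .g = q.p * q.p * q.len) :
    WP q.bound q.space flushProg s (8 * q.B + 8) (q.Inv tc ts X) := by
  have hB := hq.two_le_B
  have hBB := Nat.mul_le_mul_right q.B hB
  have hN := hq.N_eq
  have hmn := hq.len_le_two
  have hn := hq.n_le
  have hmB := hq.m_le
  have hp := hq.p_pos
  have hCore := h
  obtain ⟨h1, h2, h3, h4, h5, h6, h7, h8, h9, h10⟩ := h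
  have hs := h1.holds
  have hb := h1.bdd
  have hS : 20 * q.N < q.space := by have := hq.len_pos; unfold space; omega
  have hlen : q.space ≤ q.bound := hq.space_le_bound
  have y1 : 4 * q.N * s.var .yb ≤ 4 * q.N * 1 := Nat.mul_le_mul_left _ h9
  have y2 : 2 * q.N * s.var .yb ≤ 2 * q.N * 1 := Nat.mul_le_mul_left _ h9
  have y3 : 2 * q.N * (1 - s.var .yb) ≤ 2 * q.N * 1 := Nat.mul_le_mul_left _ (by omega)
  refine (WP.seq (T := 4 * q.B + 2) (T' := (4 * q.B + 2) + (1 + (1 + (1 + 1)))) ?_).mono (by omega)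
    fun _ h => h
  refine ((replay_spec (a := 4 * q.N) (b := 6 * q.N + 2 * q.N * s.var .yb) (l := s.var .lo) hb
    (fun s' hs' => ?_) (fun s' hs' => ?_) (fun s' hs' => ?_) (by omega) (by omega) (by omega) hlen h4
    h3).frame.mono (by omega) fun s₁ h => ?_)
  · simp [hs' .N (by simp) (by simp), hs.N]
  · rw [Expr.eval_add, Expr.eval_mul, Expr.eval_mul, Expr.eval_mul]
    simp [hs' .N (by simp) (by simp), hs' .yb (by simp) (by simp), hs.N]
  · simp [hs' .lo (by simp) (by simp)]
  obtain ⟨⟨a1, a2⟩, a3, -, a4⟩ := h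
  have a3 : ∀ x, x ≠ .k → x ≠ .i → s₁.var x = s.var x := fun x h1 h2 => a3 x (by
    simp [replayProg, Prog.writes, h1, h2])
  refine WP.seq ((replay_spec (A := F) (B := X) (a := 2 * q.N)
    (b := 6 * q.N + 2 * q.N * (1 - s.var .yb)) (l := s.var .cnt) (a4 hb)
    (fun s' hs' => ?_) (fun s' hs' => ?_) (fun s' hs' => ?_) (by omega) (by omega) (by omega) hlen
    (h5.congr fun l _ _ => a2 l (by omega))
    fun j hj => ?_).frame.mono (by omega) fun s₂ h => ?_)
  · simp [hs' .N (by simp) (by simp), a3, hs.N]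
  · rw [Expr.eval_add, Expr.eval_mul, Expr.eval_mul, Expr.eval_mul, Expr.eval_sub]
    simp [hs' .N (by simp) (by simp), hs' .yb (by simp) (by simp), a3, hs.N]
  · simp [hs' .cnt (by simp) (by simp), a3]
  · rw [a2 _ (by omega)]; exact h1.frozen j hj
  obtain ⟨⟨b1, b2⟩, b3, -, b4⟩ := h
  have b3 : ∀ x, x ≠ .k → x ≠ .i → s₂.var x = s.var x := fun x h1 h2 => by
    rw [b3 x (by simp [replayProg, Prog.writes, h1, h2]), a3 x h1 h2]
  have e1 := b3 .yb (by simp) (by simp)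
  have e2 := b3 .cnt (by simp) (by simp)
  have hb2 := b4 (a4 hb)
  have low : ∀ l, ¬ (2 * q.N ≤ l ∧ l < 6 * q.N) → s₂.mem l = s.mem l := fun l hl => by
    rw [b2 _ (by omega), a2 _ (by omega)]
  refine WP.seq (WP.assign (by simp) (by simp [e1]; omega) ?_)
  refine WP.seq (WP.assign (by simp) (by simp [e2]; omega) ?_)
  refine WP.seq (WP.assign (by simp) (by simp) ?_)
  refine WP.assign (by simp) (by simp) ?_
  set s' := St.set _ .g _ with hs'
  have v1 : s'.var .yb = 1 - s.var .yb := by simp [hs', e1]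
  have v2 : s'.var .lo = s.var .cnt := by simp [hs', e2]
  have v3 : s'.var .cnt = 0 := by simp [hs']
  have v4 : s'.var .g = 0 := by simp [hs']
  have v5 : ∀ x ∈ (.Q :: params), s'.var x = s.var x := by
    intro x hx
    rw [hs', St.set_var, St.set_var, St.set_var, St.set_var, if_neg, if_neg, if_neg, if_neg, b3]
    all_goals rintro rfl; revert hx; decide
  have m' : s'.mem = s₂.mem := rfl
  have hb' : s'.Bdd q.bound := (((hb2.set _ (by simp [e1]; omega)).set _ (by simp [e2]; omega)).set _
    (by simp)).set _ (by simp)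
  clear_value s'
  have e3 : 1 - (1 - s.var .yb) = s.var .yb := by omega
  refine ⟨⟨X, F, ⟨hs.congr fun x hx => v5 x (by simp [hx]), fun j hj => ?_, fun j hj => ?_, ?_, hb'⟩,
    fun j hj => ?_, fun j hj => ?_, ?_, ?_, fun i hi => ?_, ?_, ?_, ?_, ?_⟩, ?_, ?_⟩
  · rw [m', low _ (by omega), low _ (by omega)]; exact h1.twiddles j hj
  · rw [m']; exact b1 j hj
  · rw [v4, Nat.zero_div, Nat.zero_mod]; exact Progress.start _ _
  · rw [m', low _ (by omega)]; exact h2 j hj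
  · rw [m', b2 _ (by omega)]; exact a1 j hj
  · rw [v1, v2, m']
    exact h5.congr fun l _ _ => low l (by omega)
  · rw [v3]
    exact ⟨fun _ => X, rfl, rfl, fun k hk => absurd hk (Nat.not_lt_zero k)⟩
  -- The clock stands at the end of the last hash pair, so the entries still to be changed by a
  -- fictitious pair `p ^ 2` hold the full sums.
  · have hP := h1.progress
    rw [hg, Nat.mul_div_cancel _ hq.len_pos, Nat.mul_mod_left] at hP
    have := hP.todo i 0 (by omega) (by norm_num) (Nat.zero_le _) (by positivity)
    rw [sum_corrCount hq F hi] at this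
    rw [v1, m', low _ (by omega), ← this, resultAddr, add_zero]
  · rw [v2, hc]
  · rw [v3]; exact Nat.zero_le _
  · rw [v1]; exact Nat.sub_le _ _
  · rw [v5 _ (by simp)]; exact h10
  · rw [v3]; omega
  · rw [v3, v4, Nat.zero_mul]

/-- Correctness of the updates. -/
theorem update_spec (hq : q.Good) (htw : GoodTwiddles q.N q.Z tc ts ((1 / q.N : ℝ) ^ 12))
    (h : q.Inv tc ts X s) (ha : s.var .a0 < q.m + q.n) :
    WP q.bound q.space updateProg s (q.stride * (3 * q.d + 18) + 8 * q.B + 17)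
      (q.Inv tc ts (Function.update X (s.var .a0) (s.var .a1))) := by
  obtain ⟨⟨F, G, hcore⟩, hc, hg⟩ := h
  have hkey := append_spec hq hcore hc ha
  set X' := Function.update X (s.var .a0) (s.var .a1) with hX'
  -- Sequencing nests to the right, so `appendProg` is not literally a part of `updateProg`; its
  -- execution is taken apart and continued with the rest.
  have happ : ∀ (p : Prog) (T : ℕ) (R : St → Prop),
      (∀ s₁, q.Core tc ts X' F G s₁ → s₁.var .cnt = s.var .cnt + 1 → s₁.var .g = s.var .g →
        WP q.bound q.space p s₁ T R) →
      WP q.bound q.space (.seq (.assign .i (6 * Vr.N + 2 * Vr.N * (1 - Vr.yb) + 3 * Vr.cnt)) <|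
        .seq (.store Vr.i Vr.a0) <| .seq (.store (Vr.i + 1) (.load Vr.a0)) <|
        .seq (.store (Vr.i + 2) Vr.a1) <| .seq (.store Vr.a0 Vr.a1) <|
        .seq (.assign .cnt (Vr.cnt + 1)) p) s (6 + T) R := by
    intro p T R hp
    obtain ⟨s₁, t, a1, a2, ⟨a3, a4⟩, a5, -⟩ := hkey.frame
    obtain ⟨s₂, t', b1, b2, b3⟩ := hp s₁ a3 a4 (a5 _ (by decide))
    cases a1 with
    | seq c1 d1 => cases d1 with
      | seq c2 d2 => cases d2 with
        | seq c3 d3 => cases d3 with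
          | seq c4 d4 => cases d4 with
            | seq c5 d5 =>
              exact ⟨s₂, _, .seq c1 (.seq c2 (.seq c3 (.seq c4 (.seq c5 (.seq d5 b1))))), by omega, b3⟩
  refine (happ _ (1 + ((q.stride * (3 * q.d + 18) + 1) + (8 * q.B + 8 + 1))) _ ?_).mono (by omega)
    fun _ h => h
  intro s₁ h1 h2 h3
  have hmul : (s.var .cnt + 1) * q.stride ≤ q.p * q.p * q.len := by
    rw [← hq.B_mul_stride]; exact Nat.mul_le_mul_right _ hc
  rw [Nat.succ_mul] at hmul
  refine WP.seq (WP.assign (by simp) (by simp) ?_)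
  have h4 : q.Core tc ts X' F G (s₁.set .q 0) := h1.congr hq (fun x hx => by
    rw [St.set_var, if_neg (by rintro rfl; revert hx; decide)]) rfl
    (h1.background.bdd.set _ (Nat.zero_le _))
  refine WP.seq ((run_spec (E := Vr.Q) hq htw h4.background (by simp) (fun s' e1 e2 => ⟨?_, trivial⟩)
    (by simp [h3, hg, hmul])).frame.mono le_rfl fun s₂ h => ?_)
  · rw [Expr.eval_var, e1]; exact h4.stride_eq
  obtain ⟨⟨b1, b2, b3⟩, b4, -, -⟩ := h
  have h5 : q.Core tc ts X' F G s₂ := h4.step_mem hq b1 (fun x hx => b4 x (by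
    simp only [List.mem_cons, List.not_mem_nil, or_false] at hx
    rcases hx with rfl | rfl | rfl | rfl <;> decide)) b3
  have e1 : s₂.var .cnt = s.var .cnt + 1 := by rw [b4 _ (by decide)]; simp [h2]
  have e2 : s₂.var .g = (s.var .cnt + 1) * q.stride := by
    rw [b2, Nat.succ_mul, ← hg]; simp [h3]
  refine WP.ite (by simp) (fun h => ?_) (fun h => ?_)
  · have hcB : s₂.var .cnt = q.B := by simpa [h5.background.holds.B] using h
    refine flush_spec hq h5 hcB ?_
    rw [e2, ← e1, hcB, hq.B_mul_stride]
  · have hcB : s₂.var .cnt ≠ q.B := by simpa [h5.background.holds.B] using h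
    have := h5.cnt_le
    exact (WP.skip ⟨⟨F, G, h5⟩, by omega, by rw [e1, e2]⟩).mono (by omega) fun _ h => h

end Cfg

/-! ## Preprocessing -/

theorem Halts.assign {V S : ℕ} {s : St} {R : St → Prop} {e : Expr} {x : Vr} (hok : e.ok V S s)
    (hv : e.eval s ≤ V) (h : R (s.set x (e.eval s))) : Halts V S (.assign x e) s R :=
  (WP.assign hok hv h).halts

namespace Cfg
variable {q : Cfg} {tc ts : ℕ → ℕ} {X F G : ℕ → ℕ} {s s' : St}

/-- The parameters that preprocessing computes, for letters below `(m + 1) ^ a`. -/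
structure Initial (a : ℕ) (q : Cfg) : Prop where
  good : q.Good
  log_eq : ∃ k, q.B = 2 ^ k ∧ q.K = 2 * k + 1 ∧ ∀ j < k, 2 ^ j * 2 ^ j < q.m
  d_eq : q.d = a * q.K + 1
  e_pos : 1 ≤ q.e
  lt_p : 2 * (q.d + 1) * q.e < q.p
  p_min : ∀ r, r.Prime → 2 * (q.d + 1) * q.e < r → q.p ≤ r

/-- By `log_eq`, the doubling of `B` stops after exactly `k` rounds. -/
theorem size_spec {a : ℕ} (h : q.Initial a) (h0 : s.var .a0 = q.m)
    (h1 : s.var .a1 = q.n) :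
    Halts q.bound q.space (sizeProg a) s fun s' => s'.var .m = q.m ∧ s'.var .n = q.n ∧
      s'.var .B = q.B ∧ s'.var .N = q.N ∧ s'.var .K = q.K ∧ s'.var .D = q.D ∧ s'.var .d = q.d ∧
      s'.var .Z = q.Z := by
  obtain ⟨hq, ⟨k, hk, hK, hlt⟩, hd, -, -, -⟩ := h
  have hB := hq.two_le_B
  have hBB := Nat.mul_le_mul_right q.B hB
  have hN := hq.N_eq
  have hNb := hq.N_lt_bound
  have hKN := hq.K_lt
  have hm := hq.m_le
  have hn := hq.n_le
  have hkB : k < q.B := by rw [hk]; exact Nat.lt_two_pow_self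
  refine Halts.seq (Halts.assign (by simp) (by simp [h0]; omega) ?_)
  refine Halts.seq (Halts.assign (by simp) (by simp [h1]; omega) ?_)
  refine Halts.seq (Halts.assign (by simp) (by simp; omega) ?_)
  refine Halts.seq (Halts.assign (by simp) (by simp) ?_)
  refine Halts.seq ((WP.while_count (T := 2) (I := fun j s' => s'.var .B = 2 ^ j ∧ s'.var .K = j ∧
    s'.var .m = q.m ∧ s'.var .n = q.n) k ?_ ?_ ?_).halts.mono fun s₁ h => ?_)
  · simp [h0, h1]
  · rintro j s' hj ⟨a1, a2, a3, a4⟩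
    have hjk : 2 ^ (j + 1) ≤ q.B := by rw [hk]; exact Nat.pow_le_pow_right (by norm_num) hj
    rw [pow_succ] at hjk
    refine ⟨by simp, by simp [a1, a3, hlt j hj], WP.seq (T := 1) (T' := 1) ?_⟩
    refine WP.assign (by simp) (by simp [a1]; omega) ?_
    refine WP.assign (by simp) (by simp [a2]; omega) ?_
    simp [a1, a2, a3, a4, pow_succ]
  · rintro s' ⟨a1, a2, a3, a4⟩
    simp [a1, a3, ← hk, hm]
  obtain ⟨a1, a2, a3, a4⟩ := h
  rw [← hk] at a1
  have hDb := hq.D_le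
  have hZb : q.Z ≤ q.bound := by rw [hq.Z_eq]; exact hq.N_pow_le (by norm_num)
  have hdb : q.d ≤ q.bound := by have := hq.d_lt; have := hq.p_le; omega
  refine Halts.seq (Halts.assign (by simp) (by simp [a2]; omega) ?_)
  refine Halts.seq (Halts.assign (by simp) (by simp [a1]; omega) ?_)
  refine Halts.seq (Halts.assign (by simp) (by simp [a2, ← hK, ← hd]; omega) ?_)
  refine Halts.seq (Halts.assign ?_ ?_ ?_)
  · simp [a2, ← hK, ← hd, ← hq.D_eq, hDb]
  · simp [a2, ← hK, ← hd, ← hq.D_eq, hDb]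
  refine Halts.assign (Expr.ok_pow _ _ _ _ _ (by simp)) ?_ ?_
  · simp [a1, ← hN, ← hq.Z_eq, hZb]
  · simp [a1, a2, a3, a4, ← hN, ← hq.Z_eq, ← hK, ← hd, ← hq.D_eq]

/-- Trial division. The measure is lexicographic: either the candidate grows or, for the same
candidate, the divisor grows. A candidate that has a proper divisor is not `q.p`, so the search
never passes it. -/
theorem prime_spec {a : ℕ} (h : q.Initial a) (h0 : s.var .d = q.d) (h1 : s.var .e = q.e) :
    Halts q.bound q.space primeProg s fun s' => s'.var .p = q.p := by
  obtain ⟨hq, -, -, he, hlt, hmin⟩ := h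
  have hpb := hq.p_le
  set A := 2 * (q.d + 1) * q.e with hA
  have hA2 : 2 ≤ A := by rw [hA]; nlinarith
  refine Halts.seq (Halts.assign (by simp) (by simp [h0, h1, ← hA]; omega) ?_)
  refine Halts.seq (Halts.assign (by simp) (by simp; omega) ?_)
  refine (Halts.while_measure (I := fun s' => A < s'.var .p ∧ s'.var .p ≤ q.p ∧ 2 ≤ s'.var .q ∧
    s'.var .q ≤ s'.var .p ∧ ∀ r, 2 ≤ r → r < s'.var .q → ¬ r ∣ s'.var .p)
    (μ := fun s' => (q.p - s'.var .p) * (q.p + 1) + (q.p - s'.var .q)) ?_ ?_ ?_).mono fun s' h => ?_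
  · simp [h0, h1, ← hA]
    refine ⟨hlt, by omega, fun r h2 h3 => absurd h3 (by omega)⟩
  · intro s' _; simp
  · rintro s' ⟨a1, a2, a3, a4, a5⟩ hlt'
    have hqp : s'.var .q < s'.var .p := by
      by_contra hc
      exact hlt' (if_neg hc)
    refine (WP.ite (T := 2) (by simp) (fun h => ?_) (fun h => ?_)).halts
    · have hnd : ¬ s'.var .q ∣ s'.var .p := by
        rw [Nat.dvd_iff_mod_eq_zero]; simpa using h
      refine (WP.assign (by simp) (by simp; omega) ?_).mono (by omega) fun _ h => h
      simp only [Expr.eval_add, Expr.eval_var, Expr.eval_ofNat, St.set_var, reduceCtorEq, if_true,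
        if_false]
      refine ⟨⟨a1, a2, by omega, by omega, fun r r1 r2 => ?_⟩, by omega⟩
      rcases Nat.lt_succ_iff_lt_or_eq.mp r2 with h | rfl
      exacts [a5 r r1 h, hnd]
    · have hd : s'.var .q ∣ s'.var .p := by
        rw [Nat.dvd_iff_mod_eq_zero]; simpa using h
      have hne : s'.var .p ≠ q.p := by
        intro he
        rw [he] at hd
        rcases (Nat.dvd_prime hq.prime).mp hd with h | h <;> omega
      refine WP.seq (T := 1) (T' := 1) (WP.assign (by simp) (by simp; omega) ?_)
      refine WP.assign (by simp) (by simp; omega) ?_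
      simp only [Expr.eval_add, Expr.eval_var, Expr.eval_ofNat, St.set_var, reduceCtorEq, if_true,
        if_false]
      refine ⟨⟨by omega, by omega, le_rfl, by omega, fun r r1 r2 => absurd r2 (by omega)⟩, ?_⟩
      have e : q.p - s'.var .p = (q.p - (s'.var .p + 1)) + 1 := by omega
      rw [e, Nat.succ_mul]
      omega
  · obtain ⟨⟨a1, a2, a3, a4, a5⟩, h⟩ := h
    have hqp : s'.var .p ≤ s'.var .q := by
      by_contra hc
      exact one_ne_zero ((if_pos (show s'.var .q < s'.var .p by omega)).symm.trans h)
    have hpr : (s'.var .p).Prime := by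
      refine Nat.prime_def.mpr ⟨by omega, fun r hr => ?_⟩
      by_contra hc
      push Not at hc
      have hr0 : r ≠ 0 := by rintro rfl; simp at hr; omega
      have := Nat.le_of_dvd (by omega) hr
      exact a5 r (by omega) (by omega) hr
    have := hmin _ hpr a1
    omega

/-- A linear search is enough, since the time of preprocessing is not bounded. -/
theorem sqrt_spec {V S : ℕ} {r : Vr} (hr : r ≠ .xv) (hx : s.var .xv ≤ V) :
    Halts V S (sqrtProg r) s fun s' => s' = s.set r (Nat.sqrt (s.var .xv)) := by
  have hle : Nat.sqrt (s.var .xv) ≤ V := (Nat.sqrt_le_self _).trans hx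
  refine Halts.seq (Halts.assign (by simp) (by simp) ?_)
  refine (WP.while_count (T := 1) (I := fun k s' => s' = s.set r k) (Nat.sqrt (s.var .xv)) rfl
    ?_ ?_).halts
  · rintro k s' hk rfl
    have := Nat.le_sqrt.mp (show k + 1 ≤ Nat.sqrt (s.var .xv) from hk)
    refine ⟨by simp, by simp [hr.symm]; omega, WP.assign (by simp) (by simp; omega) ?_⟩
    ext y
    · simp only [St.set_var]; split_ifs <;> simp
    · rfl
  · rintro s' rfl
    have : ¬ (Nat.sqrt (s.var .xv) + 1 ≤ Nat.sqrt (s.var .xv)) := by omega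
    rw [Nat.le_sqrt] at this
    simp [hr.symm]
    omega

/-- The last entry of the cosine table. -/
def cosVal (q : Cfg) : ℕ := cosTab q.Z (q.K - 2)

/-- The sine that belongs to `cosVal`. -/
def sinVal (q : Cfg) : ℕ := Nat.sqrt (q.Z * q.Z - q.cosVal * q.cosVal)

/-- The twiddle factors that preprocessing computes. -/
def twiddle (q : Cfg) (j : ℕ) : ℕ × ℕ := twPair q.Z q.cosVal q.sinVal j

theorem Good.twiddles (hq : q.Good) :
    GoodTwiddles q.N q.Z (fun j => (q.twiddle j).1) (fun j => (q.twiddle j).2)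
      ((1 / q.N : ℝ) ^ 12) :=
  goodTwiddles_table hq.N_pow hq.eight_le hq.Z_eq rfl rfl

/-- The loop of `twiddleProg`. -/
theorem twiddle_loop_spec (hq : q.Good) (hk : s.var .k = 0) (hold : s.var .old = q.Z)
    (hnew : s.var .new = 0) (e1 : s.var .s = q.sinVal) (e2 : s.var .c = q.cosVal)
    (e3 : s.var .Z = q.Z) (e4 : s.var .N = q.N) :
    Halts q.bound q.space (.while (Expr.lt Vr.k (Vr.N / 4)) <|
      .seq (.store (18 * Vr.N + 2 * Vr.k) Vr.old) <| .seq (.store (18 * Vr.N + 2 * Vr.k + 1) Vr.new) <|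
      .seq (.assign .xv ((Vr.old * Vr.c - Vr.new * Vr.s) / Vr.Z)) <|
      .seq (.assign .new ((Vr.old * Vr.s + Vr.new * Vr.c) / Vr.Z)) <|
      .seq (.assign .old Vr.xv) (.assign .k (Vr.k + 1))) s fun s' =>
      q.HasTwiddles (fun j => (q.twiddle j).1) (fun j => (q.twiddle j).2) s'.mem ∧
      ∀ l < 18 * q.N, s'.mem l = s.mem l := by
  have hZ0 := hq.Z_pos
  have hK3 := hq.three_le_K
  have hKN := hq.K_lt
  have hNb := hq.N_lt_bound
  have hSb := hq.space_le_bound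
  have hS : 20 * q.N < q.space := by have := hq.len_pos; unfold space; omega
  have hZZ : 2 * (q.Z * q.Z) ≤ q.bound := by
    have := hq.N_pow_le (show 63 ≤ 100 by norm_num)
    have e : q.N ^ 63 = q.N * (q.Z * q.Z) := by rw [hq.Z_eq]; ring
    have := Nat.mul_le_mul_right (q.Z * q.Z) (show 2 ≤ q.N by have := hq.eight_le; omega)
    omega
  have hZle : q.Z ≤ q.Z * q.Z := Nat.le_mul_self _
  have hsin : q.sinVal ≤ q.Z := by
    unfold sinVal
    exact (Nat.sqrt_le_sqrt (Nat.sub_le _ _)).trans (Nat.sqrt_eq _).le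
  have hcos : q.cosVal ≤ q.Z := cosTab_le _ _
  refine (WP.while_count (T := 6) (I := fun k s' => s'.var .k = k ∧ s'.var .old = (q.twiddle k).1 ∧
    s'.var .new = (q.twiddle k).2 ∧ s'.var .s = q.sinVal ∧ s'.var .c = q.cosVal ∧ s'.var .Z = q.Z ∧
    s'.var .N = q.N ∧ (∀ j < k, s'.mem (18 * q.N + 2 * j) = (q.twiddle j).1 ∧
      s'.mem (18 * q.N + 2 * j + 1) = (q.twiddle j).2) ∧ ∀ l < 18 * q.N, s'.mem l = s.mem l)
    (q.N / 4) ?_ ?_ ?_).halts.mono fun s' h => ⟨h.2.2.2.2.2.2.2.1, h.2.2.2.2.2.2.2.2⟩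
  · simp [hk, hold, hnew, e1, e2, e3, e4, twiddle, twPair]
  · rintro k s' hk ⟨a1, a2, a3, a4, a5, a6, a7, a8, a9⟩
    have hb := hq.twiddles k hk
    have b1 : (q.twiddle k).1 ≤ 2 * q.Z := hb.1
    have b2 : (q.twiddle k).2 ≤ 2 * q.Z := hb.2.1
    have t1 : (q.twiddle (k + 1)).1 =
      ((q.twiddle k).1 * q.cosVal - (q.twiddle k).2 * q.sinVal) / q.Z := rfl
    have t2 : (q.twiddle (k + 1)).2 =
      ((q.twiddle k).1 * q.sinVal + (q.twiddle k).2 * q.cosVal) / q.Z := rfl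
    have hZ4 : 4 * q.Z ≤ q.bound := by
      have : 2 ≤ q.Z := by
        rw [hq.Z_eq]
        exact le_trans (show 2 ≤ q.N by have := hq.eight_le; omega) (Nat.le_self_pow (by norm_num) _)
      nlinarith
    have l1 : (q.twiddle (k + 1)).1 ≤ q.bound := by
      rw [t1]
      refine (Nat.div_le_of_le_mul (n := 2 * q.Z) ((Nat.sub_le _ _).trans ?_)).trans (by omega)
      exact (Nat.mul_le_mul b1 hcos).trans (le_of_eq (by ring))
    have l2 : (q.twiddle (k + 1)).2 ≤ q.bound := by
      rw [t2]
      refine (Nat.div_le_of_le_mul (n := 4 * q.Z) ?_).trans hZ4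
      calc _ ≤ 2 * q.Z * q.Z + 2 * q.Z * q.Z :=
            Nat.add_le_add (Nat.mul_le_mul b1 hsin) (Nat.mul_le_mul b2 hcos)
        _ = _ := by ring
    refine ⟨by simp, by simp [a1, a7, hk], ?_⟩
    refine WP.seq (T := 1) (T' := 1 + (1 + (1 + (1 + 1)))) (WP.store (by simp) (by simp)
      (by simp [a1, a7]; omega) (by simp [a2]; omega) ?_)
    refine WP.seq (WP.store (by simp) (by simp)
      (by simp [a1, a7]; omega) (by simp [a3]; omega) ?_)
    refine WP.seq (WP.assign (by simp) (by simpa [a2, a3, a4, a5, a6, ← t1] using l1) ?_)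
    refine WP.seq (WP.assign (by simp) (by simpa [a2, a3, a4, a5, a6, ← t2] using l2) ?_)
    refine WP.seq (WP.assign (by simp) (by simpa [a2, a3, a4, a5, a6, ← t1] using l1) ?_)
    refine WP.assign (by simp) (by simp [a1]; omega) ?_
    simp only [Expr.eval_add, Expr.eval_sub, Expr.eval_mul, Expr.eval_div, Expr.eval_var,
      Expr.eval_ofNat, St.set_var, St.put_var, St.set_mem, St.put_mem, reduceCtorEq, if_true, if_false,
      a1, a2, a3, a4, a5, a6, a7, ← t1, ← t2, true_and]
    refine ⟨fun j hj => ?_, fun l hl => ?_⟩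
    · by_cases hjk : j = k
      · subst hjk
        rw [Function.update_of_ne (by omega), Function.update_self, Function.update_self]
        exact ⟨rfl, rfl⟩
      · rw [Function.update_of_ne (by omega), Function.update_of_ne (by omega),
          Function.update_of_ne (by omega), Function.update_of_ne (by omega)]
        exact a8 j (by omega)
    · rw [Function.update_of_ne (by omega), Function.update_of_ne (by omega)]
      exact a9 l hl
  · rintro s' ⟨a1, -, -, -, -, -, a7, -⟩
    simp [a1, a7]

/-- The halving loop starts from `cos (π / 2) = 0` at `k = 2` and reaches the cosine of `2 π / N` at
`k = K`. -/
theorem twiddle_spec (hq : q.Good) (hZ : s.var .Z = q.Z) (hK : s.var .K = q.K)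
    (hN : s.var .N = q.N) :
    Halts q.bound q.space twiddleProg s fun s' =>
      q.HasTwiddles (fun j => (q.twiddle j).1) (fun j => (q.twiddle j).2) s'.mem ∧
      ∀ l < 18 * q.N, s'.mem l = s.mem l := by
  have hZ0 := hq.Z_pos
  have hK3 := hq.three_le_K
  have hKN := hq.K_lt
  have hNb := hq.N_lt_bound
  have hSb := hq.space_le_bound
  have hS : 20 * q.N < q.space := by have := hq.len_pos; unfold space; omega
  have hZZ : 2 * (q.Z * q.Z) ≤ q.bound := by
    have := hq.N_pow_le (show 63 ≤ 100 by norm_num)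
    have e : q.N ^ 63 = q.N * (q.Z * q.Z) := by rw [hq.Z_eq]; ring
    have := Nat.mul_le_mul_right (q.Z * q.Z) (show 2 ≤ q.N by have := hq.eight_le; omega)
    omega
  have hZle : q.Z ≤ q.Z * q.Z := Nat.le_mul_self _
  have hsin : q.sinVal ≤ q.Z := by
    unfold sinVal
    exact (Nat.sqrt_le_sqrt (Nat.sub_le _ _)).trans (Nat.sqrt_eq _).le
  have hcos : q.cosVal ≤ q.Z := cosTab_le _ _
  refine Halts.seq (Halts.assign (by simp) (by simp) ?_)
  refine Halts.seq (Halts.assign (by simp) (by simp; omega) ?_)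
  refine Halts.seq ((Halts.while_measure (I := fun s' => 2 ≤ s'.var .k ∧ s'.var .k ≤ q.K ∧
    s'.var .c = cosTab q.Z (s'.var .k - 2) ∧ s'.var .Z = q.Z ∧ s'.var .K = q.K ∧ s'.var .N = q.N ∧
    s'.mem = s.mem) (μ := fun s' => q.K - s'.var .k) ?_ ?_ ?_).mono fun s₁ h => ?_)
  · simp [hZ, hK, hN, cosTab]; omega
  · intro s' _; simp
  · rintro s' ⟨a1, a2, a3, a4, a5, a6, a7⟩ hlt
    have hlt : s'.var .k < q.K := by simpa [a5] using hlt
    have hc := cosTab_le q.Z (s'.var .k - 2)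
    have hx : q.Z * (q.Z + cosTab q.Z (s'.var .k - 2)) / 2 ≤ q.bound := by
      refine (Nat.div_le_self _ _).trans (le_trans ?_ hZZ)
      nlinarith
    refine Halts.seq (Halts.assign (by simp) (by simpa [a3, a4] using hx) ?_)
    refine Halts.seq ((sqrt_spec (by simp) (by simpa [a3, a4] using hx)).mono fun s₂ h => ?_)
    subst h
    refine Halts.assign (by simp) (by simp; omega) ?_
    have e : s'.var .k + 1 - 2 = (s'.var .k - 2) + 1 := by omega
    simp [a3, a4, a5, a6, a7, e, cosTab]
    omega
  obtain ⟨⟨a1, a2, a3, a4, a5, a6, a7⟩, h⟩ := h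
  have hk : s₁.var .k = q.K := by
    have : q.K ≤ s₁.var .k := by simpa [a5] using h
    omega
  rw [hk] at a3
  change s₁.var .c = q.cosVal at a3
  have hx : q.Z * q.Z - q.cosVal * q.cosVal ≤ q.bound := (Nat.sub_le _ _).trans (by omega)
  refine Halts.seq (Halts.assign (by simp) (by simpa [a3, a4] using hx) ?_)
  refine Halts.seq ((sqrt_spec (by simp) (by simpa [a3, a4] using hx)).mono fun s₂ h => ?_)
  have e1 : s₂.var .s = q.sinVal := by simp [h, a3, a4, sinVal]
  have e2 : s₂.var .c = q.cosVal := by simp [h, a3]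
  have e3 : s₂.var .Z = q.Z := by simp [h, a4]
  have e4 : s₂.var .N = q.N := by simp [h, a6]
  have e5 : s₂.mem = s.mem := by rw [h]; exact a7
  clear h
  refine Halts.seq (Halts.assign (by simp) (by simp [e3]; omega) ?_)
  refine Halts.seq (Halts.assign (by simp) (by simp) ?_)
  refine Halts.seq (Halts.assign (by simp) (by simp) ?_)
  refine (twiddle_loop_spec hq (by simp) (by simp [e3]) (by simp) (by simp [e1]) (by simp [e2])
    (by simp [e3]) (by simp [e4])).mono fun s' h => ?_
  simpa [e5] using h

theorem copy_spec (hq : q.Good) (hb : s.Bdd q.bound) (hm : s.var .m = q.m) (hn : s.var .n = q.n)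
    (hN : s.var .N = q.N) :
    Halts q.bound q.space copyProg s fun s' =>
      (∀ j < q.m + q.n, s'.mem (2 * q.N + j) = s.mem j ∧ s'.mem (4 * q.N + j) = s.mem j) ∧
      ∀ l, l < 2 * q.N ∨ 6 * q.N ≤ l → s'.mem l = s.mem l := by
  have hmn := hq.len_le_two
  have hSb := hq.space_le_bound
  have hS : 20 * q.N < q.space := by have := hq.len_pos; unfold space; omega
  refine Halts.seq (Halts.assign (by simp) (by simp) ?_)
  refine (WP.while_count (T := 3) (I := fun k s' => s'.var .k = k ∧ s'.var .m = q.m ∧ s'.var .n = q.n ∧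
    s'.var .N = q.N ∧ (∀ j < k, s'.mem (2 * q.N + j) = s.mem j ∧ s'.mem (4 * q.N + j) = s.mem j) ∧
      ∀ l, l < 2 * q.N ∨ 6 * q.N ≤ l → s'.mem l = s.mem l) (q.m + q.n) ?_ ?_ ?_).halts.mono
      fun s' h => ⟨h.2.2.2.2.1, h.2.2.2.2.2⟩
  · simp [hm, hn, hN]
  · rintro k s' hk ⟨a1, a2, a3, a4, a5, a6⟩
    have hmk := a6 k (by omega)
    refine ⟨by simp, by simp [a1, a2, a3, hk], ?_⟩
    refine WP.seq (T := 1) (T' := 1 + 1) (WP.store (by simp) (by simp [a1]; omega)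
      (by simp [a1, a4]; omega) (by simp [a1, hmk, hb.mem]) ?_)
    have e1 : Function.update s'.mem (2 * q.N + k) (s.mem k) k = s.mem k := by
      rw [Function.update_of_ne (by omega), hmk]
    refine WP.seq (WP.store (by simp) (by simp [a1]; omega)
      (by simp [a1, a4]; omega) (by simp [a1, a4, hmk, e1, hb.mem]) ?_)
    refine WP.assign (by simp) (by simp [a1]; omega) ?_
    simp only [Expr.eval_add, Expr.eval_mul, Expr.eval_load, Expr.eval_var,
      Expr.eval_ofNat, St.set_var, St.put_var, St.set_mem, St.put_mem, reduceCtorEq, if_true, if_false,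
      a1, a2, a3, a4, hmk, e1, true_and]
    refine ⟨fun j hj => ?_, fun l hl => ?_⟩
    · by_cases hjk : j = k
      · subst hjk
        rw [Function.update_of_ne (by omega), Function.update_self, Function.update_self]
        exact ⟨rfl, rfl⟩
      · rw [Function.update_of_ne (by omega), Function.update_of_ne (by omega),
          Function.update_of_ne (by omega), Function.update_of_ne (by omega)]
        exact a5 j (by omega)
    · rw [Function.update_of_ne (by omega), Function.update_of_ne (by omega)]
      exact a6 l hl
  · rintro s' ⟨a1, a2, a3, -⟩
    simp [a1, a2, a3]

/-- Correctness of preprocessing. -/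
theorem init_spec {a : ℕ} (h : q.Initial a) (hb : s.Bdd q.bound) (h0 : s.var .a0 = q.m)
    (h1 : s.var .a1 = q.n) (h2 : s.var .e = q.e) :
    Halts q.bound q.space (initProg a) s
      (q.Inv (fun j => (q.twiddle j).1) (fun j => (q.twiddle j).2) s.mem) := by
  have hq := h.good
  have hB := hq.two_le_B
  have hBB := Nat.mul_le_mul_right q.B hB
  have hN := hq.N_eq
  have hmn := hq.len_le_two
  have hn := hq.n_le
  have hmB := hq.m_le
  have hp := hq.p_pos
  have h2b := hq.two_le_bound
  have htot := hq.total_le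
  have hstr := hq.B_mul_stride
  have hstr' : q.stride ≤ q.B * q.stride := Nat.le_mul_of_pos_left _ (by omega)
  refine Halts.seq ((size_spec h h0 h1).frame.mono fun s₁ h => ?_)
  obtain ⟨⟨a1, a2, a3, a4, a5, a6, a7, a8⟩, a9, a10, a11⟩ := h
  refine Halts.seq ((prime_spec h a7 (by rw [a9 _ (by simp [sizeProg, Prog.writes]), h2])).frame.mono
    fun s₂ h => ?_)
  obtain ⟨b1, b2, b3, b4⟩ := h
  have hs2 : q.Holds s₂ := by
    constructor
    case p => exact b1
    all_goals rw [b2 _ (by decide)]; assumption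
  have hb2 := b4 (a11 hb)
  have m2 : s₂.mem = s.mem := (b3 rfl).trans (a10 rfl)
  clear a1 a2 a3 a4 a5 a6 a7 a8 a9 a10 a11 b1 b2 b3 b4
  refine Halts.seq ((twiddle_spec hq hs2.Z hs2.K hs2.N).frame.mono fun s₃ h => ?_)
  obtain ⟨⟨c1, c2⟩, c3, -, c4⟩ := h
  have hs3 : q.Holds s₃ := hs2.congr fun x hx => c3 x (by
    simp only [params, List.mem_cons, List.not_mem_nil, or_false] at hx
    rcases hx with rfl | rfl | rfl | rfl | rfl | rfl | rfl | rfl | rfl <;> decide)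
  refine Halts.seq ((copy_spec hq (c4 hb2) hs3.m hs3.n hs3.N).frame.mono fun s₄ h => ?_)
  obtain ⟨⟨d1, d2⟩, d3, -, d4⟩ := h
  have hs4 : q.Holds s₄ := hs3.congr fun x hx => d3 x (by
    simp only [params, List.mem_cons, List.not_mem_nil, or_false] at hx
    rcases hx with rfl | rfl | rfl | rfl | rfl | rfl | rfl | rfl | rfl <;> decide)
  have hb4 := d4 (c4 hb2)
  rw [m2] at c2
  have f1 : ∀ j < q.m + q.n, s₄.mem (2 * q.N + j) = s.mem j := fun j hj => by
    rw [(d1 j hj).1, c2 _ (by omega)]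
  have f2 : ∀ j < q.m + q.n, s₄.mem (4 * q.N + j) = s.mem j := fun j hj => by
    rw [(d1 j hj).2, c2 _ (by omega)]
  have f3 : ∀ j < q.m + q.n, s₄.mem j = s.mem j := fun j hj => by
    rw [d2 _ (by omega), c2 _ (by omega)]
  have f4 : q.HasTwiddles (fun j => (q.twiddle j).1) (fun j => (q.twiddle j).2) s₄.mem :=
    fun j hj => by
      rw [d2 _ (by omega), d2 _ (by omega)]; exact c1 j hj
  refine Halts.seq (Halts.assign (by simp) (by simp) ?_)
  refine Halts.seq (Halts.assign (by simp) (by simp) ?_)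
  refine Halts.seq (Halts.assign (by simp) (by simp) ?_)
  refine Halts.seq (Halts.assign (by simp) (by simp) ?_)
  have eQ : (Vr.p * Vr.p * (8 * Vr.B * (3 * (Vr.K + 1) + 1)) : Expr).eval
      ((((s₄.set .yb 0).set .lo 0).set .cnt 0).set .g 0) = q.stride := by
    simp [hs4.p, hs4.B, hs4.K, stride]
  refine Halts.seq (Halts.assign (by simp) (by simp only [Expr.eval_ofNat]; rw [eQ]; omega) ?_)
  simp only [Expr.eval_ofNat]
  rw [eQ]
  refine Halts.seq (Halts.assign (by simp) (by simp) ?_)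
  simp only [Expr.eval_ofNat]
  set s₅ := St.set _ .q 0 with hs5
  have g1 : s₅.var .yb = 0 := by simp [hs5]
  have g2 : s₅.var .lo = 0 := by simp [hs5]
  have g3 : s₅.var .cnt = 0 := by simp [hs5]
  have g4 : s₅.var .g = 0 := by simp [hs5]
  have g5 : s₅.var .Q = q.stride := by simp [hs5]
  have g6 : s₅.var .q = 0 := by simp [hs5]
  have g7 : q.Holds s₅ := hs4.congr fun x hx => by
    simp only [params, List.mem_cons, List.not_mem_nil, or_false] at hx
    rcases hx with rfl | rfl | rfl | rfl | rfl | rfl | rfl | rfl | rfl <;> simp [hs5]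
  have g8 : s₅.mem = s₄.mem := rfl
  have g9 : s₅.Bdd q.bound := (((((hb4.set _ (by omega)).set _ (by omega)).set _ (by omega)).set _
    (by omega)).set _ (by omega)).set _ (by omega)
  clear_value s₅
  have hbg : q.Background (fun j => (q.twiddle j).1) (fun j => (q.twiddle j).2) s.mem s₅ := by
    refine ⟨g7, by rw [g8]; exact f4, fun j hj => by rw [g8, f1 j hj], ?_, g9⟩
    rw [g4, Nat.zero_div, Nat.zero_mod]
    exact Progress.start _ _
  refine Halts.seq ((run_spec (E := Vr.B * Vr.Q) (M := q.B * q.stride) hq hq.twiddles hbg g6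
    (fun s' e1 e2 => ⟨by simp [e1, e2, g5, g7.B], by simp⟩) (by rw [g4, hstr, zero_add])).frame.halts.mono
    fun s₆ h => ?_)
  obtain ⟨⟨i1, i2, i3⟩, i4, -, -⟩ := h
  rw [g4, zero_add, hstr] at i2
  rw [g1] at i3
  have i4 : ∀ x ∈ [Vr.yb, .lo, .cnt, .Q], s₆.var x = s₅.var x := fun x hx => i4 x (by
    simp only [List.mem_cons, List.not_mem_nil, or_false] at hx
    rcases hx with rfl | rfl | rfl | rfl <;> decide)
  have low : ∀ l < 10 * q.N, s₆.mem l = s₄.mem l := fun l hl => by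
    rw [i3 l (by omega) (by unfold resultAddr; omega), g8]
  have hP := i1.progress
  rw [i2, Nat.mul_div_cancel _ hq.len_pos, Nat.mul_mod_left, i4 .yb (by simp), g1] at hP
  -- So far `yb` was 0 and the results went to the second array; setting it to 1 makes that array
  -- the current one, and the clock restarts for the first epoch.
  refine Halts.seq (Halts.assign (by simp) (by simp; omega) ?_)
  refine Halts.assign (by simp) (by simp) ?_
  simp only [Expr.eval_ofNat]
  set s₇ := St.set _ .g 0 with hs7
  have k1 : s₇.var .yb = 1 := by simp [hs7]
  have k2 : s₇.var .lo = 0 := by simp [hs7, i4, g2]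
  have k3 : s₇.var .cnt = 0 := by simp [hs7, i4, g3]
  have k4 : s₇.var .g = 0 := by simp [hs7]
  have k5 : s₇.var .Q = q.stride := by simp [hs7, i4, g5]
  have k6 : q.Holds s₇ := i1.holds.congr fun x hx => by
    simp only [params, List.mem_cons, List.not_mem_nil, or_false] at hx
    rcases hx with rfl | rfl | rfl | rfl | rfl | rfl | rfl | rfl | rfl <;> simp [hs7]
  have k7 : s₇.mem = s₆.mem := rfl
  have k8 : s₇.Bdd q.bound := (i1.bdd.set _ (by omega)).set _ (by omega)
  clear_value s₇
  -- Initially `X`, `F` and `G` coincide and both logs are empty.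
  refine ⟨⟨s.mem, s.mem, ⟨k6, ?_, fun j hj => ?_, ?_, k8⟩, fun j hj => ?_, fun j hj => ?_, ?_, ?_,
    fun i hi => ?_, ?_, ?_, ?_, k5⟩, ?_, ?_⟩
  · rw [k7]; exact i1.twiddles
  · rw [k7]; exact i1.frozen j hj
  · rw [k4, Nat.zero_div, Nat.zero_mod]; exact Progress.start _ _
  · rw [k7, low _ (by omega), f3 j hj]
  · rw [k7, low _ (by omega), f2 j hj]
  · rw [k2]; exact ⟨fun _ => s.mem, rfl, rfl, fun k hk => absurd hk (Nat.not_lt_zero k)⟩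
  · rw [k3]; exact ⟨fun _ => s.mem, rfl, rfl, fun k hk => absurd hk (Nat.not_lt_zero k)⟩
  · have := hP.todo i 0 (by omega) (by norm_num) (Nat.zero_le _) (by positivity)
    rw [sum_corrCount hq s.mem hi] at this
    rw [k1, k7, ← this]
    rfl
  · rw [k2]; exact Nat.zero_le _
  · rw [k3]; exact Nat.zero_le _
  · rw [k1]
  · rw [k3]; omega
  · rw [k3, k4, Nat.zero_mul]

end Cfg

/-! ## The parameters -/

namespace Cfg

/-- Here `k` is least with `m ≤ 4 ^ k`, and `p` is the least prime above `2 (d + 1) e`; minimality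
gives the size estimates and identifies these numbers with what preprocessing finds. -/
theorem exists_initial (a : ℕ) {m n e : ℕ} (hm : 2 ≤ m) (hmn : m ≤ n) (hn : n ≤ 2 * m) (he : 1 ≤ e) :
    ∃ q : Cfg, q.Initial a ∧ q.m = m ∧ q.n = n ∧ q.e = e := by
  classical
  have hex : ∃ k, m ≤ 2 ^ k * 2 ^ k :=
    ⟨m, Nat.lt_two_pow_self.le.trans (Nat.le_mul_self _)⟩
  set k := Nat.find hex with hk
  have hk1 : 1 ≤ k := by
    by_contra h
    have h1 := Nat.find_spec hex
    rw [← hk, show k = 0 by omega] at h1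
    omega
  have hlt : ∀ j < k, 2 ^ j * 2 ^ j < m := fun j hj => not_le.mp (Nat.find_min hex hj)
  set d := a * (2 * k + 1) + 1 with hd
  obtain ⟨p, hp1, hp2, hmin⟩ : ∃ p, p.Prime ∧ 2 * (d + 1) * e < p ∧
      ∀ r, r.Prime → 2 * (d + 1) * e < r → p ≤ r := by
    have hex : ∃ p, p.Prime ∧ 2 * (d + 1) * e < p := by
      obtain ⟨p, h1, h2⟩ := Nat.exists_infinite_primes (2 * (d + 1) * e + 1)
      exact ⟨p, h2, h1⟩
    exact ⟨Nat.find hex, (Nat.find_spec hex).1, (Nat.find_spec hex).2,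
      fun r h1 h2 => Nat.find_min' hex ⟨h1, h2⟩⟩
  refine ⟨⟨m, n, e, 2 ^ k, 2 ^ (2 * k + 1), 2 * k + 1, 2 ^ d, d, p, (2 ^ (2 * k + 1)) ^ 31⟩,
    ⟨⟨hm, hmn, hn, Nat.find_spec hex, Nat.le_self_pow (by omega) 2, ?_, rfl, rfl, hp1, ?_, rfl⟩,
      ⟨k, rfl, rfl, hlt⟩, rfl, he, hp2, hmin⟩, rfl, rfl, rfl⟩
  · show 2 ^ (2 * k + 1) = 2 * (2 ^ k * 2 ^ k)
    rw [← pow_add, ← pow_succ']; congr 1; omega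
  · show d < p
    have : d + 1 ≤ (d + 1) * e := Nat.le_mul_of_pos_right _ he
    rw [mul_assoc] at hp2
    omega

/-! ### Sizes of the parameters -/

namespace Initial
variable {a : ℕ} {q : Cfg} (h : q.Initial a)
include h

/-- Half of `B` was still too small, by minimality of `k`. -/
theorem B_sq_lt : q.B * q.B < 4 * q.m := by
  obtain ⟨k, h1, -, h3⟩ := h.log_eq
  obtain ⟨j, rfl⟩ : ∃ j, k = j + 1 := ⟨k - 1, by
    have := h.good.two_le_B
    have : k ≠ 0 := by rintro rfl; omega
    omega⟩
  have := h3 j (Nat.lt_succ_self j)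
  rw [h1, pow_succ]
  nlinarith

theorem N_lt : q.N < 8 * q.m := by
  have := h.B_sq_lt
  rw [h.good.N_eq]; omega

/-- Bertrand's postulate bounds the least prime above `2 (d + 1) e`. -/
theorem p_le' : q.p ≤ 4 * (q.d + 1) * q.e := by
  have he := h.e_pos
  obtain ⟨r, h1, h2, h3⟩ := Nat.exists_prime_lt_and_le_two_mul (2 * (q.d + 1) * q.e)
    (by positivity)
  exact (h.p_min r h1 h2).trans (h3.trans (le_of_eq (by ring)))

theorem D_eq' : q.D = 2 * q.N ^ a := by
  rw [h.good.D_eq, h.d_eq, h.good.N_pow, ← pow_mul, pow_succ, mul_comm a, mul_comm]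

theorem alphabet_le {σ : ℕ} (hσ : σ ≤ (q.m + 1) ^ a) : σ ≤ q.D := by
  have h1 : q.m + 1 ≤ q.N := by
    have := h.good.m_le; have := h.good.N_eq; have := h.good.two_le_m; omega
  rw [h.D_eq']
  have := hσ.trans (Nat.pow_le_pow_left h1 a)
  omega

/-- With `M = m + e`, the parameters `N`, `p` and `D` are at most `M` to the powers `3`, `3 * a + 5`
and `3 * a + 1`. So words of logarithmic length suffice. -/
theorem bound_le : q.bound ≤ (q.m + q.e) ^ ((6 * a + 9) * 100) := by
  set M := q.m + q.e with hM
  have hm := h.good.two_le_m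
  have he := h.e_pos
  have hM3 : 3 ≤ M := by omega
  have hM2 : 9 ≤ M ^ 2 := by nlinarith
  have hN : q.N ≤ M ^ 3 := by
    have h1 := h.N_lt
    have h2 : 9 * M ≤ M ^ 3 := by rw [pow_succ]; exact Nat.mul_le_mul_right _ hM2
    omega
  have hNa : q.N ^ a ≤ M ^ (3 * a) := by rw [pow_mul]; exact Nat.pow_le_pow_left hN a
  have hD : q.D ≤ M ^ (3 * a + 1) := by
    rw [h.D_eq', pow_succ, mul_comm]
    exact Nat.mul_le_mul hNa (by omega)
  have hp : q.p ≤ M ^ (3 * a + 5) := by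
    have h1 : q.d + 1 ≤ 2 * q.D := by
      have : q.d < q.D := by rw [h.good.D_eq]; exact Nat.lt_two_pow_self
      omega
    calc q.p ≤ 4 * (q.d + 1) * q.e := h.p_le'
      _ ≤ 4 * (2 * q.D) * M := by gcongr; omega
      _ = 8 * M * q.D := by ring
      _ ≤ M ^ 2 * M * (M * M ^ (3 * a + 1)) := by
        gcongr
        · omega
        · exact hD.trans (Nat.le_mul_of_pos_left _ (by omega))
      _ = M ^ (3 * a + 5) := by ring
  have hprod : q.N * q.p * q.D ≤ M ^ (6 * a + 9) := by
    calc _ ≤ M ^ 3 * M ^ (3 * a + 5) * M ^ (3 * a + 1) := by gcongr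
      _ = M ^ (6 * a + 9) := by rw [← pow_add, ← pow_add]; congr 1; ring
  rw [bound, pow_mul]
  exact Nat.pow_le_pow_left hprod 100

/-- The number of steps of an update. -/
theorem update_steps_le : 1 + (q.stride * (3 * q.d + 18) + 8 * q.B + 17) ≤
    (640 * (a + 1) ^ 2 * (3 * a + 7) + 26) * (q.K ^ 4 * q.e ^ 2 * q.B) := by
  have hK := h.good.three_le_K
  have he := h.e_pos
  have hB := h.good.two_le_B
  have h1 : q.p ≤ 4 * ((a + 1) * q.K) * q.e := by
    refine h.p_le'.trans ?_
    gcongr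
    rw [h.d_eq]; nlinarith
  have h2 : 3 * q.d + 18 ≤ (3 * a + 7) * q.K := by rw [h.d_eq]; nlinarith
  -- Two factors `p` give `4 * 4`, the definition of `stride` gives 8, and `3 * (K + 1) + 1 ≤ 5 * K`
  -- gives 5; their product is 640.
  have h3 : q.stride ≤ 640 * (a + 1) ^ 2 * (q.K ^ 3 * q.e ^ 2 * q.B) := by
    calc q.stride ≤ (4 * ((a + 1) * q.K) * q.e) * (4 * ((a + 1) * q.K) * q.e) *
        (8 * q.B * (5 * q.K)) := by unfold stride; gcongr; omega
      _ = _ := by ring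
  have h4 : q.stride * (3 * q.d + 18) ≤
      640 * (a + 1) ^ 2 * (3 * a + 7) * (q.K ^ 4 * q.e ^ 2 * q.B) :=
    (Nat.mul_le_mul h3 h2).trans (le_of_eq (by ring))
  have h5 : q.B ≤ q.K ^ 4 * q.e ^ 2 * q.B := Nat.le_mul_of_pos_left _ (by positivity)
  rw [add_mul]
  omega

/-- The number of steps of a query. -/
theorem query_steps_le : 2 * (q.B * (q.p * (9 * q.d + 13) + 11)) + 7 ≤
    (8 * (a + 1) * (9 * a + 8) + 29) * (q.K ^ 4 * q.e ^ 2 * q.B) := by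
  have hK := h.good.three_le_K
  have he := h.e_pos
  have hB := h.good.two_le_B
  have h1 : q.p ≤ 4 * ((a + 1) * q.K) * q.e := by
    refine h.p_le'.trans ?_
    gcongr
    rw [h.d_eq]; nlinarith
  have h2 : 9 * q.d + 13 ≤ (9 * a + 8) * q.K := by rw [h.d_eq]; nlinarith
  have h3 : q.K ^ 2 * q.e ≤ q.K ^ 4 * q.e ^ 2 :=
    Nat.mul_le_mul (Nat.pow_le_pow_right (by omega) (by norm_num)) (Nat.le_self_pow (by norm_num) _)
  have h4 : q.B * (q.p * (9 * q.d + 13)) ≤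
      4 * (a + 1) * (9 * a + 8) * (q.K ^ 4 * q.e ^ 2 * q.B) := by
    calc _ ≤ q.B * ((4 * ((a + 1) * q.K) * q.e) * ((9 * a + 8) * q.K)) := by gcongr
      _ = 4 * (a + 1) * (9 * a + 8) * (q.K ^ 2 * q.e * q.B) := by ring
      _ ≤ _ := by gcongr
  have h5 : q.B ≤ q.K ^ 4 * q.e ^ 2 * q.B := Nat.le_mul_of_pos_left _ (by positivity)
  -- The constant 29 absorbs the remaining `22 * B + 7`.
  have h6 : (8 * (a + 1) * (9 * a + 8) + 29) * (q.K ^ 4 * q.e ^ 2 * q.B) =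
    2 * (4 * (a + 1) * (9 * a + 8) * (q.K ^ 4 * q.e ^ 2 * q.B)) +
      29 * (q.K ^ 4 * q.e ^ 2 * q.B) := by ring
  rw [h6, mul_add]
  omega

/-- From `2 ^ K = N < 8 * m ≤ m ^ 4` and `4 / log 2 < 6`. -/
theorem K_le : (q.K : ℝ) ≤ 6 * Real.log q.m := by
  have hm : (2 : ℝ) ≤ q.m := by exact_mod_cast h.good.two_le_m
  have hN : (2 : ℝ) ^ q.K ≤ 8 * q.m := by
    have := h.N_lt.le
    rw [h.good.N_pow] at this
    exact_mod_cast this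
  have h1 := Real.log_le_log (by positivity) hN
  rw [Real.log_pow, Real.log_mul (by norm_num) (by positivity),
    show (8 : ℝ) = 2 ^ 3 by norm_num, Real.log_pow] at h1
  have h2 := Real.log_le_log (by norm_num) hm
  have h3 := Real.log_two_gt_d9
  push_cast at h1
  nlinarith [Nat.cast_nonneg (α := ℝ) q.K]

theorem B_le : (q.B : ℝ) ≤ 2 * √q.m := by
  have h1 : ((q.B : ℝ)) ^ 2 ≤ 4 * q.m := by
    have := h.B_sq_lt.le
    rw [← pow_two] at this
    exact_mod_cast this
  have h2 := Real.le_sqrt_of_sq_le h1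
  rwa [Real.sqrt_mul (by norm_num), show (4 : ℝ) = 2 ^ 2 by norm_num,
    Real.sqrt_sq (by norm_num)] at h2

/-- The space is exactly `N * (36 + 12 * K)`, already of order `m * log m`; the second logarithm and
the factor `(1 / ε) ^ 2` are slack. -/
theorem space_le_real {ε : ℝ} (hε : 0 < ε) (hε1 : ε ≤ 1) :
    (q.space : ℝ) ≤ 1600 * (1 / ε) ^ 2 * q.m * Real.log q.m ^ 2 := by
  have hm : (2 : ℝ) ≤ q.m := by exact_mod_cast h.good.two_le_m
  have hK := h.K_le
  have hN : (q.N : ℝ) ≤ 8 * q.m := by exact_mod_cast h.N_lt.le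
  have hL : 0.69 ≤ Real.log q.m :=
    le_trans (by have := Real.log_two_gt_d9; linarith) (Real.log_le_log (by norm_num) hm)
  have h1 : (1 : ℝ) ≤ (1 / ε) ^ 2 := one_le_pow₀ (by rw [le_div_iff₀ hε]; linarith)
  have e : (q.space : ℝ) = q.N * (36 + 12 * q.K) := by
    unfold space len; push_cast; ring
  have h2 : (36 + 12 * q.K : ℝ) ≤ 200 * Real.log q.m ^ 2 := by nlinarith
  calc (q.space : ℝ) = q.N * (36 + 12 * q.K) := e
    _ ≤ 8 * q.m * (200 * Real.log q.m ^ 2) := by gcongr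
    _ = 1 * (1600 * q.m * Real.log q.m ^ 2) := by ring
    _ ≤ (1 / ε) ^ 2 * (1600 * q.m * Real.log q.m ^ 2) := by gcongr
    _ = _ := by ring

theorem steps_le_real {ε : ℝ} (hε : 0 < ε) (hε1 : ε ≤ 1) (he : q.e = ⌈1 / ε⌉₊) :
    ((q.K ^ 4 * q.e ^ 2 * q.B : ℕ) : ℝ) ≤ 10368 * (1 / ε) ^ 2 * √q.m * Real.log q.m ^ 4 := by
  have h1 : (1 : ℝ) ≤ 1 / ε := by rw [le_div_iff₀ hε]; linarith
  have h2 : (q.e : ℝ) ≤ 2 * (1 / ε) := by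
    rw [he]
    have := Nat.ceil_lt_add_one (show (0 : ℝ) ≤ 1 / ε by positivity)
    linarith
  have hK := h.K_le
  have hB := h.B_le
  push_cast
  -- The constant is `6 ^ 4 * 2 ^ 2 * 2`.
  calc (q.K : ℝ) ^ 4 * q.e ^ 2 * q.B ≤
      (6 * Real.log q.m) ^ 4 * (2 * (1 / ε)) ^ 2 * (2 * √q.m) := by gcongr
    _ = _ := by ring

end Initial

/-! ## The operations on the machine -/

/-- The machine state `l` represents the pattern `P` and the text `T`. -/
def Represents (q : Cfg) {m n σ : ℕ} (P : Fin m → Fin σ) (T : Fin n → Fin σ) (l : RamState) : Prop :=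
  ∃ (X : ℕ → ℕ) (s : St), Sim s l ∧
    q.Inv (fun j => (q.twiddle j).1) (fun j => (q.twiddle j).2) X s ∧
    (∀ j : Fin m, X j = P j) ∧ ∀ j : Fin n, X (m + j) = T j

variable {q : Cfg} {tc ts X : ℕ → ℕ} {s : St}

theorem Inv.bdd (h : q.Inv tc ts X s) : s.Bdd q.bound := by
  obtain ⟨⟨F, G, h⟩, -⟩ := h
  exact h.background.bdd

theorem Inv.congr (hq : q.Good) (h : q.Inv tc ts X s) {s' : St}
    (hv : ∀ x ∈ persistent, s'.var x = s.var x) (hm : s'.mem = s.mem) (hb : s'.Bdd q.bound) :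
    q.Inv tc ts X s' := by
  obtain ⟨⟨F, G, h1⟩, h2, h3⟩ := h
  refine ⟨⟨F, G, h1.congr hq hv hm hb⟩, ?_, ?_⟩
  · rw [hv _ (by decide)]; exact h2
  · rw [hv .g (by decide), hv .cnt (by decide)]; exact h3

theorem Inv.set (hq : q.Good) (h : q.Inv tc ts X s) {x : Vr} (hx : x ∉ persistent) {v : ℕ}
    (hv : v ≤ q.bound) : q.Inv tc ts X (s.set x v) :=
  h.congr hq (fun y hy => by rw [St.set_var, if_neg (by rintro rfl; exact hx hy)]) rfl
    (h.bdd.set _ hv)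

end Cfg

theorem Sim.setReg {s : St} {l : RamState} (h : Sim s l) (x : Vr) (v : ℕ) :
    Sim (s.set x v) (l.setReg x.reg v) := by
  refine ⟨fun y => ?_, h.mem⟩
  simp only [RamState.setReg, Function.update_apply, St.set_var, Vr.reg_injective.eq_iff, h.var]

theorem WP.exec {w V S T : ℕ} (hV : 2 ≤ V) {p : Prog} {s : St} {R : St → Prop} (h : WP V S p s T R)
    (hs : s.Bdd V) (hw : V ^ p.deg < 2 ^ w) {l : RamState} (hl : Sim s l) :
    ∃ l' t, Exec w S p.code l l' t ∧ t ≤ p.cost * T ∧ ∃ s', Sim s' l' ∧ R s' := by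
  obtain ⟨s', t, h1, h2, h3⟩ := h
  obtain ⟨l', t', a1, a2, a3⟩ := h1.code_exec hV hs hw le_rfl hl
  exact ⟨l', t', a1, a2.trans (Nat.mul_le_mul_left _ h2), s', a3, h3⟩

namespace Cfg
variable {q : Cfg} {n σ w : ℕ} {P : Fin q.m → Fin σ} {T : Fin q.n → Fin σ} {l : RamState}

theorem Represents.init {a : ℕ} (h : q.Initial a) (hσ : σ ≤ q.D)
    (hw : q.bound ^ (initProg a).deg < 2 ^ w) (P : Fin q.m → Fin σ) (T : Fin q.n → Fin σ) :
    ∃ l t, Exec w q.space (hammingData a).init (inputState q.e P T) l t ∧ q.Represents P T l := by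
  have hq := h.good
  have hD := hq.D_le
  have hN := hq.N_lt_bound
  have hmn := hq.len_le_two
  have hN2 := hq.N_eq
  have hm := hq.m_le
  have hmn' := hq.m_le_n
  have hn := hq.n_le
  have hep : q.e ≤ q.bound := by
    have h1 := h.lt_p
    have h2 := hq.p_le
    have : q.e ≤ 2 * (q.d + 1) * q.e := Nat.le_mul_of_pos_left _ (by positivity)
    omega
  set s : St := ⟨fun x => (inputState q.e P T).reg x.reg, (inputState q.e P T).mem⟩ with hs
  have hb : s.Bdd q.bound := by
    constructor
    · intro x
      simp only [hs, inputState]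
      split_ifs <;> omega
    · intro j
      simp only [hs, inputState]
      split_ifs with h1 h2
      · have := (P ⟨j, h1⟩).isLt; omega
      · have := (T ⟨j - q.m, h2⟩).isLt; omega
      · omega
  obtain ⟨s', t, h1, h2⟩ := init_spec h hb rfl rfl rfl
  obtain ⟨l, t', a1, -, a3⟩ := h1.code_exec hq.two_le_bound hb hw le_rfl
    (l := inputState q.e P T) ⟨fun _ => rfl, rfl⟩
  refine ⟨l, t', a1, s.mem, s', a3, h2, fun j => ?_, fun j => ?_⟩
  · simp [hs, inputState]
  · simp [hs, inputState]

/-- The additional step pays for shifting a text position by `m`; it is granted to pattern updates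
too, for a uniform bound. -/
theorem Represents.update (hq : q.Good) (hσ : σ ≤ q.D)
    (hw : q.bound ^ updateTextProg.deg < 2 ^ w) (h : q.Represents P T l) :
    (∀ (j : Fin q.m) (x : Fin σ), ∃ l' t,
      Exec w q.space updateProg.code ((l.setReg 0 j).setReg 1 x) l' t ∧
      t ≤ updateProg.cost * (1 + (q.stride * (3 * q.d + 18) + 8 * q.B + 17)) ∧
      q.Represents (Function.update P j x) T l') ∧
    ∀ (j : Fin q.n) (x : Fin σ), ∃ l' t,
      Exec w q.space updateTextProg.code ((l.setReg 0 j).setReg 1 x) l' t ∧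
      t ≤ updateTextProg.cost * (1 + (q.stride * (3 * q.d + 18) + 8 * q.B + 17)) ∧
      q.Represents P (Function.update T j x) l' := by
  obtain ⟨X, s, h1, h2, h3, h4⟩ := h
  have hD := hq.D_le
  have hN := hq.N_lt_bound
  have hN2 := hq.N_eq
  have hm := hq.m_le
  have hn := hq.n_le
  have h2b := hq.two_le_bound
  have hmn := hq.len_le_two
  have hsp : 20 * q.N ≤ q.bound := le_trans (by unfold space; omega) hq.space_le_bound
  have hset : ∀ (j x : ℕ), j ≤ q.bound → x ≤ q.bound →
      Sim ((s.set .a0 j).set .a1 x) ((l.setReg 0 j).setReg 1 x) ∧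
      q.Inv (fun j => (q.twiddle j).1) (fun j => (q.twiddle j).2) X ((s.set .a0 j).set .a1 x) :=
    fun j x hj hx => ⟨(h1.setReg .a0 j).setReg .a1 x,
      (h2.set hq (by decide) hj).set hq (by decide) hx⟩
  constructor
  · intro j x
    have hj := j.isLt
    have hx := x.isLt
    obtain ⟨b1, b2⟩ := hset j x (by omega) (by omega)
    have hw' : q.bound ^ updateProg.deg < 2 ^ w :=
      lt_of_le_of_lt (Nat.pow_le_pow_right (by omega) (le_max_right _ _)) hw
    obtain ⟨l', t, c1, c2, s', c3, c4⟩ := ((update_spec hq hq.twiddles b2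
      (by simp; omega)).mono (Nat.le_add_left _ 1) fun _ h => h).exec h2b b2.bdd hw' b1
    refine ⟨l', t, c1, c2, _, s', c3, c4, fun i => ?_, fun i => ?_⟩
    · simp only [St.set_var, reduceCtorEq, if_true, if_false]
      by_cases hi : i = j
      · simp [hi]
      · rw [Function.update_of_ne (fun h => hi (Fin.ext h)), Function.update_of_ne hi, h3]
    · simp only [St.set_var, reduceCtorEq, if_true, if_false]
      rw [Function.update_of_ne (by omega), h4]
  · intro j x
    have hj := j.isLt
    have hx := x.isLt
    obtain ⟨b1, b2⟩ := hset j x (by omega) (by omega)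
    have hm' : ((s.set .a0 j).set .a1 x).var .m = q.m := by
      obtain ⟨⟨F, G, h⟩, -⟩ := b2
      exact h.background.holds.m
    have hv : (Vr.m + Vr.a0 : Expr).eval ((s.set .a0 j).set .a1 x) = q.m + j := by
      rw [Expr.eval_add, Expr.eval_var, hm']; simp
    have hup : WP q.bound q.space updateTextProg ((s.set .a0 j).set .a1 x)
        (1 + (q.stride * (3 * q.d + 18) + 8 * q.B + 17))
        (q.Inv (fun j => (q.twiddle j).1) (fun j => (q.twiddle j).2)
          (Function.update X (q.m + j) x)) := by
      refine WP.seq (WP.assign (by simp) (by rw [hv]; omega) ?_)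
      rw [hv]
      have := update_spec hq hq.twiddles (b2.set hq (x := .a0) (v := q.m + j) (by decide) (by omega))
        (by simp)
      simpa using this
    obtain ⟨l', t, c1, c2, s', c3, c4⟩ := hup.exec h2b b2.bdd hw b1
    refine ⟨l', t, c1, c2, _, s', c3, c4, fun i => ?_, fun i => ?_⟩
    · rw [Function.update_of_ne (by omega), h3]
    · by_cases hi : i = j
      · simp [hi]
      · rw [Function.update_of_ne (fun h => hi (Fin.ext (by omega))), Function.update_of_ne hi, h4]

/-- A query assigns only to scratch variables and stores nothing, so the invariant carries over
unchanged. -/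
theorem Represents.query {a : ℕ} (h : q.Initial a) (hσ : σ ≤ q.D) {ε : ℝ} (hε : 0 < ε) (hε1 : ε ≤ 1)
    (he : q.e = ⌈1 / ε⌉₊) (hw : q.bound ^ queryProg.deg < 2 ^ w) (hr : q.Represents P T l) {i : ℕ}
    (hi : i + q.m ≤ q.n) :
    ∃ l' t, Exec w q.space queryProg.code (l.setReg 0 i) l' t ∧
      t ≤ queryProg.cost * (2 * (q.B * (q.p * (9 * q.d + 13) + 11)) + 7) ∧ q.Represents P T l' ∧
      (hammingDist P (window T i hi) : ℝ) ≤ l'.reg 0 ∧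
      (l'.reg 0 : ℝ) ≤ (1 + ε) * hammingDist P (window T i hi) := by
  have hq := h.good
  obtain ⟨X, s, h1, h2, h3, h4⟩ := hr
  have hN := hq.N_lt_bound
  have hN2 := hq.N_eq
  have hm := hq.m_le
  have hn := hq.n_le
  have b1 := h1.setReg .a0 i
  have b2 := h2.set hq (x := .a0) (v := i) (by decide) (by omega)
  obtain ⟨F, G, hcore⟩ := b2.core
  obtain ⟨l', t, c1, c2, s', c3, c4, c5, c6, c7⟩ :=
    (query_spec hq hcore (by simpa using hi)).frame.exec hq.two_le_bound b2.bdd hw b1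
  refine ⟨l', t, c1, c2, ⟨X, s', c3, b2.congr hq (fun x hx => c5 x ?_) (c6 rfl) (c7 b2.bdd), h3, h4⟩, ?_⟩
  · revert x; decide
  have hval : l'.reg 0 = (q.p * q.m - q.matchSum X X i) / (q.p - q.d) := by
    rw [show (0 : ℕ) = Vr.reg .a0 from rfl, c3.var, c4]; simp
  have hP : ∀ j < q.m, X j < 2 ^ q.d := fun j hj => by
    have := (P ⟨j, hj⟩).isLt
    rw [h3 ⟨j, hj⟩, ← hq.D_eq]; omega
  have hT : ∀ j < q.m, X (q.m + i + j) < 2 ^ q.d := fun j hj => by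
    have := (T ⟨i + j, by omega⟩).isLt
    rw [add_assoc, h4 ⟨i + j, by omega⟩, ← hq.D_eq]; omega
  have hH : hammingDist P (window T i hi) =
      ((Finset.range q.m).filter fun j => X j ≠ X (q.m + i + j)).card := by
    rw [hammingDist, Finset.card_filter, Finset.card_filter, Finset.sum_range]
    refine Finset.sum_congr rfl fun j _ => ?_
    have e := h4 ⟨i + j, by omega⟩
    simp only [← add_assoc] at e
    rw [h3, e, window]
    simp [Fin.ext_iff]
  obtain ⟨d1, d2⟩ := mismatches_approx hq.prime X (fun j => X (q.m + i + j)) hP hT hH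
  rw [hval]
  exact answer_bounds hε hε1 (by rw [he]; exact Nat.le_ceil _) h.lt_p d1 d2

/-- `Reaches` admits any halting execution, while the specifications construct one; determinism of
the machine identifies the two. -/
theorem Represents.of_reaches {a : ℕ} (h : q.Initial a) (hσ : σ ≤ q.D) {ε : ℝ} (hε : 0 < ε)
    (hε1 : ε ≤ 1) (he : q.e = ⌈1 / ε⌉₊) (hw1 : q.bound ^ (initProg a).deg < 2 ^ w)
    (hw2 : q.bound ^ updateTextProg.deg < 2 ^ w) (hw3 : q.bound ^ queryProg.deg < 2 ^ w)
    {P₀ : Fin q.m → Fin σ} {T₀ : Fin q.n → Fin σ}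
    (hr : (hammingData a).Reaches w q.space q.e P₀ T₀ P T l) : q.Represents P T l := by
  induction hr with
  | init hx =>
    obtain ⟨l', t, b1, b2⟩ := Represents.init h hσ hw1 P₀ T₀
    rwa [(hx.deterministic b1).1]
  | updatePattern j x _ hx ih =>
    obtain ⟨l', t, b1, -, b2⟩ := (ih.update h.good hσ hw2).1 j x
    rwa [(hx.deterministic b1).1]
  | updateText j x _ hx ih =>
    obtain ⟨l', t, b1, -, b2⟩ := (ih.update h.good hσ hw2).2 j x
    rwa [(hx.deterministic b1).1]
  | query i hi _ hx ih =>
    obtain ⟨l', t, b1, -, b2, -⟩ := ih.query h hσ hε hε1 he hw3 hi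
    rwa [(hx.deterministic b1).1]

end Cfg

theorem mainTheorem8 (a : ℕ) :
    ∃ (D : DynProgram) (c k : ℕ) (C : ℝ),
      ∀ (m n σ w : ℕ) (ε : ℝ), 2 ≤ m → m ≤ n → n ≤ 2 * m → σ ≤ (m + 1) ^ a →
        0 < ε → ε ≤ 1 → (m + ⌈1 / ε⌉₊) ^ c ≤ 2 ^ w →
        ∃ S : ℕ, (S : ℝ) ≤ C * (1 / ε) ^ 2 * m * Real.log m ^ 2 ∧
          D.SolvesApproxHD w S (C * (1 / ε) ^ 2 * Real.sqrt m * Real.log m ^ k) m n σ ε := by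
  -- The degrees and costs of the compiled programs depend on `a` only, so they may enter the
  -- constants.
  obtain ⟨δ, hδ1, hδ2, hδ3⟩ : ∃ δ, (initProg a).deg ≤ δ ∧ updateTextProg.deg ≤ δ ∧
      queryProg.deg ≤ δ :=
    ⟨max (initProg a).deg (max updateTextProg.deg queryProg.deg), le_max_left _ _,
      (le_max_left _ _).trans (le_max_right _ _), (le_max_right _ _).trans (le_max_right _ _)⟩
  obtain ⟨κ, hκ1, hκ2, hκ3⟩ : ∃ κ, updateProg.cost ≤ κ ∧ updateTextProg.cost ≤ κ ∧
      queryProg.cost ≤ κ :=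
    ⟨max updateProg.cost (max updateTextProg.cost queryProg.cost), le_max_left _ _,
      (le_max_left _ _).trans (le_max_right _ _), (le_max_right _ _).trans (le_max_right _ _)⟩
  obtain ⟨M, hMl, hMr⟩ : ∃ M, 640 * (a + 1) ^ 2 * (3 * a + 7) + 26 ≤ M ∧
      8 * (a + 1) * (9 * a + 8) + 29 ≤ M := ⟨_, le_max_left _ _, le_max_right _ _⟩
  -- The bound on values is at most `(m + e) ^ ((6 * a + 9) * 100)`, intermediate results raise it
  -- to the power `δ`, and the additional 1 in the exponent makes the inequality with `2 ^ w`
  -- strict. The four logarithms in the time come from `K ^ 4`.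
  refine ⟨hammingData a, (6 * a + 9) * 100 * δ + 1, 4, 1600 + κ * M * 10368, ?_⟩
  intro m n σ w ε hm hmn hn hσ hε hε1 hw
  have he1 : 1 ≤ ⌈1 / ε⌉₊ := Nat.one_le_ceil_iff.mpr (by positivity)
  obtain ⟨q, h, rfl, rfl, he⟩ := Cfg.exists_initial a hm hmn hn he1
  have hq := h.good
  have hL : 0 ≤ Real.log q.m := Real.log_natCast_nonneg _
  have hσD := h.alphabet_le hσ
  have hδw : q.bound ^ δ < 2 ^ w := by
    refine lt_of_lt_of_le ?_ hw
    rw [← he]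
    refine lt_of_le_of_lt (Nat.pow_le_pow_left h.bound_le δ) ?_
    rw [← pow_mul]
    exact Nat.pow_lt_pow_right (by omega) (Nat.lt_succ_self _)
  have hdeg : ∀ j ≤ δ, q.bound ^ j < 2 ^ w := fun j hj =>
    lt_of_le_of_lt (Nat.pow_le_pow_right (by have := hq.two_le_bound; omega) hj) hδw
  have hw1 := hdeg _ hδ1
  have hw2 := hdeg _ hδ2
  have hw3 := hdeg _ hδ3
  have htime : ∀ {t c T : ℕ}, t ≤ c * T → c ≤ κ → T ≤ M * (q.K ^ 4 * q.e ^ 2 * q.B) →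
      (t : ℝ) ≤ (1600 + κ * M * 10368) * (1 / ε) ^ 2 * √q.m * Real.log q.m ^ 4 := by
    intro t c T h1 h2 h3
    have h4 : t ≤ κ * (M * (q.K ^ 4 * q.e ^ 2 * q.B)) := h1.trans (Nat.mul_le_mul h2 h3)
    calc (t : ℝ) ≤ κ * (M * ((q.K ^ 4 * q.e ^ 2 * q.B : ℕ) : ℝ)) := by exact_mod_cast h4
      _ ≤ κ * (M * (10368 * (1 / ε) ^ 2 * √q.m * Real.log q.m ^ 4)) := by
        gcongr; exact h.steps_le_real hε hε1 he
      _ = (κ * M * 10368) * ((1 / ε) ^ 2 * √q.m * Real.log q.m ^ 4) := by ring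
      _ ≤ (1600 + κ * M * 10368) * ((1 / ε) ^ 2 * √q.m * Real.log q.m ^ 4) := by
        gcongr; linarith
      _ = _ := by ring
  have hup := h.update_steps_le
  have hqu := h.query_steps_le
  replace hup := hup.trans (Nat.mul_le_mul_right _ hMl)
  replace hqu := hqu.trans (Nat.mul_le_mul_right _ hMr)
  refine ⟨q.space, (h.space_le_real hε hε1).trans ?_, ?_⟩
  · gcongr
    have : (0 : ℝ) ≤ κ * M * 10368 := by positivity
    linarith
  intro P₀ T₀
  rw [← he]
  constructor
  · obtain ⟨l, t, b1, -⟩ := Cfg.Represents.init h hσD hw1 P₀ T₀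
    exact ⟨l, t, b1⟩
  · intro P T l hr
    have hrep := Cfg.Represents.of_reaches h hσD hε hε1 he hw1 hw2 hw3 hr
    refine ⟨fun j x => ?_, fun j x => ?_, fun i hi => ?_⟩
    · obtain ⟨l', t, b1, b2, -⟩ := (hrep.update hq hσD hw2).1 j x
      exact ⟨l', t, b1, htime b2 hκ1 hup⟩
    · obtain ⟨l', t, b1, b2, -⟩ := (hrep.update hq hσD hw2).2 j x
      exact ⟨l', t, b1, htime b2 hκ2 hup⟩
    · obtain ⟨l', t, b1, b2, -, b3⟩ := hrep.query h hσD hε hε1 he hw3 hi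
      exact ⟨l', t, b1, htime b2 hκ3 hqu, b3⟩
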